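/- Let $0<\alpha<1$ and let $\Omega\subset\mathbb{C}$ be a bounded simply connected domain of class $C^{1,\alpha}$ (that is, $\partial\Omega$ is locally the graph of a function of class $C^{1,\alpha}$, with $\Omega$ lying on one side of it). Let $\ell$ be a line (the axis), let $\zeta_c\in\Omega\cap\ell$, and let $\zeta_b\in\partial\Omega\cap\ell$ be an intersection point of the axis with the boundary. Let $U$ be the Green's function of $\Omega$ with pole $\zeta_c$, that is, the solution of $-\Delta U=\delta_{\zeta_c}$ in $\Omega$, $U=0$ on $\partial\Omega$. Let $L=|\partial\Omega|$, and for $s\in[0,L]$ let $\varphi(s)$ be the interior normal derivative $\partial U/\partial\nu$ at the point of $\partial\Omega$ whose arclength, measured counterclockwise along $\partial\Omega$ starting from $\zeta_b$, is $s$. Then $\Omega$ is symmetric with respect to $\ell$ (it is mapped onto itself by the reflection in $\ell$) if and only if $$\varphi(s)=\varphi(L-s)\qquad\text{for all } s\in[0,L].$$ -/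

import Mathlib

open Set Complex
open scoped NNReal Topology

noncomputable section

/-- A set in the plane has boundary of class `C^{1,α}`: near each boundary point `p`, in the
rectangular coordinates `x + i y = e⁻¹ (z - p)` given by a rotation `e`, the set is the region
above the graph `y = h x` of a function `h` of class `C^{1,α}`. -/
def HasC1HolderBoundary (α : ℝ≥0) (Ω : Set ℂ) : Prop :=
  ∀ p ∈ frontier Ω, ∃ (e : ℂ) (h : ℝ → ℝ) (C : ℝ≥0) (r : ℝ),
    ‖e‖ = 1 ∧ ContDiff ℝ 1 h ∧ HolderWith C α (deriv h) ∧ 0 < r ∧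
    ∀ z ∈ Metric.ball p r,
      (z ∈ Ω ↔ h ((starRingEnd ℂ e * (z - p)).re) < (starRingEnd ℂ e * (z - p)).im)

/-- Bounded simply connected planar domains of class `C^{1,α}`. -/
structure IsC1HolderDomain (α : ℝ≥0) (Ω : Set ℂ) : Prop where
  isOpen : IsOpen Ω
  isBounded : Bornology.IsBounded Ω
  isSimplyConnected : IsSimplyConnected Ω
  boundary : HasC1HolderBoundary α Ω

/-- `U` is the Green's function of `Ω` with pole `ζ`, that is the solution of
`-Δ U = δ_ζ` in `Ω`, `U = 0` on `∂Ω`: it is the sum of the fundamental solution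
`-(1 / 2π) log |z - ζ|` and a harmonic function in `Ω`, it is continuous up to the boundary
(away from the pole), and it vanishes on the boundary. -/
structure IsGreenFunction (Ω : Set ℂ) (ζ : ℂ) (U : ℂ → ℝ) : Prop where
  exists_harmonic : ∃ H : ℂ → ℝ, InnerProductSpace.HarmonicOnNhd H Ω ∧
    ∀ z ∈ Ω, z ≠ ζ → U z = -(1 / (2 * Real.pi)) * Real.log ‖z - ζ‖ + H z
  continuousOn : ContinuousOn U (closure Ω \ {ζ})
  eq_zero : ∀ z ∈ frontier Ω, U z = 0

/-- `γ` is the parametrization of the closed curve `∂Ω` by arclength, measured counterclockwise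
starting from `b`, and `L` is the perimeter: `γ` is `C^1` with unit speed, it is `L`-periodic and
runs through `∂Ω` exactly once on `[0, L)`, and it is positively oriented, that is `i γ'`
points into `Ω`. -/
structure IsCounterclockwiseArclengthParam (Ω : Set ℂ) (b : ℂ) (L : ℝ) (γ : ℝ → ℂ) : Prop where
  length_pos : 0 < L
  contDiff : ContDiff ℝ 1 γ
  norm_deriv : ∀ s, ‖deriv γ s‖ = 1
  periodic : Function.Periodic γ L
  injOn : InjOn γ (Ico 0 L)
  image_eq : γ '' Ico 0 L = frontier Ω
  start : γ 0 = b
  interior_left : ∀ s, ∃ ε > 0, ∀ t ∈ Ioo (0 : ℝ) ε, γ s + t * (I * deriv γ s) ∈ Ω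

/-- The function `U` has at the boundary point `p` the derivative `d` in the direction `ν` (the
interior unit normal at `p`), as a one-sided derivative from inside the domain. -/
def HasInteriorNormalDeriv (U : ℂ → ℝ) (p ν : ℂ) (d : ℝ) : Prop :=
  HasDerivWithinAt (fun t : ℝ => U (p + t * ν)) d (Ici 0) 0

/-- `φ` is the interior normal derivative of `U` on the boundary curve `γ` of length `L`, as a
function of the arclength `s ∈ [0, L]`. The interior unit normal at `γ s` is `i γ'(s)`. -/
def IsNormalDerivAlong (U : ℂ → ℝ) (γ : ℝ → ℂ) (L : ℝ) (φ : ℝ → ℝ) : Prop :=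
  ∀ s ∈ Icc 0 L, HasInteriorNormalDeriv U (γ s) (I * deriv γ s) (φ s)

end

/-! Let `G` be the Riemann map of the domain with `G c = 0` and `G b = 1`. Then `U = -(1 / 2π) log
|G|`, and along the boundary `d/ds G(γ s) = 2π i φ(s) G(γ s)`: up to the factor `2π`, the normal
derivative is the speed of `arg G` with respect to arclength
(`IsRegularRiemannMap.hasDerivAt_boundary`).

Suppose that `φ` is symmetric. Then `G(γ(L - s)) G(γ s)` is constant, equal to `1`, so conjugation
on the unit circle corresponds to `s ↦ -s` on the curve. Let `f = G⁻¹`, let `R` be the reflection,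
and let `F w = R (f (conj w))`, again holomorphic. On the circle `f` runs through `γ s` and `F`
through `R γ(-s)`, both at the same arclength speed, so formally `|F'| = |f'|` there, hence `F'/f'`
is a unimodular constant and `F = k f + a`. The values at `0` and `1` are `c` and `b` for both maps,
so `F = f`, which is the symmetry of the domain.

No continuity of `f'` up to the boundary is used. Instead, difference quotients `(F(lw) - F(w)) /
(f(lw) - f(w))` under a small rotation `l` are estimated on the circle, where arc and chord agree to
first order, and then inside by the maximum principle (`norm_deriv_le_of_boundary`). This gives
`|F'| ≤ |f'|`, and the reverse inequality follows by conjugating the argument.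

The boundary behaviour of `G` comes from barriers `Re (ω ± A ω^(1+α))`. They bound `U` linearly, so
Schwarz–Pick makes `G` Lipschitz up to the boundary; they also give Hopf's lemma `φ > 0`, from which
`G` is injective on the boundary. A blow-up at a boundary point has a linear limit by
Phragmén–Lindelöf, which yields the tangential derivative.

Conversely, in a symmetric domain the reflected curve run backwards is again the arclength
parametrization from `b`, so it equals `γ` by uniqueness; `U` is symmetric because `G` and its
reflection give the same Green function. Both inward normals at corresponding points then see the
same values of `U`. -/

open Filter Metric InnerProductSpace

/-! ### Normal families along ultrafilters, and Hurwitz' theorem. -/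

/-- A pointwise limit of locally equi-Lipschitz functions is locally uniform. -/
theorem tendstoLocallyUniformlyOn_of_lipschitz {ι : Type*} {l : Filter ι} [l.NeBot]
    {F : ι → ℂ → ℂ} {g : ℂ → ℂ} {V : Set ℂ}
    (hlip : ∀ x ∈ V, ∃ N ∈ 𝓝 x, ∃ K : ℝ, ∀ᶠ i in l, ∀ y ∈ N, ∀ y' ∈ N,
      ‖F i y - F i y'‖ ≤ K * ‖y - y'‖)
    (hpt : ∀ x ∈ V, Tendsto (fun i => F i x) l (𝓝 (g x))) :
    TendstoLocallyUniformlyOn F g l V := by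
  rw [Metric.tendstoLocallyUniformlyOn_iff]
  intro ε hε x hx
  obtain ⟨N, hN, K, hK⟩ := hlip x hx
  set K' := max K 0 with hK'
  have hK'0 : 0 ≤ K' := le_max_right _ _
  have hgl : ∀ y ∈ N ∩ V, ‖g y - g x‖ ≤ K' * ‖y - x‖ := by
    intro y hy
    have h1 : Tendsto (fun i => ‖F i y - F i x‖) l (𝓝 ‖g y - g x‖) :=
      ((hpt y hy.2).sub (hpt x hx)).norm
    refine le_of_tendsto h1 (hK.mono fun i hi => ?_)
    exact (hi y hy.1 x (mem_of_mem_nhds hN)).trans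
      (mul_le_mul_of_nonneg_right (le_max_left _ _) (norm_nonneg _))
  set η := ε / (4 * (K' + 1)) with hη
  have hη0 : 0 < η := by positivity
  have hKη : K' * η ≤ ε / 4 := by
    rw [hη, mul_div_assoc', div_le_div_iff₀ (by positivity) (by positivity)]
    nlinarith
  refine ⟨N ∩ ball x η ∩ V, ?_, ?_⟩
  · exact inter_mem (mem_nhdsWithin_of_mem_nhds (inter_mem hN (ball_mem_nhds x hη0)))
      self_mem_nhdsWithin
  · have h2 : ∀ᶠ i in l, dist (F i x) (g x) < ε / 4 :=
      (Metric.tendsto_nhds.1 (hpt x hx)) _ (by positivity)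
    filter_upwards [hK, h2] with i hi hi2 y hy
    have hyx : ‖y - x‖ < η := by simpa [dist_eq_norm] using hy.1.2
    have a1 := hgl y ⟨hy.1.1, hy.2⟩
    have a2 := hi y hy.1.1 x (mem_of_mem_nhds hN)
    have a3 : K * ‖y - x‖ ≤ K' * ‖y - x‖ :=
      mul_le_mul_of_nonneg_right (le_max_left _ _) (norm_nonneg _)
    have a4 : K' * ‖y - x‖ ≤ K' * η := mul_le_mul_of_nonneg_left hyx.le hK'0
    rw [dist_eq_norm] at hi2 ⊢
    have : g y - F i y = (g y - g x) - (F i x - g x) - (F i y - F i x) := by ring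
    rw [this]
    calc _ ≤ ‖g y - g x‖ + ‖F i x - g x‖ + ‖F i y - F i x‖ :=
          (norm_sub_le _ _).trans (add_le_add (norm_sub_le _ _) le_rfl)
      _ < ε := by linarith

/-- Along an ultrafilter, pointwise bounded functions converge pointwise. -/
theorem Ultrafilter.exists_pointwise_limit {ι : Type*} (u : Ultrafilter ι) {F : ι → ℂ → ℂ}
    {V : Set ℂ} (hb : ∀ x ∈ V, ∃ B : ℝ, ∀ᶠ i in (u : Filter ι), ‖F i x‖ ≤ B) :
    ∃ g : ℂ → ℂ, ∀ x ∈ V, Tendsto (fun i => F i x) u (𝓝 (g x)) := by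
  have : ∀ x : ℂ, ∃ w : ℂ, x ∈ V → Tendsto (fun i => F i x) u (𝓝 w) := by
    intro x
    by_cases hx : x ∈ V
    · obtain ⟨B, hB⟩ := hb x hx
      obtain ⟨w, -, hw⟩ := (isCompact_closedBall (0 : ℂ) B).ultrafilter_le_nhds'
        (u.map (fun i => F i x)) (by
          rw [Ultrafilter.mem_map]
          filter_upwards [hB] with i hi
          simpa using hi)
      exact ⟨w, fun _ => hw⟩
    · exact ⟨0, fun h => absurd h hx⟩
  choose g hg using this
  exact ⟨g, hg⟩

theorem differentiableOn_of_tendstoLocallyUniformlyOn {ι : Type*} {l : Filter ι} [l.NeBot]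
    {F : ι → ℂ → ℂ} {g : ℂ → ℂ} {V : Set ℂ} (hV : IsOpen V)
    (h : TendstoLocallyUniformlyOn F g l V)
    (hd : ∀ x ∈ V, ∃ N ∈ 𝓝 x, ∀ᶠ i in l, DifferentiableOn ℂ (F i) N) :
    DifferentiableOn ℂ g V := by
  intro x hx
  obtain ⟨N, hN, hN'⟩ := hd x hx
  have hO : IsOpen (interior N ∩ V) := isOpen_interior.inter hV
  have := (h.mono inter_subset_right).differentiableOn
    (hN'.mono fun i hi => hi.mono (inter_subset_left.trans interior_subset)) hO
  exact (this.differentiableAt (hO.mem_nhds ⟨mem_interior_iff_mem_nhds.2 hN, hx⟩)).differentiableWithinAt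

/-- **Hurwitz' theorem**: a zero of a locally uniform limit, near which the limit is not
identically zero, is a limit of zeros. -/
theorem eventually_exists_zero_of_tendstoLocallyUniformlyOn {ι : Type*} {l : Filter ι} [l.NeBot]
    {F : ι → ℂ → ℂ} {g : ℂ → ℂ} {V : Set ℂ} (hV : IsOpen V)
    (h : TendstoLocallyUniformlyOn F g l V) {b : ℂ} (hb : b ∈ V)
    (hd : ∃ N ∈ 𝓝 b, ∀ᶠ i in l, DifferentiableOn ℂ (F i) N)
    (hgd : DifferentiableOn ℂ g V)
    (hg : g b = 0) (hne : ¬ ∀ᶠ z in 𝓝 b, g z = 0) {r : ℝ} (hr : 0 < r) :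
    ∀ᶠ i in l, ∃ z ∈ closedBall b r, z ∈ V ∧ F i z = 0 := by
  obtain ⟨N, hN, hN'⟩ := hd
  have han : AnalyticAt ℂ g b := hgd.analyticAt (hV.mem_nhds hb)
  have hne' : ∀ᶠ z in 𝓝[≠] b, g z ≠ 0 :=
    han.eventually_eq_zero_or_eventually_ne_zero.resolve_left hne
  rw [eventually_nhdsWithin_iff] at hne'
  obtain ⟨ρ, hρ, hρs⟩ := Metric.eventually_nhds_iff_ball.1 (hne'.and
    ((eventually_mem_set.2 (hV.mem_nhds hb)).and (eventually_mem_set.2 hN)))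
  set r' := min r (ρ / 2) with hr'
  have hr'0 : 0 < r' := by positivity
  have hsub : closedBall b r' ⊆ ball b ρ :=
    closedBall_subset_ball ((min_le_right _ _).trans_lt (by linarith))
  have hsV : closedBall b r' ⊆ V := fun z hz => (hρs z (hsub hz)).2.1
  have hsN : closedBall b r' ⊆ N := fun z hz => (hρs z (hsub hz)).2.2
  obtain ⟨z₁, hz₁, hmin⟩ := (isCompact_sphere b r').exists_isMinOn
    (NormedSpace.sphere_nonempty.2 hr'0.le)
    ((hgd.continuousOn.mono (sphere_subset_closedBall.trans hsV)).norm)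
  set ε := ‖g z₁‖ / 4 with hε
  have hε0 : 0 < ε := by
    have : g z₁ ≠ 0 := (hρs z₁ (hsub (sphere_subset_closedBall hz₁))).1 (by
      rintro rfl
      simp at hz₁
      exact hr'0.ne hz₁)
    positivity
  have hunif : TendstoUniformlyOn F g l (closedBall b r') :=
    (tendstoLocallyUniformlyOn_iff_tendstoUniformlyOn_of_compact
      (isCompact_closedBall b r')).1 (h.mono hsV)
  filter_upwards [(Metric.tendstoUniformlyOn_iff.1 hunif) ε hε0, hN'] with i hi hdi
  by_contra hcon
  push Not at hcon
  have hnz : ∀ z ∈ closedBall b r', F i z ≠ 0 := fun z hz =>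
    hcon z (closedBall_subset_closedBall (min_le_left _ _) hz) (hsV hz)
  -- Without zeros, the maximum principle for `1 / F i` turns `|F i| ≥ 3ε` on the sphere into `|F i
  -- b| ≥ 3ε`, whereas `|F i b| < ε` because `g b = 0`.
  have hdc : DiffContOnCl ℂ (fun z => (F i z)⁻¹) (ball b r') := by
    refine ⟨(hdi.mono (ball_subset_closedBall.trans hsN)).inv
      (fun z hz => hnz z (ball_subset_closedBall hz)), ?_⟩
    rw [closure_ball b hr'0.ne']
    exact (hdi.mono hsN).continuousOn.inv₀ hnz
  have hfr : ∀ z ∈ frontier (ball b r'), ‖(F i z)⁻¹‖ ≤ (3 * ε)⁻¹ := by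
    intro z hz
    rw [frontier_ball b hr'0.ne'] at hz
    have h1 : 4 * ε ≤ ‖g z‖ := by
      have := hmin hz
      simp only [mem_ofPred_eq] at this
      linarith
    have h2 := hi z (sphere_subset_closedBall hz)
    rw [dist_eq_norm] at h2
    have h3 := norm_sub_norm_le (g z) (F i z)
    rw [norm_inv]
    exact inv_anti₀ (by positivity) (by linarith)
  have hfin := Complex.norm_le_of_forall_mem_frontier_norm_le isBounded_ball hdc hfr
    (subset_closure (mem_ball_self hr'0))
  have h2 := hi b (mem_closedBall_self hr'0.le)
  rw [dist_eq_norm, hg, zero_sub, norm_neg] at h2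
  rw [norm_inv] at hfin
  have h4 : 0 < ‖F i b‖ := norm_pos_iff.2 (hnz b (mem_closedBall_self hr'0.le))
  have := (inv_le_inv₀ h4 (by positivity)).1 hfin
  linarith

/-! ### Disc automorphisms and the Riemann mapping theorem. -/

/-- The Möbius transformation of the unit disc that maps `a` to `0`. -/
noncomputable def discMoebius (a z : ℂ) : ℂ := (z - a) / (1 - (starRingEnd ℂ) a * z)

theorem discMoebius_denom_ne_zero {a z : ℂ} (ha : ‖a‖ < 1) (hz : ‖z‖ ≤ 1) :
    1 - (starRingEnd ℂ) a * z ≠ 0 := by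
  intro h
  have : ‖(starRingEnd ℂ) a * z‖ = 1 := by
    rw [← sub_eq_zero.1 h]; simp
  rw [norm_mul, RCLike.norm_conj] at this
  nlinarith [norm_nonneg a, norm_nonneg z]

theorem norm_sq_discMoebius {a z : ℂ} (ha : ‖a‖ < 1) (hz : ‖z‖ ≤ 1) :
    1 - ‖discMoebius a z‖ ^ 2 =
      (1 - ‖a‖ ^ 2) * (1 - ‖z‖ ^ 2) / ‖1 - (starRingEnd ℂ) a * z‖ ^ 2 := by
  have h0 : ‖1 - (starRingEnd ℂ) a * z‖ ^ 2 ≠ 0 :=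
    pow_ne_zero _ (norm_ne_zero_iff.2 (discMoebius_denom_ne_zero ha hz))
  rw [discMoebius, norm_div, div_pow, eq_div_iff h0, sub_mul, div_mul_cancel₀ _ h0]
  simp only [Complex.sq_norm, Complex.normSq_apply]
  simp
  ring

theorem norm_discMoebius_lt_one {a z : ℂ} (ha : ‖a‖ < 1) (hz : ‖z‖ < 1) :
    ‖discMoebius a z‖ < 1 := by
  have h := norm_sq_discMoebius ha hz.le
  have h0 : 0 < ‖1 - (starRingEnd ℂ) a * z‖ :=
    norm_pos_iff.2 (discMoebius_denom_ne_zero ha hz.le)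
  have : 0 < 1 - ‖discMoebius a z‖ ^ 2 := by
    rw [h]
    have h1 : 0 < 1 - ‖a‖ ^ 2 := by nlinarith [norm_nonneg a]
    have h2 : 0 < 1 - ‖z‖ ^ 2 := by nlinarith [norm_nonneg z]
    positivity
  nlinarith [norm_nonneg (discMoebius a z)]

theorem hasDerivAt_discMoebius {a z : ℂ} (ha : ‖a‖ < 1) (hz : ‖z‖ < 1) :
    HasDerivAt (discMoebius a)
      ((1 - ‖a‖ ^ 2 : ℝ) / (1 - (starRingEnd ℂ) a * z) ^ 2) z := by
  have h0 := discMoebius_denom_ne_zero ha hz.le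
  have h1 := ((hasDerivAt_id z).sub_const a).div
    (((hasDerivAt_id z).const_mul ((starRingEnd ℂ) a)).const_sub 1) h0
  refine h1.congr_deriv ?_
  congr 1
  have : ((‖a‖ : ℂ)) ^ 2 = (starRingEnd ℂ) a * a := by
    rw [← Complex.conj_mul']
  push_cast
  rw [this]
  simp
  ring

theorem discMoebius_injOn {a : ℂ} (ha : ‖a‖ < 1) : InjOn (discMoebius a) (ball 0 1) := by
  intro z hz w hw h
  rw [mem_ball_zero_iff] at hz hw
  rw [discMoebius, discMoebius, div_eq_div_iff (discMoebius_denom_ne_zero ha hz.le)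
    (discMoebius_denom_ne_zero ha hw.le)] at h
  have h1 : (1 - a * (starRingEnd ℂ) a) * (z - w) = 0 := by linear_combination h
  rcases mul_eq_zero.1 h1 with h2 | h2
  · exfalso
    exact discMoebius_denom_ne_zero ha ha.le (by rw [mul_comm]; exact h2)
  · exact sub_eq_zero.1 h2

theorem discMoebius_self (a : ℂ) : discMoebius a a = 0 := by simp [discMoebius]

/-- The **Schwarz–Pick** estimate of the derivative. -/
theorem norm_deriv_le_of_mapsTo_unitBall {G : ℂ → ℂ} {z : ℂ} {d : ℝ} (hd : 0 < d)
    (hG : DifferentiableOn ℂ G (ball z d)) (hm : MapsTo G (ball z d) (ball 0 1)) :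
    ‖deriv G z‖ ≤ (1 - ‖G z‖ ^ 2) / d := by
  have hz : z ∈ ball z d := mem_ball_self hd
  have hGz : ‖G z‖ < 1 := by simpa using hm hz
  have hdT : ∀ w ∈ ball z d, HasDerivAt (fun w => discMoebius (G z) (G w))
      ((1 - ‖G z‖ ^ 2 : ℝ) / (1 - (starRingEnd ℂ) (G z) * G w) ^ 2 * deriv G w) w := by
    intro w hw
    exact (hasDerivAt_discMoebius hGz (by simpa using hm hw)).comp w
      (hG.differentiableAt (isOpen_ball.mem_nhds hw)).hasDerivAt
  -- Schwarz' lemma for `G` followed by the automorphism that moves `G z` to `0`; the derivative of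
  -- that automorphism at `G z` is `1 / (1 - |G z|²)`.
  have h1 := Complex.norm_deriv_le_div_of_mapsTo_ball (c := z) (R₁ := d) (R₂ := 1)
    (f := fun w => discMoebius (G z) (G w))
    (fun w hw => (hdT w hw).differentiableAt.differentiableWithinAt)
    (fun w hw => by
      simp only [discMoebius_self]
      simpa using (norm_discMoebius_lt_one hGz (by simpa using hm hw)).le) hd
  rw [(hdT z hz).deriv] at h1
  have h2 : (1 - (starRingEnd ℂ) (G z) * G z) = ((1 - ‖G z‖ ^ 2 : ℝ) : ℂ) := by
    rw [Complex.conj_mul']; push_cast; ring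
  have h3 : 0 < 1 - ‖G z‖ ^ 2 := by nlinarith [norm_nonneg (G z)]
  rw [h2, norm_mul, norm_div, norm_pow, Complex.norm_of_nonneg h3.le] at h1
  have h4 : (1 - ‖G z‖ ^ 2) / (1 - ‖G z‖ ^ 2) ^ 2 = (1 - ‖G z‖ ^ 2)⁻¹ := by
    field_simp
  rw [h4, inv_mul_le_iff₀ h3] at h1
  calc _ ≤ _ := h1
    _ = _ := by ring

/-- An injective holomorphic map has a holomorphic inverse, in particular nonzero derivative. -/
theorem differentiableOn_of_leftInverse {G f : ℂ → ℂ} {Ω D : Set ℂ} (hΩ : IsOpen Ω)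
    (hG : DifferentiableOn ℂ G Ω) (hb : BijOn G Ω D) (hD : IsOpen D)
    (hf : ∀ z ∈ Ω, f (G z) = z) : DifferentiableOn ℂ f D := by
  have hfm : MapsTo f D Ω := by
    intro w hw
    obtain ⟨z, hz, rfl⟩ := hb.surjOn hw
    rwa [hf z hz]
  have hGf : ∀ w ∈ D, G (f w) = w := by
    intro w hw
    obtain ⟨z, hz, rfl⟩ := hb.surjOn hw
    rw [hf z hz]
  have hGa : AnalyticOnNhd ℂ G Ω := hG.analyticOnNhd hΩ
  -- not locally constant
  have hnc : ∀ z ∈ Ω, ¬ ∀ᶠ y in 𝓝 z, G y = G z := by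
    intro z hz h
    have h2 : ∀ᶠ y in 𝓝[≠] z, y = z := by
      filter_upwards [h.filter_mono nhdsWithin_le_nhds,
        (hΩ.eventually_mem hz).filter_mono nhdsWithin_le_nhds] with y hy hyΩ
      exact hb.injOn hyΩ hz hy
    have h3 : ∀ᶠ y in 𝓝[≠] z, y ≠ z := eventually_mem_nhdsWithin
    obtain ⟨y, h4, h5⟩ := (h2.and h3).exists
    exact h5 h4
  -- The open mapping theorem, which is the continuity of the inverse.
  have hopen : ∀ z ∈ Ω, 𝓝 (G z) ≤ map G (𝓝 z) := fun z hz =>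
    (hGa z hz).eventually_constant_or_nhds_le_map_nhds.resolve_left (hnc z hz)
  have hfc : ∀ w ∈ D, ContinuousAt f w := by
    intro w hw s hs
    have h1 : G '' (s ∩ Ω) ∈ 𝓝 w := by
      have := hopen (f w) (hfm hw)
      rw [hGf w hw] at this
      exact this (image_mem_map (inter_mem hs (hΩ.mem_nhds (hfm hw))))
    change f ⁻¹' s ∈ 𝓝 w
    filter_upwards [h1]
    rintro _ ⟨z, hz, rfl⟩
    rw [mem_preimage, hf z hz.2]
    exact hz.1
  have hdiff : ∀ w ∈ D, deriv G (f w) ≠ 0 → DifferentiableAt ℂ f w := by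
    intro w hw h0
    have hs : HasDerivAt G (deriv G (f w)) (f w) :=
      (hGa (f w) (hfm hw)).differentiableAt.hasDerivAt
    refine (hs.of_local_left_inverse (hfc w hw) h0 ?_).differentiableAt
    filter_upwards [hD.mem_nhds hw] with y hy using hGf y hy
  intro w hw
  -- Critical points of `G` are isolated, so `f` is differentiable in a punctured neighbourhood of
  -- `w`; being continuous at `w`, it has a removable singularity there.
  refine (analyticAt_of_differentiable_on_punctured_nhds_of_continuousAt ?_
    (hfc w hw)).differentiableAt.differentiableWithinAt
  have hz := hfm hw
  have h1 : ∀ᶠ z in 𝓝[≠] (f w), deriv G z ≠ 0 := by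
    refine ((hGa (f w) hz).deriv.eventually_eq_zero_or_eventually_ne_zero).resolve_left ?_
    intro h
    refine hnc (f w) hz ?_
    obtain ⟨r, hr, hrs⟩ := Metric.eventually_nhds_iff_ball.1 (h.and (hΩ.eventually_mem hz))
    filter_upwards [ball_mem_nhds _ hr] with y hy
    refine (convex_ball (f w) r).is_const_of_fderivWithin_eq_zero (𝕜 := ℂ)
      (hG.mono fun y hy => (hrs y hy).2) (fun y hy => ?_) hy (mem_ball_self hr)
    rw [fderivWithin_of_isOpen isOpen_ball hy]
    ext
    simp [(hrs y hy).1]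
  have h2 : Tendsto f (𝓝[≠] w) (𝓝[≠] (f w)) := by
    refine tendsto_nhdsWithin_iff.2 ⟨(hfc w hw).tendsto.mono_left nhdsWithin_le_nhds, ?_⟩
    filter_upwards [(hD.eventually_mem hw).filter_mono nhdsWithin_le_nhds,
      eventually_mem_nhdsWithin] with y hy hyw h
    apply hyw
    have h' : f y = f w := h
    have := congrArg G h'
    rw [hGf y hy, hGf w hw] at this
    exact this
  filter_upwards [h2.eventually h1, (hD.eventually_mem hw).filter_mono nhdsWithin_le_nhds]
    with y hy hyD using hdiff y hyD hy

/-- Injective holomorphic maps of `Ω` into the unit disc that vanish at `c`. -/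
structure IsDiscEmbedding (Ω : Set ℂ) (c : ℂ) (f : ℂ → ℂ) : Prop where
  differentiableOn : DifferentiableOn ℂ f Ω
  mapsTo : MapsTo f Ω (ball 0 1)
  injOn : InjOn f Ω
  eq_zero : f c = 0

/-- A disc embedding with a derivative of larger modulus exists if the given one omits a
value. -/
theorem IsDiscEmbedding.exists_larger_deriv {Ω : Set ℂ} {c : ℂ} {f : ℂ → ℂ} (hΩ : IsOpen Ω)
    (hs : IsSimplyConnected Ω) (hc : c ∈ Ω) (hf : IsDiscEmbedding Ω c f)
    (hd : deriv f c ≠ 0) {w : ℂ} (hw : ‖w‖ < 1) (hwf : w ∉ f '' Ω) :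
    ∃ F, IsDiscEmbedding Ω c F ∧ ‖deriv f c‖ < ‖deriv F c‖ := by
  have hfl : ∀ z ∈ Ω, ‖f z‖ < 1 := fun z hz => by simpa using hf.mapsTo hz
  have hdf : ∀ z ∈ Ω, HasDerivAt f (deriv f z) z := fun z hz =>
    (hf.differentiableOn.differentiableAt (hΩ.mem_nhds hz)).hasDerivAt
  have hT : ∀ z ∈ Ω, HasDerivAt (fun z => discMoebius w (f z))
      ((1 - ‖w‖ ^ 2 : ℝ) / (1 - (starRingEnd ℂ) w * f z) ^ 2 * deriv f z) z := fun z hz =>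
    (hasDerivAt_discMoebius hw (hfl z hz)).comp z (hdf z hz)
  have hT0 : ∀ z ∈ Ω, discMoebius w (f z) ≠ 0 := by
    intro z hz h
    have : discMoebius w (f z) = discMoebius w w := by rw [h, discMoebius_self]
    have := discMoebius_injOn hw (by simpa using hfl z hz) (by simpa using hw) this
    exact hwf ⟨z, hz, this⟩
  -- Koebe's square root trick: moving the omitted value `w` to `0` leaves a zero-free function on a
  -- simply connected set, which has a square root `g`. A second automorphism brings `g c` back to
  -- `0`.
  obtain ⟨g, hgc, hg2⟩ := Complex.exists_continuousOn_pow_eq hs hΩ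
    (g := fun z => discMoebius w (f z))
    (fun z hz => (hT z hz).continuousAt.continuousWithinAt)
    (by rintro ⟨z, hz, h⟩; exact hT0 z hz h) two_ne_zero
  have hg0 : ∀ z ∈ Ω, g z ≠ 0 := by
    intro z hz h
    apply hT0 z hz
    rw [← hg2, h]; simp
  have hgl : ∀ z ∈ Ω, ‖g z‖ < 1 := by
    intro z hz
    have h1 : ‖g z‖ ^ 2 < 1 := by
      rw [← norm_pow, hg2]; exact norm_discMoebius_lt_one hw (hfl z hz)
    nlinarith [norm_nonneg (g z)]
  have hgd : ∀ z ∈ Ω, DifferentiableAt ℂ g z := by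
    intro z hz
    have hs1 : HasStrictDerivAt (fun x : ℂ => x ^ 2) (2 * g z) (g z) := by
      simpa using hasStrictDerivAt_pow 2 (g z)
    have hne : (2 * g z) ≠ 0 := mul_ne_zero two_ne_zero (hg0 z hz)
    -- local inverse of the square
    have h1 : ∀ᶠ y in 𝓝 z, hs1.localInverse _ _ _ hne (g y ^ 2) = g y := by
      have := hs1.eventually_left_inverse hne
      exact (hgc.continuousAt (hΩ.mem_nhds hz)).eventually this
    have h2 : DifferentiableAt ℂ (hs1.localInverse _ _ _ hne) (g z ^ 2) :=
      (hs1.to_localInverse hne).hasDerivAt.differentiableAt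
    have h3 : DifferentiableAt ℂ
        (fun y => hs1.localInverse _ _ _ hne (discMoebius w (f y))) z := by
      rw [hg2 z] at h2
      exact h2.comp z (hT z hz).differentiableAt
    refine h3.congr_of_eventuallyEq ?_
    filter_upwards [h1] with y hy
    rw [← hy, hg2]
  have hgdc := hgd c hc
  set b := g c with hb
  have hbl : ‖b‖ < 1 := hgl c hc
  have hb0 : b ≠ 0 := hg0 c hc
  have hb2 : ‖b‖ ^ 2 = ‖w‖ := by
    rw [← norm_pow, hb, hg2, hf.eq_zero]; simp [discMoebius]
  have hF : ∀ z ∈ Ω, HasDerivAt (fun z => discMoebius b (g z))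
      ((1 - ‖b‖ ^ 2 : ℝ) / (1 - (starRingEnd ℂ) b * g z) ^ 2 * deriv g z) z := fun z hz =>
    (hasDerivAt_discMoebius hbl (hgl z hz)).comp z (hgd z hz).hasDerivAt
  refine ⟨fun z => discMoebius b (g z), ⟨fun z hz => (hF z hz).differentiableAt.differentiableWithinAt,
    fun z hz => by simpa using norm_discMoebius_lt_one hbl (hgl z hz), ?_, discMoebius_self b⟩, ?_⟩
  · intro z hz z' hz' h
    have h1 := discMoebius_injOn hbl (by simpa using hgl z hz) (by simpa using hgl z' hz') h
    have h2 : discMoebius w (f z) = discMoebius w (f z') := by rw [← hg2, ← hg2, h1]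
    exact hf.injOn hz hz' (discMoebius_injOn hw (by simpa using hfl z hz)
      (by simpa using hfl z' hz') h2)
  · have e1 : 2 * b * deriv g c = (1 - ‖w‖ ^ 2 : ℝ) * deriv f c := by
      have h1 : HasDerivAt (fun z => g z ^ 2) (2 * b * deriv g c) c := by
        simpa using hgdc.hasDerivAt.fun_pow 2
      have h2 : HasDerivAt (fun z => g z ^ 2) ((1 - ‖w‖ ^ 2 : ℝ) * deriv f c) c := by
        have := hT c hc
        rw [hf.eq_zero] at this
        simp only [← hg2] at this
        simpa using this
      exact h1.unique h2
    have e2 : ‖b‖ * (2 * ‖deriv g c‖) = (1 - ‖w‖ ^ 2) * ‖deriv f c‖ := by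
      have h3 : 0 ≤ 1 - ‖w‖ ^ 2 := by nlinarith [norm_nonneg w]
      have := congrArg norm e1
      rw [norm_mul, norm_mul, norm_mul, Complex.norm_of_nonneg h3] at this
      simp at this
      linarith
    have h3 : 0 < 1 - ‖b‖ ^ 2 := by nlinarith [norm_nonneg b]
    have e3 : (1 - (starRingEnd ℂ) b * b) = ((1 - ‖b‖ ^ 2 : ℝ) : ℂ) := by
      rw [Complex.conj_mul']; push_cast; ring
    rw [(hF c hc).deriv, norm_mul, norm_div, norm_pow, ← hb, e3, Complex.norm_of_nonneg h3.le]
    have hbp : 0 < ‖b‖ := norm_pos_iff.2 hb0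
    have hfp : 0 < ‖deriv f c‖ := norm_pos_iff.2 hd
    have e4 : (1 - ‖b‖ ^ 2) / (1 - ‖b‖ ^ 2) ^ 2 * ‖deriv g c‖ = ‖deriv g c‖ / (1 - ‖b‖ ^ 2) := by
      field_simp
    rw [e4, lt_div_iff₀ h3]
    rw [← hb2] at e2
    -- The derivative is multiplied by `(1 + |b|²) / (2|b|)`, which exceeds `1` by a multiple of `(1
    -- - |b|)²`.
    have e5 : 2 * ‖b‖ * (‖deriv g c‖ - ‖deriv f c‖ * (1 - ‖b‖ ^ 2)) =
        (1 - ‖b‖ ^ 2) * ‖deriv f c‖ * (1 - ‖b‖) ^ 2 := by linear_combination e2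
    have e6 : 0 < (1 - ‖b‖ ^ 2) * ‖deriv f c‖ * (1 - ‖b‖) ^ 2 := by
      have : 0 < 1 - ‖b‖ := by linarith
      positivity
    rw [← e5] at e6
    have := (pos_iff_pos_of_mul_pos e6).1 (by positivity)
    linarith

/-- The **Riemann mapping theorem** for bounded domains. -/
theorem exists_riemann_map {Ω : Set ℂ} {c : ℂ} (hΩ : IsOpen Ω) (hs : IsSimplyConnected Ω)
    (hB : Bornology.IsBounded Ω) (hc : c ∈ Ω) :
    ∃ G : ℂ → ℂ, DifferentiableOn ℂ G Ω ∧ BijOn G Ω (ball 0 1) ∧ G c = 0 := by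
  have hpc : IsPreconnected Ω := hs.isPathConnected.isConnected.isPreconnected
  -- initial element
  obtain ⟨f₀, hf₀, hd₀⟩ : ∃ f, IsDiscEmbedding Ω c f ∧ deriv f c ≠ 0 := by
    obtain ⟨R, hR, hRs⟩ := hB.subset_ball_lt 0 c
    have hRC : (R : ℂ) ≠ 0 := by exact_mod_cast hR.ne'
    have hd : ∀ z, HasDerivAt (fun z : ℂ => (z - c) / R) (1 / R) z := fun z =>
      ((hasDerivAt_id z).sub_const c).div_const _
    refine ⟨fun z => (z - c) / R, ⟨fun z _ => (hd z).differentiableAt.differentiableWithinAt,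
      fun z hz => ?_, fun z _ z' _ h => ?_, by simp⟩, ?_⟩
    · rw [mem_ball_zero_iff, norm_div, Complex.norm_of_nonneg hR.le, div_lt_one hR]
      simpa [dist_eq_norm] using hRs hz
    · simpa [div_left_inj' hRC] using h
    · rw [(hd c).deriv]; exact one_div_ne_zero hRC
  -- The extremal problem: maximize `‖deriv f c‖` over all disc embeddings. Schwarz–Pick bounds
  -- these numbers, and a maximizer is onto, since an omitted value would allow a larger derivative.
  set S : Set ℝ := (fun f : ℂ → ℂ => ‖deriv f c‖) '' {f | IsDiscEmbedding Ω c f} with hS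
  obtain ⟨R, hR, hRs⟩ := Metric.isOpen_iff.1 hΩ c hc
  have hbdd : BddAbove S := by
    refine ⟨1 / R, ?_⟩
    rintro _ ⟨f, hf, rfl⟩
    have := norm_deriv_le_of_mapsTo_unitBall hR (hf.differentiableOn.mono hRs)
      (hf.mapsTo.mono_left hRs)
    simpa [IsDiscEmbedding.eq_zero hf] using this
  have hne : S.Nonempty := ⟨_, f₀, hf₀, rfl⟩
  obtain ⟨x, -, hxt, hxS⟩ := exists_seq_tendsto_sSup hne hbdd
  choose F hF hFx using hxS
  have hF' : ∀ n, IsDiscEmbedding Ω c (F n) := hF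
  have hpos : 0 < sSup S := (norm_pos_iff.2 hd₀).trans_le (le_csSup hbdd ⟨f₀, hf₀, rfl⟩)
  -- A limit along a free ultrafilter serves as the limit of a convergent subsequence of the
  -- maximizing sequence.
  set u : Ultrafilter ℕ := hyperfilter ℕ
  have hu_le : (u : Filter ℕ) ≤ atTop := by
    rw [← Nat.cofinite_eq_atTop]; exact hyperfilter_le_cofinite
  obtain ⟨g, hg⟩ := u.exists_pointwise_limit (F := F) (V := Ω) (fun z hz => ⟨1,
    Eventually.of_forall fun n => by simpa using (ball_subset_closedBall ((hF' n).mapsTo hz))⟩)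
  have hlu : TendstoLocallyUniformlyOn F g u Ω := by
    refine tendstoLocallyUniformlyOn_of_lipschitz (fun z hz => ?_) hg
    obtain ⟨r, hr, hrs⟩ := Metric.isOpen_iff.1 hΩ z hz
    refine ⟨ball z (r / 2), ball_mem_nhds _ (by positivity), 1 / (r / 2),
      Eventually.of_forall fun n y hy y' hy' => ?_⟩
    refine (convex_ball z (r / 2)).norm_image_sub_le_of_norm_deriv_le (𝕜 := ℂ) (fun v hv => ?_)
      (fun v hv => ?_) hy' hy
    · exact (hF' n).differentiableOn.differentiableAt
        (hΩ.mem_nhds (hrs (ball_subset_ball (by linarith) hv)))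
    · have hsub : ball v (r / 2) ⊆ Ω := by
        refine (ball_subset_ball' ?_).trans hrs
        rw [mem_ball] at hv; linarith
      refine (norm_deriv_le_of_mapsTo_unitBall (by positivity) ((hF' n).differentiableOn.mono hsub)
        ((hF' n).mapsTo.mono_left hsub)).trans ?_
      gcongr
      nlinarith [norm_nonneg (F n v)]
  have hgd : DifferentiableOn ℂ g Ω :=
    hlu.differentiableOn (Eventually.of_forall fun n => (hF' n).differentiableOn) hΩ
  have hder : ‖deriv g c‖ = sSup S := by
    have h1 := (hlu.deriv (Eventually.of_forall fun n => (hF' n).differentiableOn) hΩ).tendsto_at hc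
    have h2 : Tendsto (fun n => ‖deriv (F n) c‖) u (𝓝 (sSup S)) := by
      have : (fun n => ‖deriv (F n) c‖) = x := funext hFx
      rw [this]; exact hxt.mono_left hu_le
    exact tendsto_nhds_unique h1.norm h2
  have hga : AnalyticOnNhd ℂ g Ω := hgd.analyticOnNhd hΩ
  have hnc : ∀ z ∈ Ω, ¬ ∀ᶠ y in 𝓝 z, g y = g z := by
    intro z hz h
    have h1 : EqOn g (fun _ => g z) Ω :=
      hga.eqOn_of_preconnected_of_eventuallyEq analyticOnNhd_const hpc hz h
    have h2 : deriv g c = 0 := by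
      rw [(h1.eventuallyEq_of_mem (hΩ.mem_nhds hc)).deriv_eq]; simp
    rw [h2, norm_zero] at hder
    exact hpos.ne hder
  have hgle : ∀ z ∈ Ω, ‖g z‖ ≤ 1 := fun z hz =>
    le_of_tendsto (hg z hz).norm (Eventually.of_forall fun n => by
      simpa using (ball_subset_closedBall ((hF' n).mapsTo hz)))
  have hemb : IsDiscEmbedding Ω c g := by
    refine ⟨hgd, fun z hz => ?_, fun a ha b hb hab => ?_, ?_⟩
    · rw [mem_ball_zero_iff]
      refine lt_of_le_of_ne (hgle z hz) fun h => ?_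
      refine hnc z hz (Complex.eventually_eq_of_isLocalMax_norm
        ((hΩ.eventually_mem hz).mono fun y hy => hgd.differentiableAt (hΩ.mem_nhds hy)) ?_)
      filter_upwards [hΩ.eventually_mem hz] with y hy
      simp only [Function.comp_apply, h]
      exact hgle y hy
    · by_contra hne
      -- If `g a = g b`, Hurwitz' theorem for `F n - F n a` gives a zero within `dist a b / 2` of
      -- `b`, hence different from `a`, against the injectivity of `F n`.
      have hlu2 : TendstoLocallyUniformlyOn (fun n z => F n z - F n a) (fun z => g z - g a) u Ω := by
        refine tendstoLocallyUniformlyOn_of_lipschitz (fun z hz => ?_)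
          (fun z hz => (hg z hz).sub (hg a ha))
        obtain ⟨r, hr, hrs⟩ := Metric.isOpen_iff.1 hΩ z hz
        refine ⟨ball z (r / 2), ball_mem_nhds _ (by positivity), 1 / (r / 2),
          Eventually.of_forall fun n y hy y' hy' => ?_⟩
        simp only [sub_sub_sub_cancel_right]
        refine (convex_ball z (r / 2)).norm_image_sub_le_of_norm_deriv_le (𝕜 := ℂ) (fun v hv => ?_)
          (fun v hv => ?_) hy' hy
        · exact (hF' n).differentiableOn.differentiableAt
            (hΩ.mem_nhds (hrs (ball_subset_ball (by linarith) hv)))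
        · have hsub : ball v (r / 2) ⊆ Ω := by
            refine (ball_subset_ball' ?_).trans hrs
            rw [mem_ball] at hv; linarith
          refine (norm_deriv_le_of_mapsTo_unitBall (by positivity)
            ((hF' n).differentiableOn.mono hsub) ((hF' n).mapsTo.mono_left hsub)).trans ?_
          gcongr
          nlinarith [norm_nonneg (F n v)]
      have hab' : 0 < dist a b := dist_pos.2 hne
      obtain ⟨n, z, hz, hzΩ, hzn⟩ := (eventually_exists_zero_of_tendstoLocallyUniformlyOn hΩ hlu2 hb
        ⟨Ω, hΩ.mem_nhds hb, Eventually.of_forall fun n =>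
          (hF' n).differentiableOn.sub_const _⟩ (hgd.sub_const _) (by simp [hab])
        (fun h => hnc b hb (h.mono fun y hy => by
          have : g y - g a = 0 := hy
          rw [← hab]; exact sub_eq_zero.1 this)) (half_pos hab')).exists
      have := (hF' n).injOn hzΩ ha (sub_eq_zero.1 hzn)
      rw [this, mem_closedBall] at hz
      linarith
    · refine tendsto_nhds_unique (hg c hc) ?_
      simp only [(hF' _).eq_zero]
      exact tendsto_const_nhds
  refine ⟨g, hgd, ⟨hemb.mapsTo, hemb.injOn, fun w hw => ?_⟩, hemb.eq_zero⟩
  by_contra hwn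
  obtain ⟨F', hF', hlt⟩ := hemb.exists_larger_deriv hΩ hs hc (by
    rw [← norm_ne_zero_iff, hder]; exact hpos.ne') (by simpa using hw) hwn
  have := le_csSup hbdd (show ‖deriv F' c‖ ∈ S from ⟨F', hF', rfl⟩)
  linarith

/-! ### Maximum principle, and the Green function as the logarithm of a Riemann map. -/

/-- The **maximum principle** for harmonic functions on bounded open sets of the plane. -/
theorem InnerProductSpace.HarmonicOnNhd.le_of_frontier_le {u : ℂ → ℝ} {V : Set ℂ} (hV : IsOpen V)
    (hb : Bornology.IsBounded V) (hu : HarmonicOnNhd u V) (hc : ContinuousOn u (closure V))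
    {M : ℝ} (h : ∀ z ∈ frontier V, u z ≤ M) {z : ℂ} (hz : z ∈ closure V) : u z ≤ M := by
  have hcomp : IsCompact (closure V) := hb.isCompact_closure
  obtain ⟨z₀, hz₀, hmax⟩ := hcomp.exists_isMaxOn ⟨z, hz⟩ hc
  refine (hmax hz).trans ?_
  have hScl : IsCompact (closure V ∩ u ⁻¹' {u z₀}) :=
    hcomp.of_isClosed_subset (hc.preimage_isClosed_of_isClosed isClosed_closure isClosed_singleton)
      inter_subset_left
  -- Among all maximum points take one furthest to the right. If it were interior, `|exp F|` with
  -- `Re F = u` would be constant near it, and points slightly to the right would be maximum points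
  -- as well.
  obtain ⟨z₁, hz₁, hre⟩ := hScl.exists_isMaxOn ⟨z₀, hz₀, rfl⟩ Complex.continuous_re.continuousOn
  have hz₁u : u z₁ = u z₀ := hz₁.2
  by_cases hzV : z₁ ∈ V
  · exfalso
    obtain ⟨r, hr, hrs⟩ := Metric.isOpen_iff.1 hV z₁ hzV
    obtain ⟨F, hF, hFu⟩ := (hu.mono hrs).exists_analyticOnNhd_ball_re_eq
    have hzb : z₁ ∈ ball z₁ r := mem_ball_self hr
    have hn : ∀ y ∈ ball z₁ r, ‖Complex.exp (F y)‖ = Real.exp (u y) := by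
      intro y hy
      rw [Complex.norm_exp, ← hFu hy]
    have h1 : ∀ᶠ y in 𝓝 z₁, ‖Complex.exp (F y)‖ = ‖Complex.exp (F z₁)‖ := by
      refine Complex.norm_eventually_eq_of_isLocalMax (f := fun y => Complex.exp (F y)) ?_ ?_
      · filter_upwards [ball_mem_nhds z₁ hr] with y hy
        exact ((hF y hy).differentiableAt).cexp
      · filter_upwards [ball_mem_nhds z₁ hr] with y hy
        simp only [Function.comp_apply]
        rw [hn y hy, hn z₁ hzb, hz₁u]
        exact Real.exp_le_exp.2 (hmax (subset_closure (hrs hy)))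
    have h2 : ∀ᶠ y in 𝓝 z₁, y.re ≤ z₁.re := by
      filter_upwards [h1, ball_mem_nhds z₁ hr] with y hy hyb
      rw [hn y hyb, hn z₁ hzb, Real.exp_eq_exp, hz₁u] at hy
      exact hre ⟨subset_closure (hrs hyb), hy⟩
    have h3 : Tendsto (fun t : ℝ => z₁ + t) (𝓝[>] 0) (𝓝 z₁) := by
      have : Continuous (fun t : ℝ => z₁ + (t : ℂ)) := by fun_prop
      have h4 := this.tendsto 0
      simp only [ofReal_zero, add_zero] at h4
      exact h4.mono_left nhdsWithin_le_nhds
    obtain ⟨t, ht, ht0⟩ := ((h3.eventually h2).and self_mem_nhdsWithin).exists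
    simp at ht ht0
    linarith
  · rw [← hz₁u]
    exact h z₁ (by rw [hV.frontier_eq]; exact ⟨hz₁.1, hzV⟩)

/-- The two-function form of the maximum principle. -/
theorem InnerProductSpace.HarmonicOnNhd.le_of_frontier_le_fun {u v : ℂ → ℝ} {V : Set ℂ}
    (hV : IsOpen V) (hb : Bornology.IsBounded V) (hu : HarmonicOnNhd u V)
    (hc : ContinuousOn u (closure V)) (hv : HarmonicOnNhd v V)
    (hvc : ContinuousOn v (closure V)) (h : ∀ z ∈ frontier V, u z ≤ v z) {z : ℂ}
    (hz : z ∈ closure V) : u z ≤ v z := by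
  have := (hu.sub hv).le_of_frontier_le hV hb (hc.sub hvc) (M := 0)
    (fun z hz => by simpa using h z hz) hz
  simpa using this

/-- A holomorphic bijection from `Ω` onto the unit disc that maps `c` to `0`. -/
structure IsRiemannMap (Ω : Set ℂ) (c : ℂ) (G : ℂ → ℂ) : Prop where
  isOpen : IsOpen Ω
  isBounded : Bornology.IsBounded Ω
  mem : c ∈ Ω
  differentiableOn : DifferentiableOn ℂ G Ω
  bijOn : BijOn G Ω (ball 0 1)
  eq_zero : G c = 0

namespace IsRiemannMap

variable {Ω : Set ℂ} {c : ℂ} {G : ℂ → ℂ}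

theorem norm_lt_one (h : IsRiemannMap Ω c G) {z : ℂ} (hz : z ∈ Ω) : ‖G z‖ < 1 := by
  simpa using h.bijOn.mapsTo hz

theorem exists_inverse (h : IsRiemannMap Ω c G) :
    ∃ f : ℂ → ℂ, (∀ z ∈ Ω, f (G z) = z) ∧ MapsTo f (ball 0 1) Ω ∧
      (∀ w ∈ ball (0 : ℂ) 1, G (f w) = w) ∧ DifferentiableOn ℂ f (ball 0 1) := by
  have hi := h.bijOn.invOn_invFunOn
  refine ⟨Function.invFunOn G Ω, hi.1, h.bijOn.surjOn.mapsTo_invFunOn, hi.2, ?_⟩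
  exact differentiableOn_of_leftInverse h.isOpen h.differentiableOn h.bijOn isOpen_ball hi.1

theorem hasDerivAt (h : IsRiemannMap Ω c G) {z : ℂ} (hz : z ∈ Ω) :
    HasDerivAt G (deriv G z) z :=
  (h.differentiableOn.differentiableAt (h.isOpen.mem_nhds hz)).hasDerivAt

theorem deriv_ne_zero (h : IsRiemannMap Ω c G) {z : ℂ} (hz : z ∈ Ω) : deriv G z ≠ 0 := by
  obtain ⟨f, hfG, hfm, hGf, hfd⟩ := h.exists_inverse
  have hw := h.bijOn.mapsTo hz
  have h1 : HasDerivAt f (deriv f (G z)) (G z) :=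
    (hfd.differentiableAt (isOpen_ball.mem_nhds hw)).hasDerivAt
  have h2 := h1.comp z (h.hasDerivAt hz)
  have h3 : HasDerivAt (f ∘ G) 1 z :=
    (hasDerivAt_id z).congr_of_eventuallyEq
      ((h.isOpen.eventually_mem hz).mono fun y hy => hfG y hy)
  intro h0
  have := h2.unique h3
  rw [h0, mul_zero] at this
  exact zero_ne_one this

/-- Properness of the Riemann map: the points with `|G| ≤ 1 - ε` form a compact subset of the
domain, which a boundary point avoids together with a neighbourhood. -/
theorem tendsto_norm (h : IsRiemannMap Ω c G) {p : ℂ} (hp : p ∈ frontier Ω) :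
    Tendsto (fun z => ‖G z‖) (𝓝[Ω] p) (𝓝 1) := by
  obtain ⟨f, hfG, hfm, hGf, hfd⟩ := h.exists_inverse
  have hpΩ : p ∉ Ω := by rw [h.isOpen.frontier_eq] at hp; exact hp.2
  rw [Metric.tendsto_nhds]
  intro ε hε
  have hsub : closedBall (0 : ℂ) (1 - ε) ⊆ ball 0 1 := closedBall_subset_ball (by linarith)
  have hK : IsCompact (f '' closedBall 0 (1 - ε)) :=
    (isCompact_closedBall _ _).image_of_continuousOn (hfd.continuousOn.mono hsub)
  have hpK : (f '' closedBall 0 (1 - ε))ᶜ ∈ 𝓝 p := by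
    refine hK.isClosed.isOpen_compl.mem_nhds ?_
    rintro ⟨w, hw, rfl⟩
    exact hpΩ (hfm (hsub hw))
  filter_upwards [mem_nhdsWithin_of_mem_nhds hpK, self_mem_nhdsWithin] with z hzK hz
  have h1 := h.norm_lt_one hz
  have h2 : 1 - ε < ‖G z‖ := by
    by_contra hcon
    exact hzK ⟨G z, by simpa using not_lt.1 hcon, hfG z hz⟩
  rw [Real.dist_eq, abs_lt]
  constructor <;> linarith

/-- The Green's function in terms of a Riemann map. -/
theorem greenFunction_eq (h : IsRiemannMap Ω c G) {U : ℂ → ℝ} (hU : IsGreenFunction Ω c U)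
    {z : ℂ} (hz : z ∈ Ω) (hzc : z ≠ c) :
    U z = -(1 / (2 * Real.pi)) * Real.log ‖G z‖ := by
  obtain ⟨H, hH, hUH⟩ := hU.exists_harmonic
  have hG0 : ∀ z ∈ Ω, z ≠ c → G z ≠ 0 := by
    intro z hz hzc h0
    exact hzc (h.bijOn.injOn hz h.mem (by rw [h0, h.eq_zero]))
  have hDd : DifferentiableOn ℂ (dslope G c) Ω :=
    (Complex.differentiableOn_dslope (h.isOpen.mem_nhds h.mem)).2 h.differentiableOn
  have hGD : ∀ z, G z = (z - c) * dslope G c z := by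
    intro z
    have := sub_smul_dslope G c z
    rw [h.eq_zero, sub_zero, smul_eq_mul] at this
    exact this.symm
  have hD0 : ∀ z ∈ Ω, dslope G c z ≠ 0 := by
    intro z hz
    by_cases hzc : z = c
    · rw [hzc, dslope_same]; exact h.deriv_ne_zero h.mem
    · intro h0
      exact hG0 z hz hzc (by rw [hGD, h0, mul_zero])
  -- This is `U + (1 / 2π) log |G|` with the two logarithmic poles at `c` cancelled; `dslope G c`
  -- has no zeros because `G` is injective with nonzero derivative at `c`.
  set v : ℂ → ℝ := fun z => H z + (1 / (2 * Real.pi)) * Real.log ‖dslope G c z‖ with hv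
  have hvU : ∀ z ∈ Ω, z ≠ c → v z = U z + (1 / (2 * Real.pi)) * Real.log ‖G z‖ := by
    intro z hz hzc
    have h1 : ‖z - c‖ ≠ 0 := norm_ne_zero_iff.2 (sub_ne_zero.2 hzc)
    rw [hUH z hz hzc, hGD z, norm_mul, Real.log_mul h1 (norm_ne_zero_iff.2 (hD0 z hz))]
    simp only [hv]
    ring
  have hvh : HarmonicOnNhd v Ω := by
    intro z hz
    refine (hH z hz).add ?_
    exact ((hDd.analyticAt (h.isOpen.mem_nhds hz)).harmonicAt_log_norm (hD0 z hz)).const_smul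
  -- Extended by zero, `v` is continuous up to the boundary, since `U → 0` and `|G| → 1` there; the
  -- maximum principle for `±u` then gives `u = 0`.
  set u : ℂ → ℝ := Ω.indicator v with hu
  have huv : ∀ z ∈ Ω, u =ᶠ[𝓝 z] v := fun z hz =>
    (h.isOpen.eventually_mem hz).mono fun y hy => indicator_of_mem hy v
  have huh : HarmonicOnNhd u Ω := fun z hz => (harmonicAt_congr_nhds (huv z hz)).2 (hvh z hz)
  have hufr : ∀ p ∈ frontier Ω, u p = 0 := by
    intro p hp
    rw [h.isOpen.frontier_eq] at hp
    exact indicator_of_notMem hp.2 v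
  have huc : ContinuousOn u (closure Ω) := by
    intro p hp
    by_cases hpΩ : p ∈ Ω
    · exact ((huh p hpΩ).1.continuousAt).continuousWithinAt
    · have hpf : p ∈ frontier Ω := by rw [h.isOpen.frontier_eq]; exact ⟨hp, hpΩ⟩
      have hpc : p ≠ c := fun e => hpΩ (e ▸ h.mem)
      rw [ContinuousWithinAt, hufr p hpf, closure_eq_self_union_frontier, nhdsWithin_union]
      refine Tendsto.sup ?_ ?_
      · have h1 : Tendsto U (𝓝[Ω] p) (𝓝 0) := by
          have := (hU.continuousOn p ⟨hp, hpc⟩).tendsto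
          rw [hU.eq_zero p hpf] at this
          refine this.mono_left (nhdsWithin_le_iff.2 ?_)
          filter_upwards [self_mem_nhdsWithin,
            mem_nhdsWithin_of_mem_nhds (isOpen_ne.mem_nhds hpc)] with z hz hzc
          exact ⟨subset_closure hz, hzc⟩
        have h2 : Tendsto (fun z => Real.log ‖G z‖) (𝓝[Ω] p) (𝓝 0) := by
          have := (Real.continuousAt_log one_ne_zero).tendsto.comp (h.tendsto_norm hpf)
          simpa [Function.comp_def] using this
        have h3 := h1.add (h2.const_mul (1 / (2 * Real.pi)))
        rw [mul_zero, add_zero] at h3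
        refine h3.congr' ?_
        filter_upwards [self_mem_nhdsWithin,
            mem_nhdsWithin_of_mem_nhds (isOpen_ne.mem_nhds hpc)] with z hz hzc
        rw [hu, indicator_of_mem hz, hvU z hz hzc]
      · refine tendsto_const_nhds.congr' ?_
        filter_upwards [self_mem_nhdsWithin] with z hz using (hufr z hz).symm
  have h1 : u z ≤ 0 := huh.le_of_frontier_le h.isOpen h.isBounded huc
    (fun p hp => (hufr p hp).le) (subset_closure hz)
  have h2 : -u z ≤ 0 := huh.neg.le_of_frontier_le h.isOpen h.isBounded huc.neg
    (fun p hp => by simp [hufr p hp]) (subset_closure hz)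
  have h3 : v z = 0 := by
    have : u z = v z := indicator_of_mem hz v
    linarith
  rw [hvU z hz hzc] at h3
  linarith

theorem norm_eq_exp (h : IsRiemannMap Ω c G) {U : ℂ → ℝ} (hU : IsGreenFunction Ω c U)
    {z : ℂ} (hz : z ∈ Ω) (hzc : z ≠ c) : ‖G z‖ = Real.exp (-(2 * Real.pi * U z)) := by
  have h0 : G z ≠ 0 := fun h0 => hzc (h.bijOn.injOn hz h.mem (by rw [h0, h.eq_zero]))
  rw [h.greenFunction_eq hU hz hzc]
  have : -(2 * Real.pi * (-(1 / (2 * Real.pi)) * Real.log ‖G z‖)) = Real.log ‖G z‖ := by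
    field_simp
  rw [this, Real.exp_log (norm_pos_iff.2 h0)]

theorem greenFunction_pos (h : IsRiemannMap Ω c G) {U : ℂ → ℝ} (hU : IsGreenFunction Ω c U)
    {z : ℂ} (hz : z ∈ Ω) (hzc : z ≠ c) : 0 < U z := by
  have h1 := h.norm_eq_exp hU hz hzc
  have h2 := h.norm_lt_one hz
  rw [h1, Real.exp_lt_one_iff] at h2
  have := Real.pi_pos
  by_contra hcon
  nlinarith

/-- From `1 - e⁻ˣ ≤ x`. It turns upper bounds of `U` into bounds of the numerator in Schwarz–Pick.
-/
theorem one_sub_norm_le (h : IsRiemannMap Ω c G) {U : ℂ → ℝ} (hU : IsGreenFunction Ω c U)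
    {z : ℂ} (hz : z ∈ Ω) (hzc : z ≠ c) : 1 - ‖G z‖ ≤ 2 * Real.pi * U z := by
  rw [h.norm_eq_exp hU hz hzc]
  linarith [Real.add_one_le_exp (-(2 * Real.pi * U z))]

end IsRiemannMap

/-! ### Boundary charts: flatness and joining nearby points. -/

/-- The part of `HasC1HolderBoundary` that concerns a single boundary point. -/
structure IsC1HolderChart (α : ℝ≥0) (Ω : Set ℂ) (p e : ℂ) (h : ℝ → ℝ) (C : ℝ≥0) (r : ℝ) :
    Prop where
  norm_eq_one : ‖e‖ = 1
  contDiff : ContDiff ℝ 1 h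
  holderWith : HolderWith C α (deriv h)
  pos : 0 < r
  mem_iff : ∀ z ∈ ball p r,
    (z ∈ Ω ↔ h ((starRingEnd ℂ e * (z - p)).re) < (starRingEnd ℂ e * (z - p)).im)

/-- At `p`, the boundary of `Ω` deviates from the line orthogonal to `ν` by at most
`C |ω| ^ q` in distance `|ω| < r`. -/
def IsFlatAt (Ω : Set ℂ) (q C r : ℝ) (p ν : ℂ) : Prop :=
  ∀ ω : ℂ, ‖ω‖ < r → (C * ‖ω‖ ^ q < ω.re → p + ν * ω ∈ Ω) ∧
    (p + ν * ω ∈ Ω → -(C * ‖ω‖ ^ q) ≤ ω.re)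

/-- Mean value inequality for `h y - deriv h x * y`, whose derivative is at most `C |d| ^ α` between
`x` and `x + d`. -/
theorem HolderWith.abs_sub_taylor_le {α C : ℝ≥0} {h : ℝ → ℝ} (hh : ContDiff ℝ 1 h)
    (hC : HolderWith C α (deriv h)) (x d : ℝ) :
    |h (x + d) - h x - deriv h x * d| ≤ C * |d| ^ (1 + (α : ℝ)) := by
  have hd : ∀ y, HasDerivAt h (deriv h y) y := fun y =>
    (hh.differentiable one_ne_zero y).hasDerivAt
  have h1 := (convex_uIcc x (x + d)).norm_image_sub_le_of_norm_hasDerivWithin_le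
    (f := fun y => h y - deriv h x * y) (f' := fun y => deriv h y - deriv h x)
    (C := C * |d| ^ (α : ℝ))
    (fun y _ => (((hd y).sub ((hasDerivAt_id y).const_mul (deriv h x))).congr_deriv
      (by simp)).hasDerivWithinAt)
    (fun y hy => by
      have := hC.dist_le y x
      rw [dist_eq_norm, Real.dist_eq] at this
      refine this.trans ?_
      have := Set.abs_sub_left_of_mem_uIcc hy
      rw [add_sub_cancel_left] at this
      exact mul_le_mul_of_nonneg_left
        (Real.rpow_le_rpow (abs_nonneg _) this α.2) C.2)
    left_mem_uIcc right_mem_uIcc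
  have e1 : h (x + d) - deriv h x * (x + d) - (h x - deriv h x * x) =
    h (x + d) - h x - deriv h x * d := by ring
  rw [e1, Real.norm_eq_abs, Real.norm_eq_abs, add_sub_cancel_left] at h1
  refine h1.trans_eq ?_
  rcases eq_or_ne d 0 with rfl | hd0
  · simp [Real.zero_rpow (by positivity : (1 + (α : ℝ)) ≠ 0)]
  · rw [Real.rpow_add (abs_pos.2 hd0), Real.rpow_one]; ring

theorem conj_mul_self_of_norm_eq_one {e : ℂ} (he : ‖e‖ = 1) : (starRingEnd ℂ) e * e = 1 := by
  rw [Complex.conj_mul', he]; simp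

namespace IsC1HolderChart

variable {α C : ℝ≥0} {Ω : Set ℂ} {p₀ e : ℂ} {h : ℝ → ℝ} {r : ℝ}

theorem im_eq (hch : IsC1HolderChart α Ω p₀ e h C r) (hΩ : IsOpen Ω) {z : ℂ}
    (hz : z ∈ ball p₀ r) (hzf : z ∈ frontier Ω) :
    (starRingEnd ℂ e * (z - p₀)).im = h ((starRingEnd ℂ e * (z - p₀)).re) := by
  rw [hΩ.frontier_eq] at hzf
  refine le_antisymm ?_ ?_
  · have := hzf.2
    rw [hch.mem_iff z hz] at this
    exact not_lt.1 this
  · have hcl : z ∈ closure (Ω ∩ ball p₀ r) := by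
      rw [mem_closure_iff_nhds] at *
      intro t ht
      obtain ⟨y, hy, hyΩ⟩ := (mem_closure_iff_nhds.1 hzf.1) (t ∩ ball p₀ r)
        (inter_mem ht (isOpen_ball.mem_nhds hz))
      exact ⟨y, hy.1, hyΩ, hy.2⟩
    have hcl2 : IsClosed {y : ℂ | h ((starRingEnd ℂ e * (y - p₀)).re) ≤
        (starRingEnd ℂ e * (y - p₀)).im} := by
      have := hch.contDiff.continuous
      exact isClosed_le (by fun_prop) (by fun_prop)
    exact closure_minimal (fun y hy => ((hch.mem_iff y hy.2).1 hy.1).le) hcl2 hcl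

/-- The interior unit normal of a graph at the point over `x`. -/
noncomputable def normal (e : ℂ) (h : ℝ → ℝ) (x : ℝ) : ℂ :=
  e * (-(deriv h x) + I) / (Real.sqrt (1 + deriv h x ^ 2) : ℝ)

theorem norm_normal (he : ‖e‖ = 1) (x : ℝ) : ‖normal e h x‖ = 1 := by
  have hS : 0 < 1 + deriv h x ^ 2 := by positivity
  have h1 : ‖(-(deriv h x) + I : ℂ)‖ = Real.sqrt (1 + deriv h x ^ 2) := by
    rw [← Real.sqrt_sq (norm_nonneg _), Complex.sq_norm, Complex.normSq_apply]
    congr 1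
    simp
    ring
  rw [normal, norm_div, norm_mul, he, h1, Complex.norm_of_nonneg (Real.sqrt_nonneg _), one_mul,
    div_self (Real.sqrt_pos.2 hS).ne']

/-- In the chart, the height of `p + ν ω` above the tangent line at `p` is `S * ω.re` with `S = sqrt
(1 + h'²)`, and the graph leaves the tangent line by at most `C |ω| ^ (1 + α)`. Since `S ≥ 1`, the
Hölder constant `C` itself can be kept. -/
theorem isFlatAt (hch : IsC1HolderChart α Ω p₀ e h C r) (hΩ : IsOpen Ω) {p : ℂ}
    (hp : p ∈ frontier Ω) {ρ : ℝ} (hpr : dist p p₀ + ρ ≤ r) (hρ : 0 < ρ) :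
    IsFlatAt Ω (1 + α) C ρ p (normal e h (starRingEnd ℂ e * (p - p₀)).re) := by
  have hpb : p ∈ ball p₀ r := by rw [mem_ball]; linarith
  have him := hch.im_eq hΩ hpb hp
  set x := (starRingEnd ℂ e * (p - p₀)).re with hx
  set S := Real.sqrt (1 + deriv h x ^ 2) with hS
  have hS1 : 1 ≤ S := by
    rw [hS, Real.one_le_sqrt]; nlinarith [sq_nonneg (deriv h x)]
  have hSS : S * S = 1 + deriv h x ^ 2 := Real.mul_self_sqrt (by positivity)
  intro ω hω
  have hν := norm_normal (h := h) hch.norm_eq_one x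
  have hzb : p + normal e h x * ω ∈ ball p₀ r := by
    rw [mem_ball]
    calc _ ≤ dist (p + normal e h x * ω) p + dist p p₀ := dist_triangle _ _ _
      _ < r := by
        rw [dist_eq_norm, add_sub_cancel_left, norm_mul, hν, one_mul]; linarith
  rw [hch.mem_iff _ hzb]
  have hSC : (S : ℂ) ≠ 0 := by exact_mod_cast (zero_lt_one.trans_le hS1).ne'
  set d : ℂ := (-((deriv h x : ℝ) : ℂ) + I) * ω / (S : ℂ) with hd
  have hκ : starRingEnd ℂ e * (p + normal e h x * ω - p₀) =
      starRingEnd ℂ e * (p - p₀) + d := by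
    have := conj_mul_self_of_norm_eq_one hch.norm_eq_one
    rw [normal, hd, ← hS]
    linear_combination ((-((deriv h x : ℝ) : ℂ) + I) * ω / (S : ℂ)) * this
  have hnd : ‖d‖ = ‖ω‖ := by
    have : d = starRingEnd ℂ e * normal e h x * ω := by
      have := conj_mul_self_of_norm_eq_one hch.norm_eq_one
      rw [normal, hd, ← hS]
      linear_combination -((-((deriv h x : ℝ) : ℂ) + I) * ω / (S : ℂ)) * this
    rw [this, norm_mul, norm_mul, hν, RCLike.norm_conj, hch.norm_eq_one]; simp
  have hdre : d.re * S = -(deriv h x) * ω.re - ω.im := by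
    have : d * S = (-((deriv h x : ℝ) : ℂ) + I) * ω := by rw [hd]; field_simp
    have := congrArg re this
    simpa using this
  have hdim : d.im * S = ω.re - deriv h x * ω.im := by
    have : d * S = (-((deriv h x : ℝ) : ℂ) + I) * ω := by rw [hd]; field_simp
    have := congrArg im this
    simp at this
    linarith
  have hkey : d.im - deriv h x * d.re = ω.re * S := by
    have hS0 : S ≠ 0 := (zero_lt_one.trans_le hS1).ne'
    apply mul_right_cancel₀ hS0
    linear_combination hdim - deriv h x * hdre - ω.re * hSS
  have htay := hch.holderWith.abs_sub_taylor_le hch.contDiff x d.re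
  have hle : (C : ℝ) * |d.re| ^ (1 + (α : ℝ)) ≤ C * ‖ω‖ ^ (1 + (α : ℝ)) := by
    gcongr
    rw [← hnd]; exact Complex.abs_re_le_norm d
  rw [abs_le] at htay
  rw [hκ, add_re, add_im, him, ← hx]
  constructor
  · intro hlt
    have h0 : 0 ≤ ω.re := le_trans (by positivity) hlt.le
    nlinarith [htay.2]
  · intro hlt
    rcases le_or_gt 0 ω.re with h0 | h0
    · exact le_trans (by simp only [neg_nonpos]; positivity) h0
    · nlinarith [htay.1]

/-- A function with bounded derivative is Lipschitz near a boundary point. -/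
theorem exists_lipschitz (hch : IsC1HolderChart α Ω p₀ e h C r) (hΩ : IsOpen Ω) :
    ∃ ρ > 0, ∃ K : ℝ, 0 ≤ K ∧ ∀ (G : ℂ → ℂ) (M : ℝ), DifferentiableOn ℂ G Ω →
      (∀ z ∈ Ω, ‖deriv G z‖ ≤ M) → ∀ z₁ ∈ Ω ∩ ball p₀ ρ, ∀ z₂ ∈ Ω ∩ ball p₀ ρ,
      ‖G z₁ - G z₂‖ ≤ M * K * ‖z₁ - z₂‖ := by
  obtain ⟨Λ, t, ht, hΛ⟩ := (hch.contDiff.contDiffAt (x := 0)).exists_lipschitzOnWith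
  obtain ⟨δ, hδ, hδt⟩ := Metric.mem_nhds_iff.1 ht
  set ρ := min δ (r / (2 * (Λ : ℝ) + 6)) with hρdef
  have hr := hch.pos
  -- The size of `ρ` keeps the path used below inside the chart: its height `τ` is at most `(Λ + 1)
  -- * 2ρ`, so `τ + 3ρ ≤ (2Λ + 5) ρ < r`.
  have hρ : 0 < ρ := by positivity
  have hρr : ρ * (2 * (Λ : ℝ) + 6) ≤ r := by
    rw [← le_div_iff₀ (by positivity)]; exact min_le_right _ _
  refine ⟨ρ, hρ, 2 * Λ + 3, by positivity, ?_⟩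
  rintro G M hG hM z₁ ⟨h1, hb1⟩ z₂ ⟨h2, hb2⟩
  have he := conj_mul_self_of_norm_eq_one hch.norm_eq_one
  have hec : ‖(starRingEnd ℂ) e‖ = 1 := by rw [RCLike.norm_conj, hch.norm_eq_one]
  set D := ‖z₁ - z₂‖ with hD
  have hD0 : 0 ≤ D := norm_nonneg _
  rw [mem_ball, dist_eq_norm] at hb1 hb2
  have hD2 : D < 2 * ρ := by
    have : z₁ - z₂ = (z₁ - p₀) - (z₂ - p₀) := by ring
    rw [hD, this]
    exact (norm_sub_le _ _).trans_lt (by linarith)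
  -- The path goes up by `τ`, across, and down by `τ`. Along the crossing the height changes by at
  -- most `D` and the graph by at most `Λ D`, so this `τ` keeps it above the graph; the total length
  -- `2τ + D` explains the constant `2Λ + 3`.
  set τ := ((Λ : ℝ) + 1) * D with hτ
  have hτ0 : 0 ≤ τ := by positivity
  have hτr : τ + 3 * ρ < r + 0 ∨ τ + 3 * ρ ≤ r := by
    right; nlinarith [Λ.2]
  have hτr' : τ + 3 * ρ ≤ r := by rcases hτr with h | h <;> linarith
  have hX : ∀ z, ‖z - p₀‖ < ρ → |(starRingEnd ℂ e * (z - p₀)).re| < ρ := fun z hz =>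
    (Complex.abs_re_le_norm _).trans_lt (by rw [norm_mul, hec, one_mul]; exact hz)
  -- vertical segments
  have hv : ∀ z ∈ Ω, ‖z - p₀‖ < ρ → segment ℝ z (z + e * I * τ) ⊆ Ω := by
    intro z hz hzb y hy
    rw [segment_eq_image'] at hy
    obtain ⟨s, hs, rfl⟩ := hy
    have hzm := (hch.mem_iff z (by rw [mem_ball, dist_eq_norm]; linarith)).1 hz
    have hsm : ‖e * I * τ‖ = τ := by
      rw [norm_mul, norm_mul, hch.norm_eq_one, Complex.norm_of_nonneg hτ0]; simp
    have hb : z + s • (z + e * I * τ - z) ∈ ball p₀ r := by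
      rw [mem_ball, dist_eq_norm, add_sub_cancel_left]
      have : z + s • (e * I * τ) - p₀ = (z - p₀) + s • (e * I * τ) := by ring
      rw [this]
      refine (norm_add_le _ _).trans_lt ?_
      rw [norm_smul, hsm, Real.norm_of_nonneg hs.1]
      nlinarith [hs.2, hs.1]
    refine (hch.mem_iff _ hb).2 ?_
    have e1 : starRingEnd ℂ e * (z + s • (z + e * I * τ - z) - p₀) =
        starRingEnd ℂ e * (z - p₀) + (s * τ : ℝ) * I := by
      rw [add_sub_cancel_left, Complex.real_smul]
      push_cast
      linear_combination (s * τ * I : ℂ) * he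
    rw [e1, add_re, add_im]
    have e2 : (((s * τ : ℝ) : ℂ) * I).re = 0 := by simp
    have e3 : (((s * τ : ℝ) : ℂ) * I).im = s * τ := by simp
    rw [e2, e3, add_zero]
    nlinarith [hs.1]
  -- horizontal segment
  have hh : segment ℝ (z₁ + e * I * τ) (z₂ + e * I * τ) ⊆ Ω := by
    intro y hy
    rw [segment_eq_image'] at hy
    obtain ⟨s, hs, rfl⟩ := hy
    have hz1m := (hch.mem_iff z₁ (by rw [mem_ball, dist_eq_norm]; linarith)).1 h1
    have hsm : ‖e * I * τ‖ = τ := by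
      rw [norm_mul, norm_mul, hch.norm_eq_one, Complex.norm_of_nonneg hτ0]; simp
    have hD' : ‖z₂ - z₁‖ = D := by rw [hD, norm_sub_rev]
    have hsD : ‖s • (z₂ - z₁)‖ ≤ D := by
      rw [norm_smul, hD', Real.norm_of_nonneg hs.1]
      nlinarith [hs.2]
    have e0 : z₁ + e * I * τ + s • (z₂ + e * I * τ - (z₁ + e * I * τ)) =
        z₁ + s • (z₂ - z₁) + e * I * τ := by
      rw [add_sub_add_right_eq_sub]; ring
    have hw : ‖z₁ + s • (z₂ - z₁) - p₀‖ < ρ := by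
      have : z₁ + s • (z₂ - z₁) ∈ ball p₀ ρ :=
        (convex_ball p₀ ρ).segment_subset (x := z₁) (y := z₂) (by rwa [mem_ball, dist_eq_norm])
          (by rwa [mem_ball, dist_eq_norm] : z₂ ∈ ball p₀ ρ)
          (by rw [segment_eq_image']; exact ⟨s, hs, rfl⟩)
      rwa [mem_ball, dist_eq_norm] at this
    simp only [e0]
    set w := z₁ + s • (z₂ - z₁) with hwdef
    have hb : w + e * I * τ ∈ ball p₀ r := by
      rw [mem_ball, dist_eq_norm]
      have : w + e * I * τ - p₀ = (w - p₀) + e * I * τ := by ring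
      rw [this]
      refine (norm_add_le _ _).trans_lt ?_
      rw [hsm]; linarith
    refine (hch.mem_iff _ hb).2 ?_
    have e1 : starRingEnd ℂ e * (w + e * I * τ - p₀) =
        starRingEnd ℂ e * (w - p₀) + (τ : ℝ) * I := by
      linear_combination (τ * I : ℂ) * he
    rw [e1, add_re, add_im]
    have e2 : (((τ : ℝ) : ℂ) * I).re = 0 := by simp
    have e3 : (((τ : ℝ) : ℂ) * I).im = τ := by simp
    rw [e2, e3, add_zero]
    have e4 : starRingEnd ℂ e * (w - p₀) = starRingEnd ℂ e * (z₁ - p₀) +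
        starRingEnd ℂ e * (s • (z₂ - z₁)) := by rw [hwdef]; ring
    have hle : ‖starRingEnd ℂ e * (s • (z₂ - z₁))‖ ≤ D := by
      rw [norm_mul, hec, one_mul]; exact hsD
    have hlip := hΛ.dist_le_mul ((starRingEnd ℂ e * (w - p₀)).re)
      (hδt (by rw [mem_ball_zero_iff, Real.norm_eq_abs]; exact (hX w hw).trans_le (min_le_left _ _)))
      ((starRingEnd ℂ e * (z₁ - p₀)).re)
      (hδt (by rw [mem_ball_zero_iff, Real.norm_eq_abs]; exact (hX z₁ hb1).trans_le (min_le_left _ _)))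
    have hre : |(starRingEnd ℂ e * (w - p₀)).re - (starRingEnd ℂ e * (z₁ - p₀)).re| ≤ D := by
      rw [e4, add_re, add_sub_cancel_left]; exact (Complex.abs_re_le_norm _).trans hle
    have him : |(starRingEnd ℂ e * (w - p₀)).im - (starRingEnd ℂ e * (z₁ - p₀)).im| ≤ D := by
      rw [e4, add_im, add_sub_cancel_left]; exact (Complex.abs_im_le_norm _).trans hle
    rw [Real.dist_eq, Real.dist_eq] at hlip
    have h5 : (Λ : ℝ) * |(starRingEnd ℂ e * (w - p₀)).re - (starRingEnd ℂ e * (z₁ - p₀)).re| ≤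
      Λ * D := mul_le_mul_of_nonneg_left hre Λ.2
    have h6 := le_abs_self (h (starRingEnd ℂ e * (w - p₀)).re - h (starRingEnd ℂ e * (z₁ - p₀)).re)
    have h7 := neg_abs_le ((starRingEnd ℂ e * (w - p₀)).im - (starRingEnd ℂ e * (z₁ - p₀)).im)
    have h8 : τ = Λ * D + D := by rw [hτ]; ring
    linarith
  have hseg : ∀ a b : ℂ, segment ℝ a b ⊆ Ω → ‖G b - G a‖ ≤ M * ‖b - a‖ := fun a b hab =>
    (convex_segment a b).norm_image_sub_le_of_norm_deriv_le (𝕜 := ℂ)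
      (fun y hy => hG.differentiableAt (hΩ.mem_nhds (hab hy))) (fun y hy => hM y (hab hy))
      (left_mem_segment ℝ a b) (right_mem_segment ℝ a b)
  have hsm : ‖e * I * τ‖ = τ := by
    rw [norm_mul, norm_mul, hch.norm_eq_one, Complex.norm_of_nonneg hτ0]; simp
  have a1 := hseg _ _ (hv z₁ h1 hb1)
  have a2 := hseg _ _ (hv z₂ h2 hb2)
  have a3 := hseg _ _ hh
  rw [add_sub_cancel_left, hsm] at a1 a2
  rw [add_sub_add_right_eq_sub, norm_sub_rev z₂ z₁] at a3
  have e5 : G z₁ - G z₂ = -(G (z₁ + e * I * τ) - G z₁) -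
      (G (z₂ + e * I * τ) - G (z₁ + e * I * τ)) + (G (z₂ + e * I * τ) - G z₂) := by ring
  rw [e5]
  calc _ ≤ ‖G (z₁ + e * I * τ) - G z₁‖ + ‖G (z₂ + e * I * τ) - G (z₁ + e * I * τ)‖ +
        ‖G (z₂ + e * I * τ) - G z₂‖ := by
        refine (norm_add_le _ _).trans (add_le_add ((norm_sub_le _ _).trans ?_) le_rfl)
        rw [norm_neg]
    _ ≤ M * τ + M * D + M * τ := by linarith
    _ = M * (2 * Λ + 3) * D := by rw [hτ]; ring

end IsC1HolderChart

theorem HasC1HolderBoundary.exists_chart {α : ℝ≥0} {Ω : Set ℂ} (h : HasC1HolderBoundary α Ω)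
    {p : ℂ} (hp : p ∈ frontier Ω) : ∃ e h C r, IsC1HolderChart α Ω p e h C r := by
  obtain ⟨e, g, C, r, h1, h2, h3, h4, h5⟩ := h p hp
  exact ⟨e, g, C, r, h1, h2, h3, h4, h5⟩

theorem IsFlatAt.mono {Ω : Set ℂ} {q C C' r r' : ℝ} {p ν : ℂ} (h : IsFlatAt Ω q C r p ν)
    (hC : C ≤ C') (hr : r' ≤ r) : IsFlatAt Ω q C' r' p ν := by
  intro ω hω
  have hle : C * ‖ω‖ ^ q ≤ C' * ‖ω‖ ^ q :=
    mul_le_mul_of_nonneg_right hC (Real.rpow_nonneg (norm_nonneg _) _)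
  obtain ⟨h1, h2⟩ := h ω (hω.trans_le hr)
  exact ⟨fun h3 => h1 (hle.trans_lt h3), fun h3 => (neg_le_neg hle).trans (h2 h3)⟩

theorem IsC1HolderDomain.isCompact_frontier {α : ℝ≥0} {Ω : Set ℂ} (h : IsC1HolderDomain α Ω) :
    IsCompact (frontier Ω) :=
  h.isBounded.isCompact_closure.of_isClosed_subset isClosed_frontier frontier_subset_closure

/-- Compactness of the boundary makes the constants uniform. Uniformity matters because barriers
will be placed at the boundary point nearest to an arbitrary interior point. -/
theorem IsC1HolderDomain.exists_isFlatAt {α : ℝ≥0} {Ω : Set ℂ} (h : IsC1HolderDomain α Ω) :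
    ∃ C r : ℝ, 0 ≤ C ∧ 0 < r ∧ ∀ p ∈ frontier Ω, ∃ ν : ℂ, ‖ν‖ = 1 ∧
      IsFlatAt Ω (1 + α) C r p ν := by
  refine h.isCompact_frontier.induction_on (p := fun S => ∃ C r : ℝ, 0 ≤ C ∧ 0 < r ∧
    ∀ p ∈ S, ∃ ν : ℂ, ‖ν‖ = 1 ∧ IsFlatAt Ω (1 + α) C r p ν) ?_ ?_ ?_ ?_
  · exact ⟨0, 1, le_rfl, one_pos, by simp⟩
  · rintro s t hst ⟨C, r, hC, hr, H⟩
    exact ⟨C, r, hC, hr, fun p hp => H p (hst hp)⟩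
  · rintro s t ⟨C, r, hC, hr, H⟩ ⟨C', r', hC', hr', H'⟩
    refine ⟨max C C', min r r', le_max_of_le_left hC, lt_min hr hr', ?_⟩
    rintro p (hp | hp)
    · obtain ⟨ν, h1, h2⟩ := H p hp
      exact ⟨ν, h1, h2.mono (le_max_left _ _) (min_le_left _ _)⟩
    · obtain ⟨ν, h1, h2⟩ := H' p hp
      exact ⟨ν, h1, h2.mono (le_max_right _ _) (min_le_right _ _)⟩
  · intro p₀ hp₀
    obtain ⟨e, g, C, r, hch⟩ := h.boundary.exists_chart hp₀
    have hr := hch.pos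
    refine ⟨frontier Ω ∩ ball p₀ (r / 2), inter_mem self_mem_nhdsWithin
      (mem_nhdsWithin_of_mem_nhds (ball_mem_nhds _ (by positivity))), C, r / 2, C.2,
      by positivity, ?_⟩
    rintro p ⟨hp, hpb⟩
    rw [mem_ball] at hpb
    exact ⟨_, IsC1HolderChart.norm_normal hch.norm_eq_one _,
      hch.isFlatAt h.isOpen hp (by linarith) (by positivity)⟩

/-! ### Barriers, linear growth of the Green function, and Hopf's lemma. -/

/-- Near the imaginary axis, `ω ^ q` has negative real part when `1 < q < 2`. -/
theorem exists_re_cpow_le {q : ℝ} (hq1 : 1 < q) (hq2 : q < 2) :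
    ∃ κ > 0, ∃ δ > 0, ∀ ω : ℂ, |ω.re| ≤ δ * ‖ω‖ → (ω ^ (q : ℂ)).re ≤ -(κ * ‖ω‖ ^ q) := by
  have hπ := Real.pi_pos
  have hcos : Real.cos (Real.pi / 2 * q) < 0 :=
    Real.cos_neg_of_pi_div_two_lt_of_lt (by nlinarith) (by nlinarith)
  set κ := -Real.cos (Real.pi / 2 * q) / 2 with hκ
  have hκ0 : 0 < κ := by rw [hκ]; linarith
  -- The arguments `θ` for which the estimate fails. At `θ = ±π/2` it holds strictly, because `π/2 <
  -- qπ/2 < π`; so `cos θ` does not vanish on the compact set `K` and has a positive lower bound `δ`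
  -- in modulus.
  set K : Set ℝ := Icc (-Real.pi) Real.pi ∩ {θ | -κ ≤ Real.cos (θ * q)} with hK
  have hKc : IsCompact K :=
    isCompact_Icc.inter_right (isClosed_le continuous_const (by fun_prop))
  have hpos : ∀ θ ∈ K, 0 < |Real.cos θ| := by
    rintro θ ⟨hθ, hθκ⟩
    rw [abs_pos]
    intro h0
    have h1 : |θ| = Real.pi / 2 := by
      refine Real.injOn_cos ⟨abs_nonneg _, abs_le.2 hθ⟩ ⟨by positivity, by linarith⟩ ?_
      rw [Real.cos_abs, h0, Real.cos_pi_div_two]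
    have h2 : Real.cos (θ * q) = Real.cos (Real.pi / 2 * q) := by
      rw [← Real.cos_abs, abs_mul, h1, abs_of_pos (by linarith : 0 < q)]
    have h3 : -κ ≤ Real.cos (θ * q) := hθκ
    rw [h2] at h3
    linarith
  obtain ⟨δ, hδ, hδK⟩ : ∃ δ > 0, ∀ θ ∈ K, δ < |Real.cos θ| := by
    rcases K.eq_empty_or_nonempty with he | hne
    · exact ⟨1, one_pos, by simp [he]⟩
    · obtain ⟨θ₀, hθ₀, hmin⟩ := hKc.exists_isMinOn hne
        (Real.continuous_cos.abs.continuousOn (s := K))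
      refine ⟨|Real.cos θ₀| / 2, half_pos (hpos _ hθ₀), fun θ hθ => ?_⟩
      have h1 : |Real.cos θ₀| ≤ |Real.cos θ| := hmin hθ
      linarith [hpos _ hθ₀]
  refine ⟨κ, hκ0, δ, hδ, fun ω hω => ?_⟩
  rcases eq_or_ne ω 0 with rfl | h0
  · have : (q : ℂ) ≠ 0 := by exact_mod_cast (by linarith : q ≠ 0)
    simp [Complex.zero_cpow this, Real.zero_rpow (by linarith : q ≠ 0)]
  · have hn : 0 < ‖ω‖ := norm_pos_iff.2 h0
    rw [Complex.cpow_ofReal_re]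
    have h1 : Complex.arg ω ∉ K := by
      intro hmem
      have := hδK _ hmem
      rw [Complex.cos_arg h0, abs_div, abs_of_pos hn, lt_div_iff₀ hn] at this
      linarith
    have h2 : Real.cos (Complex.arg ω * q) ≤ -κ := by
      by_contra hcon
      exact h1 ⟨⟨(Complex.neg_pi_lt_arg ω).le, Complex.arg_le_pi ω⟩, (not_le.1 hcon).le⟩
    have h3 : 0 < ‖ω‖ ^ q := Real.rpow_pos_of_pos hn _
    nlinarith

/-- Barrier functions on domains whose boundary is flat to order `q`. -/
theorem exists_barrier {q : ℝ} (hq1 : 1 < q) (hq2 : q < 2) {C : ℝ} (hC : 0 ≤ C) :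
    ∃ A > 0, ∃ ρ₀ > 0, ρ₀ ≤ 1 ∧ ∀ ω : ℂ, ‖ω‖ ≤ ρ₀ →
      (-(C * ‖ω‖ ^ q) ≤ ω.re → ‖ω‖ ^ q ≤ ω.re - A * (ω ^ (q : ℂ)).re ∧
        (ω = 0 ∨ ω ∈ slitPlane)) ∧
      (|ω.re| ≤ C * ‖ω‖ ^ q → ω.re + A * (ω ^ (q : ℂ)).re ≤ 0) := by
  obtain ⟨κ, hκ, δ, hδ, H⟩ := exists_re_cpow_le hq1 hq2
  -- Near the imaginary axis `-A Re ω^q ≥ (C + 1) |ω|^q`, which absorbs the deviation `C |ω|^q` of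
  -- the boundary. Thus `Re (ω - A ω^q)` is a barrier from above and `Re (ω + A ω^q)` one from
  -- below.
  set A := (C + 1) / κ with hA
  have hA0 : 0 < A := by positivity
  have hAκ : A * κ = C + 1 := by rw [hA]; field_simp
  set η := min δ 1 / (2 * (C + A + 1)) with hη
  have hη0 : 0 < η := by positivity
  have hηm : η * (2 * (C + A + 1)) = min δ 1 := by rw [hη]; field_simp
  have hm1 := min_le_left δ 1
  have hm2 := min_le_right δ 1
  have hm0 : 0 < min δ 1 := by positivity
  -- This radius makes `|ω|^q ≤ η |ω|`, so that away from the imaginary axis the power terms are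
  -- dominated by `|ω.re| > δ |ω|`.
  refine ⟨A, hA0, min 1 (η ^ (1 / (q - 1))), by positivity, min_le_left _ _, fun ω hω => ?_⟩
  have hsmall : ‖ω‖ ^ q ≤ η * ‖ω‖ := by
    rcases eq_or_ne ω 0 with rfl | h0
    · simp [Real.zero_rpow (by linarith : q ≠ 0)]
    · have hn : 0 < ‖ω‖ := norm_pos_iff.2 h0
      have h1 : ‖ω‖ ^ (q - 1) ≤ η := by
        calc _ ≤ (η ^ (1 / (q - 1))) ^ (q - 1) :=
              Real.rpow_le_rpow hn.le (hω.trans (min_le_right _ _)) (by linarith)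
          _ = η := by
            rw [← Real.rpow_mul hη0.le, one_div_mul_cancel (by linarith : q - 1 ≠ 0),
              Real.rpow_one]
      have h2 : ‖ω‖ ^ q = ‖ω‖ ^ (q - 1) * ‖ω‖ := by
        rw [← Real.rpow_add_one hn.ne']; ring_nf
      rw [h2]; gcongr
  have hn := norm_nonneg ω
  have hnq : 0 ≤ ‖ω‖ ^ q := by positivity
  have hCsmall : C * ‖ω‖ ^ q ≤ min δ 1 / 2 * ‖ω‖ := by
    have : C * ‖ω‖ ^ q ≤ C * (η * ‖ω‖) := mul_le_mul_of_nonneg_left hsmall hC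
    have h5 : 0 ≤ (η * (A + 1)) * ‖ω‖ := by positivity
    nlinarith
  have hAsmall : (A + 1) * ‖ω‖ ^ q ≤ min δ 1 / 2 * ‖ω‖ := by
    have : (A + 1) * ‖ω‖ ^ q ≤ (A + 1) * (η * ‖ω‖) :=
      mul_le_mul_of_nonneg_left hsmall (by positivity)
    have h5 : 0 ≤ (η * C) * ‖ω‖ := by positivity
    nlinarith
  have hδω : min δ 1 * ‖ω‖ ≤ δ * ‖ω‖ := mul_le_mul_of_nonneg_right hm1 hn
  refine ⟨fun hre => ⟨?_, ?_⟩, fun hre => ?_⟩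
  · by_cases hcase : |ω.re| ≤ δ * ‖ω‖
    · have h1 := H ω hcase
      have h2 : A * (ω ^ (q : ℂ)).re ≤ A * -(κ * ‖ω‖ ^ q) := mul_le_mul_of_nonneg_left h1 hA0.le
      have h3 : A * -(κ * ‖ω‖ ^ q) = -((C + 1) * ‖ω‖ ^ q) := by rw [← hAκ]; ring
      nlinarith
    · rw [not_le] at hcase
      have hpos : 0 ≤ ω.re := by
        by_contra hneg
        rw [not_le] at hneg
        rw [abs_of_neg hneg] at hcase
        nlinarith
      rw [abs_of_nonneg hpos] at hcase
      have h1 : (ω ^ (q : ℂ)).re ≤ ‖ω‖ ^ q :=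
        (Complex.re_le_norm _).trans_eq (Complex.norm_cpow_real _ _)
      nlinarith
  · rcases eq_or_ne ω 0 with h0 | h0
    · exact Or.inl h0
    · right
      rw [mem_slitPlane_iff]
      by_contra hcon
      push Not at hcon
      have hnp : 0 < ‖ω‖ := norm_pos_iff.2 h0
      have h1 : ‖ω‖ = |ω.re| := by
        rw [← Complex.abs_re_eq_norm.2 hcon.2]
      rw [abs_of_nonpos hcon.1] at h1
      nlinarith
  · have hcase : |ω.re| ≤ δ * ‖ω‖ := by nlinarith
    have h1 := H ω hcase
    have h2 : A * (ω ^ (q : ℂ)).re ≤ A * -(κ * ‖ω‖ ^ q) := mul_le_mul_of_nonneg_left h1 hA0.le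
    have h3 : A * -(κ * ‖ω‖ ^ q) = -((C + 1) * ‖ω‖ ^ q) := by rw [← hAκ]; ring
    have h4 := (abs_le.1 hre).2
    nlinarith

theorem IsGreenFunction.harmonicAt {Ω : Set ℂ} {c : ℂ} {U : ℂ → ℝ} (hU : IsGreenFunction Ω c U)
    (hΩ : IsOpen Ω) {z : ℂ} (hz : z ∈ Ω) (hzc : z ≠ c) : HarmonicAt U z := by
  obtain ⟨H, hH, hUH⟩ := hU.exists_harmonic
  have h1 : HarmonicAt (fun z => -(1 / (2 * Real.pi)) * Real.log ‖z - c‖ + H z) z := by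
    refine HarmonicAt.add ?_ (hH z hz)
    have : AnalyticAt ℂ (fun z => z - c) z := analyticAt_id.sub analyticAt_const
    exact (this.harmonicAt_log_norm (sub_ne_zero.2 hzc)).const_smul
  refine (harmonicAt_congr_nhds ?_).2 h1
  filter_upwards [hΩ.eventually_mem hz, isOpen_ne.eventually_mem hzc] with y hy hyc
  exact hUH y hy hyc

theorem norm_conj_mul_sub {ν : ℂ} (hν : ‖ν‖ = 1) (z p : ℂ) :
    ‖starRingEnd ℂ ν * (z - p)‖ = ‖z - p‖ := by
  rw [norm_mul, RCLike.norm_conj, hν, one_mul]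

theorem add_mul_conj_mul_sub {ν : ℂ} (hν : ‖ν‖ = 1) (z p : ℂ) :
    p + ν * (starRingEnd ℂ ν * (z - p)) = z := by
  have := conj_mul_self_of_norm_eq_one hν
  linear_combination (z - p) * this

theorem conj_mul_add_mul_sub {ν : ℂ} (hν : ‖ν‖ = 1) (p ω : ℂ) :
    starRingEnd ℂ ν * (p + ν * ω - p) = ω := by
  have := conj_mul_self_of_norm_eq_one hν
  linear_combination ω * this

/-- In flat coordinates, the real and `q`-th power functions are continuous and harmonic. -/
theorem continuousOn_barrier {q : ℝ} (hq : 0 < q) (A : ℝ) (p ν : ℂ) {S : Set ℂ}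
    (hS : ∀ z ∈ S, starRingEnd ℂ ν * (z - p) = 0 ∨ starRingEnd ℂ ν * (z - p) ∈ slitPlane) :
    ContinuousOn (fun z => (starRingEnd ℂ ν * (z - p) +
      A * (starRingEnd ℂ ν * (z - p)) ^ (q : ℂ)).re) S := by
  intro z hz
  have h1 : ContinuousAt (fun ω : ℂ => ω ^ (q : ℂ)) (starRingEnd ℂ ν * (z - p)) := by
    rcases hS z hz with h | h
    · rw [h]
      exact Complex.continuousAt_cpow_const_of_re_pos (Or.inl le_rfl) (by simpa using hq)
    · exact continuousAt_cpow_const h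
  have h2 : ContinuousAt (fun z => starRingEnd ℂ ν * (z - p)) z := by fun_prop
  have h3 : ContinuousAt (fun z => (starRingEnd ℂ ν * (z - p)) ^ (q : ℂ)) z :=
    ContinuousAt.comp (g := fun ω : ℂ => ω ^ (q : ℂ)) h1 h2
  exact (Complex.continuous_re.continuousAt.comp
    (h2.add (h3.const_mul (A : ℂ)))).continuousWithinAt

theorem harmonicOnNhd_barrier {q : ℝ} (A : ℝ) (p ν : ℂ) {S : Set ℂ}
    (hS : ∀ z ∈ S, starRingEnd ℂ ν * (z - p) ∈ slitPlane) :
    HarmonicOnNhd (fun z => (starRingEnd ℂ ν * (z - p) +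
      A * (starRingEnd ℂ ν * (z - p)) ^ (q : ℂ)).re) S := by
  intro z hz
  have h1 : AnalyticAt ℂ (fun z => starRingEnd ℂ ν * (z - p)) z := by fun_prop
  exact (h1.add (analyticAt_const.mul (h1.cpow analyticAt_const (hS z hz)))).harmonicAt_re

/-- The Green's function grows at most linearly away from the boundary. -/
theorem IsGreenFunction.exists_le {Ω : Set ℂ} (hΩ : IsOpen Ω) (hb : Bornology.IsBounded Ω)
    {c : ℂ} (hc : c ∈ Ω) {U : ℂ → ℝ} (hU : IsGreenFunction Ω c U) {q C r : ℝ}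
    (hq1 : 1 < q) (hq2 : q < 2) (hC : 0 ≤ C) (hr : 0 < r) :
    ∃ m A ρ : ℝ, 0 ≤ m ∧ 0 ≤ A ∧ 0 < ρ ∧ ρ ≤ 1 ∧ ∀ p ∈ frontier Ω, ∀ ν : ℂ, ‖ν‖ = 1 →
      IsFlatAt Ω q C r p ν → ∀ ω : ℂ, ‖ω‖ < ρ → p + ν * ω ∈ Ω →
        p + ν * ω ≠ c ∧ U (p + ν * ω) ≤ m * (ω.re + A * ‖ω‖ ^ q) := by
  obtain ⟨d, hd, hdΩ⟩ := Metric.isOpen_iff.1 hΩ c hc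
  obtain ⟨A, hA, ρ₀, hρ₀, hρ₀1, HB⟩ := exists_barrier hq1 hq2 hC
  -- `U` is bounded off the disc of radius `d / 2` about the pole; discs of radius `ρ ≤ d / 2` about
  -- boundary points stay there, so the constants do not depend on the boundary point.
  have hKc : IsCompact (closure Ω ∩ {z | d / 2 ≤ dist z c}) :=
    hb.isCompact_closure.inter_right (isClosed_le continuous_const (by fun_prop))
  have hUK : ContinuousOn U (closure Ω ∩ {z | d / 2 ≤ dist z c}) := by
    refine hU.continuousOn.mono fun z hz => ⟨hz.1, ?_⟩
    rintro rfl
    have := hz.2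
    simp at this
    linarith
  obtain ⟨M₀, hM₀⟩ := hKc.bddAbove_image hUK
  set M := max M₀ 0
  have hM : ∀ z ∈ closure Ω, d / 2 ≤ dist z c → U z ≤ M := fun z hz hzd =>
    (hM₀ ⟨z, ⟨hz, hzd⟩, rfl⟩).trans (le_max_left _ _)
  have hM0 : 0 ≤ M := le_max_right _ _
  set ρ := min ρ₀ (min (r / 2) (d / 2)) with hρdef
  have hρ : 0 < ρ := by positivity
  have hρr : ρ < r := (min_le_right _ _).trans_lt ((min_le_left _ _).trans_lt (by linarith))
  have hρd : ρ ≤ d / 2 := (min_le_right _ _).trans (min_le_right _ _)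
  have hρρ₀ : ρ ≤ ρ₀ := min_le_left _ _
  refine ⟨M / ρ ^ q, A, ρ, by positivity, hA.le, hρ, hρρ₀.trans hρ₀1, fun p hp ν hν hflat => ?_⟩
  have hpΩ : p ∉ Ω := by rw [hΩ.frontier_eq] at hp; exact hp.2
  have hpd : d ≤ dist p c := by
    by_contra h
    exact hpΩ (hdΩ (by rw [mem_ball]; linarith))
  set V := Ω ∩ ball p ρ with hV
  have hVo : IsOpen V := hΩ.inter isOpen_ball
  have hVcl : closure V ⊆ closure Ω ∩ closedBall p ρ := fun z hz =>
    ⟨closure_mono inter_subset_left hz,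
      closure_minimal (inter_subset_right.trans ball_subset_closedBall) isClosed_closedBall hz⟩
  have hfar : ∀ z ∈ closedBall p ρ, d / 2 ≤ dist z c := by
    intro z hz
    rw [mem_closedBall] at hz
    have := dist_triangle_left p c z
    linarith
  have hVne : ∀ z ∈ closedBall p ρ, z ≠ c := by
    rintro z hz rfl
    have := hfar z hz
    simp at this
    linarith
  have hre : ∀ z ∈ closure V,
      -(C * ‖starRingEnd ℂ ν * (z - p)‖ ^ q) ≤ (starRingEnd ℂ ν * (z - p)).re := by
    have hcl : IsClosed {z : ℂ | -(C * ‖starRingEnd ℂ ν * (z - p)‖ ^ q) ≤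
        (starRingEnd ℂ ν * (z - p)).re} := by
      refine isClosed_le ?_ (by fun_prop)
      refine (continuous_const.mul (Continuous.rpow_const (by fun_prop) ?_)).neg
      intro _; right; linarith
    refine fun z hz => closure_minimal (fun y hy => ?_) hcl hz
    have hyb := hy.2
    rw [mem_ball, dist_eq_norm] at hyb
    refine (hflat _ (by rw [norm_conj_mul_sub hν]; linarith)).2 ?_
    rw [add_mul_conj_mul_sub hν]; exact hy.1
  have hbar : ∀ z ∈ closure V, ‖starRingEnd ℂ ν * (z - p)‖ ^ q ≤
      (starRingEnd ℂ ν * (z - p)).re - A * ((starRingEnd ℂ ν * (z - p)) ^ (q : ℂ)).re ∧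
      (starRingEnd ℂ ν * (z - p) = 0 ∨ starRingEnd ℂ ν * (z - p) ∈ slitPlane) := by
    intro z hz
    have hzb := (hVcl hz).2
    rw [mem_closedBall, dist_eq_norm] at hzb
    exact (HB _ (by rw [norm_conj_mul_sub hν]; linarith)).1 (hre z hz)
  set B : ℂ → ℝ := fun z => (starRingEnd ℂ ν * (z - p) +
    ((-A : ℝ) : ℂ) * (starRingEnd ℂ ν * (z - p)) ^ (q : ℂ)).re with hBdef
  have hBeq : ∀ z, B z = (starRingEnd ℂ ν * (z - p)).re -
      A * ((starRingEnd ℂ ν * (z - p)) ^ (q : ℂ)).re := by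
    intro z
    rw [hBdef]
    simp only
    rw [add_re, Complex.re_ofReal_mul]
    ring
  have hUV : HarmonicOnNhd U V := fun z hz =>
    hU.harmonicAt hΩ hz.1 (hVne z (ball_subset_closedBall hz.2))
  have hUc : ContinuousOn U (closure V) :=
    hU.continuousOn.mono fun z hz => ⟨(hVcl hz).1, hVne z (hVcl hz).2⟩
  have hBc : ContinuousOn B (closure V) :=
    continuousOn_barrier (by linarith) _ p ν fun z hz => (hbar z hz).2
  have hBh : HarmonicOnNhd B V := harmonicOnNhd_barrier _ p ν fun z hz =>
    (hbar z (subset_closure hz)).2.resolve_left (by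
      intro h0
      have := add_mul_conj_mul_sub hν z p
      rw [h0, mul_zero, add_zero] at this
      exact hpΩ (this ▸ hz.1))
  -- Comparison on the frontier of `V`: on the circle `B ≥ ρ^q` and `U ≤ M`, and on the boundary of
  -- the domain `U = 0 ≤ B`.
  have hcomp : ∀ z ∈ closure V, U z ≤ M / ρ ^ q * B z := by
    intro z hz
    refine hUV.le_of_frontier_le_fun hVo (hb.subset inter_subset_left) hUc
      (hBh.const_smul (c := M / ρ ^ q)) (hBc.const_smul (M / ρ ^ q)) (fun y hy => ?_) hz
    have hycl := frontier_subset_closure hy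
    have hB0 : ‖starRingEnd ℂ ν * (y - p)‖ ^ q ≤ B y := by
      rw [hBeq]; exact (hbar y hycl).1
    simp only [Pi.smul_apply, smul_eq_mul]
    by_cases hyΩ : y ∈ Ω
    · have hyb : ‖starRingEnd ℂ ν * (y - p)‖ = ρ := by
        rw [norm_conj_mul_sub hν, ← dist_eq_norm]
        refine le_antisymm (hVcl hycl).2 ?_
        by_contra hlt
        rw [hVo.frontier_eq] at hy
        exact hy.2 ⟨hyΩ, not_le.1 hlt⟩
      rw [hyb] at hB0
      refine (hM y (hVcl hycl).1 (hfar y (hVcl hycl).2)).trans ?_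
      have : 0 < ρ ^ q := by positivity
      calc M = M / ρ ^ q * ρ ^ q := by field_simp
        _ ≤ _ := by gcongr
    · rw [hU.eq_zero y (by rw [hΩ.frontier_eq]; exact ⟨(hVcl hycl).1, hyΩ⟩)]
      have : 0 ≤ B y := le_trans (by positivity) hB0
      positivity
  intro ω hω hωΩ
  have hmem : p + ν * ω ∈ V := ⟨hωΩ, by
    rw [mem_ball, dist_eq_norm, add_sub_cancel_left, norm_mul, hν, one_mul]; exact hω⟩
  refine ⟨hVne _ (ball_subset_closedBall hmem.2), (hcomp _ (subset_closure hmem)).trans ?_⟩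
  rw [hBeq, conj_mul_add_mul_sub hν]
  have h1 : -(ω ^ (q : ℂ)).re ≤ ‖ω‖ ^ q :=
    ((neg_le_abs _).trans (Complex.abs_re_le_norm _)).trans_eq (Complex.norm_cpow_real _ _)
  have h2 : 0 ≤ M / ρ ^ q := by positivity
  refine mul_le_mul_of_nonneg_left ?_ h2
  nlinarith

/-- **Hopf's lemma** for the Green's function. -/
theorem IsGreenFunction.exists_mul_le {Ω : Set ℂ} (hΩ : IsOpen Ω)
    {c : ℂ} (hc : c ∈ Ω) {U : ℂ → ℝ} (hU : IsGreenFunction Ω c U)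
    (hUpos : ∀ z ∈ Ω, z ≠ c → 0 < U z) {q C r : ℝ}
    (hq1 : 1 < q) (hq2 : q < 2) (hC : 0 ≤ C) (hr : 0 < r) {p ν : ℂ} (hp : p ∈ frontier Ω)
    (hν : ‖ν‖ = 1) (hflat : IsFlatAt Ω q C r p ν) :
    ∃ m > 0, ∀ᶠ t : ℝ in 𝓝[>] 0, m * t ≤ U (p + ν * t) := by
  have hq0 : 0 < q := by linarith
  have hpΩ : p ∉ Ω := by rw [hΩ.frontier_eq] at hp; exact hp.2
  have hpc : 0 < dist p c := dist_pos.2 fun h => hpΩ (h ▸ hc)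
  obtain ⟨A, hA, ρ₀, hρ₀, hρ₀1, HB⟩ := exists_barrier hq1 hq2 (C := C + 1) (by linarith)
  set ρ := min ρ₀ (min (r / 2) (dist p c / 2)) with hρdef
  have hρ : 0 < ρ := by positivity
  have hρr : ρ < r := (min_le_right _ _).trans_lt ((min_le_left _ _).trans_lt (by linarith))
  have hρd : ρ < dist p c :=
    (min_le_right _ _).trans_lt ((min_le_right _ _).trans_lt (by linarith))
  have hρρ₀ : ρ ≤ ρ₀ := min_le_left _ _
  set κ : ℂ → ℂ := fun z => starRingEnd ℂ ν * (z - p) with hκ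
  have hκn : ∀ z, ‖κ z‖ = ‖z - p‖ := fun z => norm_conj_mul_sub hν z p
  have hκc : Continuous κ := by fun_prop
  have hrp : Continuous fun z => (C + 1) * ‖κ z‖ ^ q :=
    continuous_const.mul (Continuous.rpow_const (by fun_prop) fun _ => Or.inr hq0.le)
  set V := ball p ρ ∩ {z | (C + 1) * ‖κ z‖ ^ q < (κ z).re} with hV
  have hVo : IsOpen V := isOpen_ball.inter (isOpen_lt hrp (by fun_prop))
  have hVcl : closure V ⊆ closedBall p ρ ∩ {z | (C + 1) * ‖κ z‖ ^ q ≤ (κ z).re} :=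
    closure_minimal (fun z hz => ⟨ball_subset_closedBall hz.1, by
        have h5 : (C + 1) * ‖κ z‖ ^ q < (κ z).re := hz.2
        exact h5.le⟩)
      (isClosed_closedBall.inter (isClosed_le hrp (by fun_prop)))
  have hmemΩ : ∀ z ∈ closure V, z ≠ p → z ∈ Ω := by
    intro z hz hzp
    obtain ⟨h1, h2⟩ := hVcl hz
    rw [mem_closedBall, dist_eq_norm] at h1
    have h3 := (hflat (κ z) (by rw [hκn]; linarith)).1
    rw [hκ] at h3
    simp only [add_mul_conj_mul_sub hν] at h3
    refine h3 ?_
    have h4 : 0 < ‖κ z‖ ^ q := by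
      refine Real.rpow_pos_of_pos ?_ _
      rw [hκn]; exact norm_pos_iff.2 (sub_ne_zero.2 hzp)
    have h5 : (C + 1) * ‖κ z‖ ^ q ≤ (κ z).re := h2
    linarith
  have hne : ∀ z ∈ closure V, z ≠ c := by
    rintro z hz rfl
    have := (hVcl hz).1
    rw [mem_closedBall, dist_comm] at this
    linarith
  have hclΩ : ∀ z ∈ closure V, z ∈ closure Ω := by
    intro z hz
    by_cases h : z = p
    · rw [h]; exact frontier_subset_closure hp
    · exact subset_closure (hmemΩ z hz h)
  have hU0 : ∀ z ∈ closure V, 0 ≤ U z := by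
    intro z hz
    by_cases h : z = p
    · rw [h, hU.eq_zero p hp]
    · exact (hUpos z (hmemΩ z hz h) (hne z hz)).le
  have hUc : ContinuousOn U (closure V) :=
    hU.continuousOn.mono fun z hz => ⟨hclΩ z hz, hne z hz⟩
  have hclc : IsCompact (closure V) := (isBounded_ball.subset inter_subset_left).isCompact_closure
  obtain ⟨m₀, hm₀, hm₀U⟩ : ∃ m₀ > 0, ∀ z ∈ closure V ∩ sphere p ρ, m₀ ≤ U z := by
    have hKc : IsCompact (closure V ∩ sphere p ρ) := hclc.inter_right isClosed_sphere
    rcases (closure V ∩ sphere p ρ).eq_empty_or_nonempty with he | hn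
    · exact ⟨1, one_pos, by simp [he]⟩
    · obtain ⟨z₀, hz₀, hmin⟩ := hKc.exists_isMinOn hn (hUc.mono inter_subset_left)
      have : z₀ ≠ p := by
        rintro rfl
        have := hz₀.2
        simp at this
        linarith
      exact ⟨U z₀, hUpos _ (hmemΩ _ hz₀.1 this) (hne _ hz₀.1), fun z hz => hmin hz⟩
  set B : ℂ → ℝ := fun z => (κ z + (A : ℂ) * (κ z) ^ (q : ℂ)).re with hBdef
  have hBeq : ∀ z, B z = (κ z).re + A * ((κ z) ^ (q : ℂ)).re := by
    intro z
    rw [hBdef]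
    simp only
    rw [add_re, Complex.re_ofReal_mul]
  have hslit : ∀ z ∈ closure V, κ z = 0 ∨ κ z ∈ slitPlane := by
    intro z hz
    obtain ⟨h1, h2⟩ := hVcl hz
    have h5 : (C + 1) * ‖κ z‖ ^ q ≤ (κ z).re := h2
    by_cases h0 : κ z = 0
    · exact Or.inl h0
    · right
      rw [mem_slitPlane_iff]; left
      have : 0 < ‖κ z‖ ^ q := Real.rpow_pos_of_pos (norm_pos_iff.2 h0) _
      exact lt_of_lt_of_le (by positivity) h5
  have hBc : ContinuousOn B (closure V) := continuousOn_barrier hq0 A p ν hslit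
  have hBh : HarmonicOnNhd B V := harmonicOnNhd_barrier A p ν fun z hz => by
    rw [mem_slitPlane_iff]; left
    have h5 : (C + 1) * ‖κ z‖ ^ q < (κ z).re := hz.2
    exact lt_of_le_of_lt (by positivity) h5
  have hUV : HarmonicOnNhd U V := by
    intro z hz
    refine hU.harmonicAt hΩ (hmemΩ z (subset_closure hz) ?_) (hne z (subset_closure hz))
    rintro rfl
    have h5 : (C + 1) * ‖κ z‖ ^ q < (κ z).re := hz.2
    have h6 : κ z = 0 := by simp [hκ]
    rw [h6] at h5
    simp [Real.zero_rpow hq0.ne'] at h5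
  set b := 1 + A with hb
  have hb0 : 0 < b := by positivity
  have hcomp : ∀ z ∈ closure V, m₀ / b * B z ≤ U z := by
    intro z hz
    refine (hBh.const_smul (c := m₀ / b)).le_of_frontier_le_fun hVo
      (isBounded_ball.subset inter_subset_left) (hBc.const_smul (m₀ / b)) hUV hUc
      (fun y hy => ?_) hz
    have hycl := frontier_subset_closure hy
    obtain ⟨h1, h2⟩ := hVcl hycl
    have h5 : (C + 1) * ‖κ y‖ ^ q ≤ (κ y).re := h2
    have h1' : ‖κ y‖ ≤ ρ := by rw [hκn, ← dist_eq_norm]; exact h1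
    simp only [Pi.smul_apply, smul_eq_mul]
    have hnq : 0 ≤ ‖κ y‖ ^ q := by positivity
    by_cases hyb : dist y p = ρ
    · have hBb : B y ≤ b := by
        rw [hBeq, hb]
        have h6 : ((κ y) ^ (q : ℂ)).re ≤ 1 := by
          refine (Complex.re_le_norm _).trans ?_
          rw [Complex.norm_cpow_real]
          exact Real.rpow_le_one (norm_nonneg _) (by linarith) hq0.le
        have h7 : (κ y).re ≤ 1 := (Complex.re_le_norm _).trans (by linarith)
        nlinarith
      calc m₀ / b * B y ≤ m₀ / b * b := by gcongr
        _ = m₀ := by field_simp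
        _ ≤ U y := hm₀U y ⟨hycl, hyb⟩
    · have hlt : dist y p < ρ := lt_of_le_of_ne h1 hyb
      have h6 : (κ y).re = (C + 1) * ‖κ y‖ ^ q := by
        refine le_antisymm ?_ h5
        by_contra hcon
        rw [hVo.frontier_eq] at hy
        exact hy.2 ⟨hlt, not_le.1 hcon⟩
      have h7 : B y ≤ 0 := by
        rw [hBeq]
        refine (HB (κ y) (by linarith)).2 ?_
        rw [h6, abs_of_nonneg (by positivity)]
      exact (mul_nonpos_of_nonneg_of_nonpos (by positivity) h7).trans (hU0 y hycl)
  refine ⟨m₀ / b, by positivity, ?_⟩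
  have hlim : Tendsto (fun t : ℝ => (C + 1) * t ^ (q - 1)) (𝓝[>] 0) (𝓝 0) := by
    have h1 : ContinuousAt (fun t : ℝ => (C + 1) * t ^ (q - 1)) 0 :=
      continuousAt_const.mul (Real.continuousAt_rpow_const _ _ (Or.inr (by linarith)))
    have h2 := h1.tendsto
    simp only [Real.zero_rpow (by linarith : q - 1 ≠ 0), mul_zero] at h2
    exact h2.mono_left nhdsWithin_le_nhds
  filter_upwards [hlim.eventually_lt_const one_pos, Ioo_mem_nhdsGT hρ] with t ht ht0
  have htq : t ^ q = t ^ (q - 1) * t := by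
    rw [← Real.rpow_add_one ht0.1.ne']; ring_nf
  have hκt : κ (p + ν * t) = t := conj_mul_add_mul_sub hν p t
  have hmem : p + ν * t ∈ V := by
    refine ⟨?_, ?_⟩
    · rw [mem_ball, dist_eq_norm, add_sub_cancel_left, norm_mul, hν, one_mul,
        Complex.norm_of_nonneg ht0.1.le]
      exact ht0.2
    · change (C + 1) * ‖κ (p + ν * t)‖ ^ q < (κ (p + ν * t)).re
      rw [hκt, Complex.norm_of_nonneg ht0.1.le, Complex.ofReal_re, htq]
      nlinarith [ht0.1]
  refine le_trans ?_ (hcomp _ (subset_closure hmem))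
  rw [hBeq, hκt]
  have h8 : 0 ≤ (((t : ℂ)) ^ (q : ℂ)).re := by
    rw [← Complex.ofReal_cpow ht0.1.le, Complex.ofReal_re]
    exact Real.rpow_nonneg ht0.1.le _
  rw [Complex.ofReal_re]
  have h9 : 0 ≤ A * (((t : ℂ)) ^ (q : ℂ)).re := by positivity
  gcongr
  linarith

/-! ### Lipschitz extension of the Riemann map to the boundary. -/

/-- Schwarz–Pick on the largest disc about `z` gives `|G'| ≤ (1 - |G|²) / d`, and the barrier at the
nearest boundary point gives `1 - |G|² ≤ 4π U ≤ 4π m (1 + A) d`. Far from the boundary `1 / ρ`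
suffices. -/
theorem IsRiemannMap.exists_norm_deriv_le {α : ℝ≥0} (hα₀ : 0 < α) (hα₁ : α < 1) {Ω : Set ℂ}
    (hΩ : IsC1HolderDomain α Ω) {c : ℂ} {G : ℂ → ℂ} (h : IsRiemannMap Ω c G) {U : ℂ → ℝ}
    (hU : IsGreenFunction Ω c U) : ∃ M, ∀ z ∈ Ω, ‖deriv G z‖ ≤ M := by
  obtain ⟨C, r, hC, hr, hflat⟩ := hΩ.exists_isFlatAt
  have hα₀' : (0 : ℝ) < α := by exact_mod_cast hα₀
  have hα₁' : (α : ℝ) < 1 := by exact_mod_cast hα₁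
  obtain ⟨m, A, ρ, hm, hA, hρ, hρ1, hle⟩ := hU.exists_le hΩ.isOpen hΩ.isBounded h.mem
    (q := 1 + α) (by linarith) (by linarith) hC hr
  have hne : (Ωᶜ).Nonempty := by
    rw [nonempty_compl]
    rintro rfl
    exact NormedSpace.unbounded_univ ℝ ℂ hΩ.isBounded
  have hcl : IsClosed Ωᶜ := hΩ.isOpen.isClosed_compl
  refine ⟨max (1 / ρ) (4 * Real.pi * (m * (1 + A))), fun z hz => ?_⟩
  have hd : 0 < infDist z Ωᶜ := (hcl.notMem_iff_infDist_pos hne).1 (by simpa using hz)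
  have hball : ball z (infDist z Ωᶜ) ⊆ Ω := by
    have := disjoint_ball_infDist (x := z) (s := Ωᶜ)
    rw [disjoint_compl_right_iff_subset] at this
    exact this
  have hsp := norm_deriv_le_of_mapsTo_unitBall hd (h.differentiableOn.mono hball)
    (h.bijOn.mapsTo.mono_left hball)
  obtain ⟨p, hp, hpd⟩ := hcl.exists_infDist_eq_dist hne z
  set d := infDist z Ωᶜ with hddef
  rcases le_or_gt ρ d with hcase | hcase
  · refine le_trans (hsp.trans ?_) (le_max_left _ _)
    have : 1 - ‖G z‖ ^ 2 ≤ 1 := by nlinarith [norm_nonneg (G z)]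
    gcongr
  · refine le_trans hsp (le_trans ?_ (le_max_right _ _))
    have hpf : p ∈ frontier Ω := by
      rw [hΩ.isOpen.frontier_eq]
      refine ⟨closure_mono hball ?_, hp⟩
      rw [closure_ball z hd.ne', mem_closedBall, dist_comm, hpd]
    obtain ⟨ν, hν, hflν⟩ := hflat p hpf
    have hωn : ‖starRingEnd ℂ ν * (z - p)‖ = d := by
      rw [norm_conj_mul_sub hν, hpd, dist_eq_norm]
    have heq := add_mul_conj_mul_sub hν z p
    have h1 := hle p hpf ν hν hflν (starRingEnd ℂ ν * (z - p)) (by rw [hωn]; exact hcase)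
      (by rw [heq]; exact hz)
    rw [heq, hωn] at h1
    have h2 := h.one_sub_norm_le hU hz h1.1
    have h3 : d ^ (1 + (α : ℝ)) ≤ d := by
      rw [Real.rpow_add hd, Real.rpow_one]
      have : d ^ (α : ℝ) ≤ 1 := Real.rpow_le_one hd.le (by linarith) hα₀'.le
      nlinarith
    have h4 : (starRingEnd ℂ ν * (z - p)).re ≤ d := (Complex.re_le_norm _).trans hωn.le
    have h5 : U z ≤ m * ((1 + A) * d) := by
      refine h1.2.trans (mul_le_mul_of_nonneg_left ?_ hm)
      nlinarith
    rw [div_le_iff₀ hd]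
    have h6 := h.norm_lt_one hz
    have h7 : 2 * Real.pi * U z ≤ 2 * Real.pi * (m * ((1 + A) * d)) := by
      have := Real.pi_pos
      gcongr
    nlinarith [norm_nonneg (G z)]

/-- A Riemann map that is continuous up to the boundary and Lipschitz near the boundary. -/
structure IsRegularRiemannMap (Ω : Set ℂ) (c : ℂ) (G : ℂ → ℂ) : Prop extends
    IsRiemannMap Ω c G where
  continuousOn : ContinuousOn G (closure Ω)
  norm_eq_one : ∀ p ∈ frontier Ω, ‖G p‖ = 1
  exists_lipschitz : ∀ p ∈ frontier Ω, ∃ ρ > 0, ∃ K : ℝ, 0 ≤ K ∧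
    ∀ z₁ ∈ closure Ω ∩ ball p ρ, ∀ z₂ ∈ closure Ω ∩ ball p ρ, ‖G z₁ - G z₂‖ ≤ K * ‖z₁ - z₂‖

theorem IsRiemannMap.congr {Ω : Set ℂ} {c : ℂ} {G G' : ℂ → ℂ} (h : IsRiemannMap Ω c G)
    (hG : EqOn G' G Ω) : IsRiemannMap Ω c G' :=
  ⟨h.isOpen, h.isBounded, h.mem, h.differentiableOn.congr hG, h.bijOn.congr hG.symm, by
    rw [hG h.mem, h.eq_zero]⟩

theorem tendsto_nhdsWithin_of_continuousOn_closure {Ω : Set ℂ} {G : ℂ → ℂ}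
    (h : ContinuousOn G (closure Ω)) {p : ℂ} (hp : p ∈ closure Ω) :
    Tendsto G (𝓝[Ω] p) (𝓝 (G p)) :=
  (h p hp).tendsto.mono_left (nhdsWithin_mono _ subset_closure)

/-- Lipschitz bounds pass to the closure. -/
theorem norm_sub_le_of_continuousOn_closure {Ω : Set ℂ} {G : ℂ → ℂ}
    (h : ContinuousOn G (closure Ω)) {p : ℂ} {ρ K : ℝ}
    (hL : ∀ z₁ ∈ Ω ∩ ball p ρ, ∀ z₂ ∈ Ω ∩ ball p ρ, ‖G z₁ - G z₂‖ ≤ K * ‖z₁ - z₂‖) :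
    ∀ z₁ ∈ closure Ω ∩ ball p ρ, ∀ z₂ ∈ closure Ω ∩ ball p ρ,
      ‖G z₁ - G z₂‖ ≤ K * ‖z₁ - z₂‖ := by
  have step : ∀ z₁ ∈ closure Ω ∩ ball p ρ, ∀ z₂ ∈ Ω ∩ ball p ρ,
      ‖G z₁ - G z₂‖ ≤ K * ‖z₁ - z₂‖ := by
    rintro z₁ ⟨h1, h1b⟩ z₂ h2
    have : (𝓝[Ω] z₁).NeBot := mem_closure_iff_nhdsWithin_neBot.1 h1
    have t1 := ((tendsto_nhdsWithin_of_continuousOn_closure h h1).sub_const (G z₂)).norm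
    have t2 : Tendsto (fun z => K * ‖z - z₂‖) (𝓝[Ω] z₁) (𝓝 (K * ‖z₁ - z₂‖)) :=
      (Continuous.tendsto (by fun_prop) z₁).mono_left nhdsWithin_le_nhds
    refine le_of_tendsto_of_tendsto t1 t2 ?_
    filter_upwards [self_mem_nhdsWithin, mem_nhdsWithin_of_mem_nhds (isOpen_ball.mem_nhds h1b)]
      with z hz hzb using hL z ⟨hz, hzb⟩ z₂ h2
  rintro z₁ h1 z₂ ⟨h2, h2b⟩
  have : (𝓝[Ω] z₂).NeBot := mem_closure_iff_nhdsWithin_neBot.1 h2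
  have t1 := ((tendsto_nhdsWithin_of_continuousOn_closure h h2).const_sub (G z₁)).norm
  have t2 : Tendsto (fun z => K * ‖z₁ - z‖) (𝓝[Ω] z₂) (𝓝 (K * ‖z₁ - z₂‖)) :=
    (Continuous.tendsto (by fun_prop) z₂).mono_left nhdsWithin_le_nhds
  refine le_of_tendsto_of_tendsto t1 t2 ?_
  filter_upwards [self_mem_nhdsWithin, mem_nhdsWithin_of_mem_nhds (isOpen_ball.mem_nhds h2b)]
    with z hz hzb using step z₁ h1 z ⟨hz, hzb⟩

/-- A bounded derivative and the short paths in boundary charts make `G₀` Lipschitz near each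
boundary point, so it extends continuously; the boundary values are unimodular, and dividing by the
value at `b` normalizes them. -/
theorem exists_isRegularRiemannMap {α : ℝ≥0} (hα₀ : 0 < α) (hα₁ : α < 1) {Ω : Set ℂ}
    (hΩ : IsC1HolderDomain α Ω) {c b : ℂ} (hc : c ∈ Ω) (hb : b ∈ frontier Ω) {U : ℂ → ℝ}
    (hU : IsGreenFunction Ω c U) : ∃ G, IsRegularRiemannMap Ω c G ∧ G b = 1 := by
  obtain ⟨G₀, hG₀d, hG₀b, hG₀c⟩ := exists_riemann_map hΩ.isOpen hΩ.isSimplyConnected hΩ.isBounded hc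
  have h₀ : IsRiemannMap Ω c G₀ := ⟨hΩ.isOpen, hΩ.isBounded, hc, hG₀d, hG₀b, hG₀c⟩
  obtain ⟨M, hM⟩ := h₀.exists_norm_deriv_le hα₀ hα₁ hΩ hU
  have hM0 : 0 ≤ M := (norm_nonneg _).trans (hM c hc)
  have hL : ∀ p ∈ frontier Ω, ∃ ρ > 0, ∃ K : ℝ, 0 ≤ K ∧
      ∀ z₁ ∈ Ω ∩ ball p ρ, ∀ z₂ ∈ Ω ∩ ball p ρ, ‖G₀ z₁ - G₀ z₂‖ ≤ K * ‖z₁ - z₂‖ := by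
    intro p hp
    obtain ⟨e, g, C, r, hch⟩ := hΩ.boundary.exists_chart hp
    obtain ⟨ρ, hρ, K, hK, H⟩ := hch.exists_lipschitz hΩ.isOpen
    exact ⟨ρ, hρ, M * K, by positivity, H G₀ M hG₀d hM⟩
  set G₁ := extendFrom Ω G₀ with hG₁
  have hcont : ContinuousOn G₁ (closure Ω) := by
    refine continuousOn_extendFrom subset_rfl fun p hp => ?_
    by_cases hpΩ : p ∈ Ω
    · exact ⟨G₀ p, (h₀.hasDerivAt hpΩ).continuousAt.tendsto.mono_left nhdsWithin_le_nhds⟩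
    · obtain ⟨ρ, hρ, K, hK, H⟩ := hL p (by rw [hΩ.isOpen.frontier_eq]; exact ⟨hp, hpΩ⟩)
      have hlip : LipschitzOnWith K.toNNReal G₀ (Ω ∩ ball p ρ) := by
        refine LipschitzOnWith.of_dist_le_mul fun x hx y hy => ?_
        rw [dist_eq_norm, dist_eq_norm, Real.coe_toNNReal K hK]
        exact H x hx y hy
      obtain ⟨g, hg, hgG⟩ := hlip.extend_finite_dimension
      refine ⟨g p, (hg.continuous.tendsto p).mono_left nhdsWithin_le_nhds |>.congr' ?_⟩
      filter_upwards [self_mem_nhdsWithin, mem_nhdsWithin_of_mem_nhds (ball_mem_nhds p hρ)]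
        with z hz hzb using (hgG ⟨hz, hzb⟩).symm
  have heq : EqOn G₁ G₀ Ω := by
    intro z hz
    have hnb : (𝓝[Ω] z).NeBot := mem_closure_iff_nhdsWithin_neBot.1 (subset_closure hz)
    have ht := (h₀.hasDerivAt hz).continuousAt.tendsto.mono_left (nhdsWithin_le_nhds (s := Ω))
    exact extendFrom_eq (subset_closure hz) ht
  have h₁ : IsRiemannMap Ω c G₁ := h₀.congr heq
  have hn : ∀ p ∈ frontier Ω, ‖G₁ p‖ = 1 := by
    intro p hp
    have hpc := frontier_subset_closure hp
    have : (𝓝[Ω] p).NeBot := mem_closure_iff_nhdsWithin_neBot.1 hpc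
    exact tendsto_nhds_unique (tendsto_nhdsWithin_of_continuousOn_closure hcont hpc).norm
      (h₁.tendsto_norm hp)
  set k := G₁ b with hk
  have hkn : ‖k‖ = 1 := hn b hb
  have hk0 : k ≠ 0 := norm_ne_zero_iff.1 (by rw [hkn]; exact one_ne_zero)
  refine ⟨fun z => G₁ z / k, ⟨⟨hΩ.isOpen, hΩ.isBounded, hc, h₁.differentiableOn.div_const k,
    ⟨?_, ?_, ?_⟩, by simp [h₁.eq_zero]⟩, hcont.div_const k, fun p hp => by
      rw [norm_div, hkn, hn p hp, div_one], fun p hp => ?_⟩, by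
      simp only [← hk]; exact div_self hk0⟩
  · intro z hz
    simp only [mem_ball_zero_iff, norm_div, hkn, div_one]
    exact h₁.norm_lt_one hz
  · intro z hz z' hz' h
    exact h₁.bijOn.injOn hz hz' ((div_left_inj' hk0).1 h)
  · intro w hw
    rw [mem_ball_zero_iff] at hw
    obtain ⟨z, hz, hzw⟩ := h₁.bijOn.surjOn (show w * k ∈ ball (0 : ℂ) 1 by
      rw [mem_ball_zero_iff, norm_mul, hkn, mul_one]; exact hw)
    exact ⟨z, hz, by simp only [hzw]; field_simp⟩
  · obtain ⟨ρ, hρ, K, hK, H⟩ := hL p hp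
    refine ⟨ρ, hρ, K, hK, fun z₁ h1 z₂ h2 => ?_⟩
    have := norm_sub_le_of_continuousOn_closure hcont (p := p) (ρ := ρ) (K := K)
      (fun z₁ h1 z₂ h2 => by rw [heq h1.1, heq h2.1]; exact H z₁ h1 z₂ h2) z₁ h1 z₂ h2
    simp only [← sub_div, norm_div, hkn, div_one]
    exact this

/-! ### Inward normals, and blow-up of the Riemann map at a boundary point. -/

/-- The interior normal of a flat boundary point in terms of the boundary parametrization. -/
theorem IsCounterclockwiseArclengthParam.normal_eq {Ω : Set ℂ} (hΩ : IsOpen Ω) {b : ℂ} {L : ℝ}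
    {γ : ℝ → ℂ} (hγ : IsCounterclockwiseArclengthParam Ω b L γ) {q C r : ℝ} (hq : 1 < q)
    (hC : 0 ≤ C) (hr : 0 < r) {s : ℝ} {ν : ℂ} (hν : ‖ν‖ = 1)
    (hflat : IsFlatAt Ω q C r (γ s) ν) : I * deriv γ s = ν := by
  have hd : HasDerivAt γ (deriv γ s) s :=
    (hγ.contDiff.differentiable one_ne_zero s).hasDerivAt
  have hfr : ∀ t, γ t ∈ frontier Ω := by
    intro t
    rw [← hγ.image_eq]
    obtain ⟨t', ht', h⟩ := hγ.periodic.exists_mem_Ico₀ hγ.length_pos t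
    exact ⟨t', ht', h.symm⟩
  have hlip : ∀ t, ‖γ (s + t) - γ s‖ ≤ |t| := by
    intro t
    have := convex_univ.norm_image_sub_le_of_norm_deriv_le (𝕜 := ℝ) (f := γ) (C := 1)
      (fun y _ => hγ.contDiff.differentiable one_ne_zero y) (fun y _ => (hγ.norm_deriv y).le)
      (mem_univ s) (mem_univ (s + t))
    simpa using this
  set v := starRingEnd ℂ ν * deriv γ s with hv
  have hvn : ‖v‖ = 1 := by rw [hv, norm_mul, RCLike.norm_conj, hν, hγ.norm_deriv, one_mul]
  set w : ℝ → ℂ := fun t => starRingEnd ℂ ν * (γ (s + t) - γ s) with hw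
  have hwn : ∀ t, ‖w t‖ ≤ |t| := fun t => by
    rw [hw]; simp only; rw [norm_conj_mul_sub hν]; exact hlip t
  have hq0 : 0 < q := by linarith
  have hsmall : Tendsto (fun t : ℝ => C * |t| ^ (q - 1)) (𝓝 0) (𝓝 0) := by
    have h1 : ContinuousAt (fun t : ℝ => C * |t| ^ (q - 1)) 0 :=
      continuousAt_const.mul
        (ContinuousAt.rpow_const continuous_abs.continuousAt (Or.inr (by linarith)))
    have h2 := h1.tendsto
    simpa only [abs_zero, Real.zero_rpow (by linarith : q - 1 ≠ 0), mul_zero] using h2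
  have hpow : ∀ t : ℝ, |t| ^ q = |t| ^ (q - 1) * |t| := by
    intro t
    rcases eq_or_ne t 0 with rfl | h0
    · simp [Real.zero_rpow hq0.ne']
    · rw [← Real.rpow_add_one (abs_pos.2 h0).ne']; ring_nf
  -- The curve stays on the boundary, so its normal displacement is `O(|t|^q)` with `q > 1`; hence
  -- `γ' s` is orthogonal to `ν`, and only its sign remains.
  have hre_bound : ∀ t : ℝ, |t| < r → |(w t).re| ≤ C * |t| ^ (q - 1) * |t| := by
    intro t ht
    have hle : C * ‖w t‖ ^ q ≤ C * |t| ^ (q - 1) * |t| := by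
      rw [mul_assoc, ← hpow]
      exact mul_le_mul_of_nonneg_left (Real.rpow_le_rpow (norm_nonneg _) (hwn t) hq0.le) hC
    have hmem := hfr (s + t)
    rw [hΩ.frontier_eq] at hmem
    have heq : γ s + ν * w t = γ (s + t) := add_mul_conj_mul_sub hν _ _
    have hwr : ‖w t‖ < r := (hwn t).trans_lt ht
    rw [abs_le]
    constructor
    · refine le_trans (neg_le_neg hle) ?_
      have hcl : IsClosed {z : ℂ | -(C * ‖starRingEnd ℂ ν * (z - γ s)‖ ^ q) ≤
          (starRingEnd ℂ ν * (z - γ s)).re} := by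
        refine isClosed_le ?_ (by fun_prop)
        refine (continuous_const.mul (Continuous.rpow_const (by fun_prop) ?_)).neg
        intro _; right; linarith
      have hmem2 : γ (s + t) ∈ closure (Ω ∩ ball (γ s) r) := by
        rw [mem_closure_iff_nhds]
        intro u hu
        have hb : γ (s + t) ∈ ball (γ s) r := by
          rw [mem_ball, dist_eq_norm]; exact (hlip t).trans_lt ht
        obtain ⟨y, hy, hyΩ⟩ := (mem_closure_iff_nhds.1 hmem.1) (u ∩ ball (γ s) r)
          (inter_mem hu (isOpen_ball.mem_nhds hb))
        exact ⟨y, hy.1, hyΩ, hy.2⟩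
      refine closure_minimal (fun y hy => ?_) hcl hmem2
      have hyb := hy.2
      rw [mem_ball, dist_eq_norm] at hyb
      refine (hflat _ (by rw [norm_conj_mul_sub hν]; exact hyb)).2 ?_
      rw [add_mul_conj_mul_sub hν]; exact hy.1
    · refine le_trans ?_ hle
      by_contra hcon
      have := (hflat (w t) hwr).1 (not_le.1 hcon)
      rw [heq] at this
      exact hmem.2 this
  have hslope : Tendsto (fun t : ℝ => t⁻¹ * (w t).re) (𝓝[≠] 0) (𝓝 v.re) := by
    have h1 := (hasDerivAt_iff_tendsto_slope_zero.1 hd).const_mul (starRingEnd ℂ ν)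
    have h2 := (Complex.continuous_re.tendsto _).comp h1
    refine h2.congr fun t => ?_
    simp only [Function.comp_apply, hw, Complex.real_smul]
    have : starRingEnd ℂ ν * (((t⁻¹ : ℝ) : ℂ) * (γ (s + t) - γ s)) =
      ((t⁻¹ : ℝ) : ℂ) * (starRingEnd ℂ ν * (γ (s + t) - γ s)) := by ring
    rw [this, Complex.re_ofReal_mul]
  have hslope0 : Tendsto (fun t : ℝ => t⁻¹ * (w t).re) (𝓝[≠] 0) (𝓝 0) := by
    refine squeeze_zero_norm' ?_ (hsmall.mono_left nhdsWithin_le_nhds)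
    filter_upwards [self_mem_nhdsWithin, mem_nhdsWithin_of_mem_nhds (ball_mem_nhds (0 : ℝ) hr)]
      with t ht htr
    have ht0 : 0 < |t| := abs_pos.2 ht
    rw [norm_mul, norm_inv, Real.norm_eq_abs, Real.norm_eq_abs, inv_mul_le_iff₀ ht0]
    rw [mem_ball_zero_iff, Real.norm_eq_abs] at htr
    linarith [hre_bound t htr]
  have hvre : v.re = 0 := tendsto_nhds_unique hslope hslope0
  have hvim : v.im ^ 2 = 1 := by
    have h1 : ‖v‖ ^ 2 = 1 := by rw [hvn]; norm_num
    rw [Complex.sq_norm, Complex.normSq_apply, hvre] at h1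
    linarith
  have hgv : deriv γ s = ν * v := by
    have := conj_mul_self_of_norm_eq_one hν
    rw [hv]; linear_combination (-deriv γ s) * this
  rcases mul_self_eq_one_iff.1 ((sq v.im).symm.trans hvim) with h1 | h1
  -- Here `I * deriv γ s = -ν`, and short segments in the direction `-ν` would lie in the domain,
  -- contrary to flatness.
  · exfalso
    have hvI : v = I := Complex.ext (by simp [hvre]) (by simp [h1])
    obtain ⟨ε, hε, hin⟩ := hγ.interior_left s
    have hev : ∀ᶠ t : ℝ in 𝓝[>] 0, C * |t| ^ (q - 1) < 1 :=
      (hsmall.mono_left nhdsWithin_le_nhds).eventually_lt_const one_pos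
    obtain ⟨t, ⟨ht1, ht2⟩, ht3⟩ := ((hev.and (Ioo_mem_nhdsGT hε)).and (Ioo_mem_nhdsGT hr)).exists
    have h2 := hin t ht2
    have e1 : γ s + t * (I * deriv γ s) = γ s + ν * (-(t : ℂ)) := by
      rw [hgv, hvI]; linear_combination (t * ν) * I_mul_I
    have ht0 : 0 < t := ht2.1
    have hn : ‖(-(t : ℂ))‖ = |t| := by rw [norm_neg, Complex.norm_real, Real.norm_eq_abs]
    rw [e1] at h2
    have h3 := (hflat (-(t : ℂ)) (by rw [hn, abs_of_pos ht0]; exact ht3.2)).2 h2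
    rw [hn, hpow, neg_re, Complex.ofReal_re, abs_of_pos ht0] at h3
    rw [abs_of_pos ht0] at ht1
    nlinarith
  · have hvI : v = -I := Complex.ext (by simp [hvre]) (by simp [h1])
    rw [hgv, hvI]; linear_combination (-ν) * I_mul_I

/-- A holomorphic function on the right half-plane whose real part is between `0` and a multiple
of `Re ω` and is linear on the positive axis is affine. -/
theorem eq_mul_add_of_re_le {k : ℂ → ℂ} (hk : DifferentiableOn ℂ k {ω | 0 < ω.re}) {C c : ℝ}
    (h0 : ∀ ω : ℂ, 0 < ω.re → 0 ≤ (k ω).re) (hC : ∀ ω : ℂ, 0 < ω.re → (k ω).re ≤ C * ω.re)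
    (hc : ∀ x : ℝ, 0 < x → (k x).re = c * x) :
    ∃ b : ℂ, ∀ ω : ℂ, 0 < ω.re → k ω = c * ω + b := by
  set D := |C| + |c| with hD
  have hD0 : 0 ≤ D := by positivity
  have hdiff : ∀ ω : ℂ, 0 < ω.re → |(k ω - c * ω).re| ≤ D * ω.re := by
    intro ω hω
    have e1 : (k ω - c * ω).re = (k ω).re - c * ω.re := by
      rw [sub_re, Complex.re_ofReal_mul]
    rw [e1]
    refine (abs_sub _ _).trans ?_
    rw [abs_of_nonneg (h0 ω hω), abs_mul, abs_of_pos hω, hD, add_mul]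
    have : C * ω.re ≤ |C| * ω.re := by gcongr; exact le_abs_self C
    linarith [hC ω hω]
  have key : ∀ σ : ℝ, |σ| = 1 → ∀ ω : ℂ, 0 < ω.re → σ * (k ω - c * ω).re ≤ 0 := by
    intro σ hσ ω hω
    -- `E` has exponential type and modulus `1` on the positive axis; Phragmén–Lindelöf for both
    -- signs `σ` forces `Re (k ω - c ω) = 0`.
    set E : ℂ → ℂ := fun ω => Complex.exp (σ * (k ω - c * ω)) with hE
    have hEn : ∀ ω, ‖E ω‖ = Real.exp (σ * (k ω - c * ω).re) := by
      intro ω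
      rw [hE]; simp only
      rw [Complex.norm_exp, Complex.re_ofReal_mul]
    have hEle : ∀ ω : ℂ, 0 < ω.re → ‖E ω‖ ≤ Real.exp (D * ω.re) := by
      intro ω hω
      rw [hEn]
      refine Real.exp_le_exp.2 ((le_abs_self _).trans ?_)
      rw [abs_mul, hσ, one_mul]
      exact hdiff ω hω
    have hEd : DifferentiableOn ℂ E {ω | 0 < ω.re} :=
      ((hk.sub ((differentiableOn_id).const_mul (c : ℂ))).const_mul (σ : ℂ)).cexp
    -- Nothing is known about `k` on the imaginary axis, so the half-plane is shifted to `Re > ε`,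
    -- where the edge bound is `exp (D ε)`; then `ε → 0`.
    have hbound : ∀ ε : ℝ, 0 < ε → ∀ z : ℂ, 0 ≤ z.re → ‖E (z + ε)‖ ≤ Real.exp (D * ε) := by
      intro ε hε z hz
      have hmaps : ∀ z : ℂ, 0 ≤ z.re → 0 < (z + ε).re := by
        intro z hz
        rw [add_re, Complex.ofReal_re]; linarith
      refine PhragmenLindelof.right_half_plane_of_bounded_on_real (f := fun z => E (z + ε))
        ?_ ⟨1, by norm_num, D, ?_⟩ ?_ ?_ hz
      · refine DifferentiableOn.diffContOnCl ?_
        refine hEd.comp (by fun_prop) fun z hz => ?_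
        refine hmaps z ?_
        have hcl : IsClosed {z : ℂ | 0 ≤ z.re} := isClosed_le continuous_const continuous_re
        have hsub : {z : ℂ | 0 < z.re} ⊆ {z : ℂ | 0 ≤ z.re} := fun y hy => by
          have h5 : 0 < y.re := hy
          exact h5.le
        exact closure_minimal hsub hcl hz
      · refine Asymptotics.IsBigO.of_bound (Real.exp (D * ε)) ?_
        refine eventually_inf_principal.2 (Eventually.of_forall fun z hz => ?_)
        have hz' : 0 < z.re := hz
        refine (hEle _ (hmaps z hz'.le)).trans ?_
        rw [Real.rpow_one, Real.norm_of_nonneg (Real.exp_pos _).le, ← Real.exp_add, add_re,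
          Complex.ofReal_re]
        refine Real.exp_le_exp.2 ?_
        have := mul_le_mul_of_nonneg_left (Complex.re_le_norm z) hD0
        linarith
      · refine isBoundedUnder_of_eventually_le (a := 1) ?_
        filter_upwards [eventually_ge_atTop 0] with x hx
        have : ((x : ℂ) + ε) = ((x + ε : ℝ) : ℂ) := by push_cast; ring
        rw [this, hEn, sub_re, hc _ (by linarith), Complex.re_ofReal_mul, Complex.ofReal_re, sub_self,
          mul_zero, Real.exp_zero]
      · intro x
        have h1 : ((x : ℂ) * I + ε).re = ε := by simp
        have := hEle ((x : ℂ) * I + ε) (by rw [h1]; exact hε)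
        rwa [h1] at this
    have hle : ‖E ω‖ ≤ 1 := by
      have ht : Tendsto (fun ε : ℝ => Real.exp (D * ε)) (𝓝[>] 0) (𝓝 1) := by
        have : Continuous fun ε : ℝ => Real.exp (D * ε) := by fun_prop
        have h2 := this.tendsto 0
        simp only [mul_zero, Real.exp_zero] at h2
        exact h2.mono_left nhdsWithin_le_nhds
      refine ge_of_tendsto ht ?_
      filter_upwards [Ioo_mem_nhdsGT hω] with ε hε
      have := hbound ε hε.1 (ω - ε) (by rw [sub_re, Complex.ofReal_re]; linarith [hε.2])
      rwa [sub_add_cancel] at this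
    rw [hEn, Real.exp_le_one_iff] at hle
    exact hle
  have hre : ∀ ω ∈ {ω : ℂ | 0 < ω.re}, (k ω - c * ω).re = 0 := by
    intro ω hω
    have h1 := key 1 (by simp) ω hω
    have h2 := key (-1) (by simp) ω hω
    linarith
  have hopen : IsOpen {ω : ℂ | 0 < ω.re} := isOpen_lt continuous_const continuous_re
  have hconn : IsConnected {ω : ℂ | 0 < ω.re} :=
    ⟨⟨1, by simp⟩, (convex_halfSpace_re_gt 0).isPreconnected⟩
  obtain ⟨b, hb⟩ := AnalyticOnNhd.eq_const_of_re_eq_const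
    ((hk.sub ((differentiableOn_id).const_mul (c : ℂ))).analyticOnNhd hopen) hre hopen hconn
  refine ⟨b, fun ω hω => ?_⟩
  have h3 : k ω - c * ω = b := hb ω hω
  rw [← h3]; ring

/-- Dilations of a point of the half-plane enter a domain that is flat at `p`. -/
theorem IsFlatAt.eventually_mem {Ω : Set ℂ} {q C r : ℝ} (hq1 : 1 < q) (hC : 0 ≤ C) (hr : 0 < r)
    {p ν : ℂ} (hν : ‖ν‖ = 1) (hflat : IsFlatAt Ω q C r p ν) {ω₀ : ℂ} (hω₀ : 0 < ω₀.re) {ρ : ℝ}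
    (hρ : 0 < ρ) : ∃ N ∈ 𝓝 ω₀, ∀ᶠ t : ℝ in 𝓝[>] 0, ∀ ω ∈ N, p + ν * (t * ω) ∈ Ω ∩ ball p ρ := by
  set R := ‖ω₀‖ + ω₀.re / 2 with hR
  have hR0 : 0 < R := by positivity
  refine ⟨ball ω₀ (ω₀.re / 2), ball_mem_nhds _ (by positivity), ?_⟩
  have hlim : Tendsto (fun t : ℝ => C * R ^ q * t ^ (q - 1)) (𝓝[>] 0) (𝓝 0) := by
    have h1 : ContinuousAt (fun t : ℝ => C * R ^ q * t ^ (q - 1)) 0 :=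
      continuousAt_const.mul (Real.continuousAt_rpow_const _ _ (Or.inr (by linarith)))
    have h2 := h1.tendsto
    simp only [Real.zero_rpow (by linarith : q - 1 ≠ 0), mul_zero] at h2
    exact h2.mono_left nhdsWithin_le_nhds
  have hm : 0 < min r ρ / R := by positivity
  filter_upwards [hlim.eventually_lt_const (half_pos hω₀), Ioo_mem_nhdsGT hm] with t ht htI ω hω
  have ht0 : 0 < t := htI.1
  rw [mem_ball, dist_eq_norm] at hω
  have hωR : ‖ω‖ < R := by
    have : ω = ω₀ + (ω - ω₀) := by ring
    rw [this]
    exact (norm_add_le _ _).trans_lt (by linarith)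
  have hωre : ω₀.re / 2 < ω.re := by
    have h1 := Complex.abs_re_le_norm (ω - ω₀)
    rw [sub_re] at h1
    linarith [neg_abs_le (ω.re - ω₀.re)]
  have hn : ‖(t : ℂ) * ω‖ = t * ‖ω‖ := by rw [norm_mul, Complex.norm_of_nonneg ht0.le]
  have hsmall : t * ‖ω‖ < min r ρ := by
    have := htI.2
    rw [lt_div_iff₀ hR0] at this
    exact lt_of_le_of_lt (by gcongr) this
  refine ⟨(hflat _ (by rw [hn]; exact hsmall.trans_le (min_le_left _ _))).1 ?_, ?_⟩
  · rw [hn, Complex.re_ofReal_mul, Real.mul_rpow ht0.le (norm_nonneg _)]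
    have htq : t ^ q = t ^ (q - 1) * t := by
      rw [← Real.rpow_add_one ht0.ne']; ring_nf
    have h1 : ‖ω‖ ^ q ≤ R ^ q := Real.rpow_le_rpow (norm_nonneg _) hωR.le (by linarith)
    rw [htq]
    have h2 : 0 ≤ t ^ (q - 1) := Real.rpow_nonneg ht0.le _
    calc C * (t ^ (q - 1) * t * ‖ω‖ ^ q) ≤ C * (t ^ (q - 1) * t * R ^ q) := by gcongr
      _ = (C * R ^ q * t ^ (q - 1)) * t := by ring
      _ < t * ω.re := by rw [mul_comm]; gcongr; linarith
  · rw [mem_ball, dist_eq_norm, add_sub_cancel_left, norm_mul, hν, one_mul, hn]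
    exact hsmall.trans_le (min_le_right _ _)

namespace IsRegularRiemannMap

variable {Ω : Set ℂ} {c : ℂ} {G : ℂ → ℂ} {U : ℂ → ℝ} {q C r : ℝ} {p ν : ℂ} {d : ℝ}

/-- The dilations of `G` at a flat boundary point. -/
noncomputable def dilate (G : ℂ → ℂ) (p ν : ℂ) (t : ℝ) (ω : ℂ) : ℂ :=
  (G (p + ν * (t * ω)) - G p) / t

/-- A Lipschitz constant of `G` near `p` is inherited by all dilations. This is the compactness of
the blow-up, and the bound `K * ‖y‖` later fixes the additive constant of the limit. -/
theorem eventually_dilate (h : IsRegularRiemannMap Ω c G) (hq1 : 1 < q) (hC : 0 ≤ C) (hr : 0 < r)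
    (hp : p ∈ frontier Ω) (hν : ‖ν‖ = 1) (hflat : IsFlatAt Ω q C r p ν) :
    ∃ K : ℝ, 0 ≤ K ∧ ∀ ω₀ : ℂ, 0 < ω₀.re → ∃ N ∈ 𝓝 ω₀, ∀ᶠ t : ℝ in 𝓝[>] 0,
      DifferentiableOn ℂ (dilate G p ν t) N ∧
      (∀ y ∈ N, ∀ y' ∈ N, ‖dilate G p ν t y - dilate G p ν t y'‖ ≤ K * ‖y - y'‖) ∧
      ∀ y ∈ N, ‖dilate G p ν t y‖ ≤ K * ‖y‖ := by
  obtain ⟨ρ, hρ, K, hK, hL⟩ := h.exists_lipschitz p hp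
  refine ⟨K, hK, fun ω₀ hω₀ => ?_⟩
  obtain ⟨N, hN, hev⟩ := hflat.eventually_mem hq1 hC hr hν hω₀ hρ
  refine ⟨N, hN, ?_⟩
  filter_upwards [hev, self_mem_nhdsWithin] with t ht ht0
  have ht0' : (0 : ℝ) < t := ht0
  have hcl : ∀ y ∈ N, p + ν * (t * y) ∈ closure Ω ∩ ball p ρ := fun y hy =>
    ⟨subset_closure (ht y hy).1, (ht y hy).2⟩
  refine ⟨fun y hy => ?_, fun y hy y' hy' => ?_, fun y hy => ?_⟩
  · have h1 : DifferentiableAt ℂ G (p + ν * (t * y)) := (h.hasDerivAt (ht y hy).1).differentiableAt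
    have h2 : DifferentiableAt ℂ (fun y => G (p + ν * (t * y))) y :=
      DifferentiableAt.comp (g := G) y h1 (by fun_prop)
    exact ((h2.sub_const (G p)).div_const (t : ℂ)).differentiableWithinAt
  · rw [dilate, dilate, ← sub_div, sub_sub_sub_cancel_right, norm_div,
      Complex.norm_of_nonneg ht0'.le, div_le_iff₀ ht0']
    refine (hL _ (hcl y hy) _ (hcl y' hy')).trans_eq ?_
    have : p + ν * (t * y) - (p + ν * (t * y')) = ν * (t * (y - y')) := by ring
    rw [this, norm_mul, norm_mul, hν, Complex.norm_of_nonneg ht0'.le]; ring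
  · rw [dilate, norm_div, Complex.norm_of_nonneg ht0'.le, div_le_iff₀ ht0']
    refine (hL _ (hcl y hy) _ ⟨frontier_subset_closure hp, mem_ball_self hρ⟩).trans_eq ?_
    rw [add_sub_cancel_left, norm_mul, norm_mul, hν, Complex.norm_of_nonneg ht0'.le]; ring

/-- The dilations of `G` at a boundary point converge to a linear function. -/
theorem tendsto_dilate (h : IsRegularRiemannMap Ω c G) (hU : IsGreenFunction Ω c U)
    (hq1 : 1 < q) (hq2 : q < 2) (hC : 0 ≤ C) (hr : 0 < r)
    (hp : p ∈ frontier Ω) (hν : ‖ν‖ = 1) (hflat : IsFlatAt Ω q C r p ν)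
    (hd : HasInteriorNormalDeriv U p ν d) {ω : ℂ} (hω : 0 < ω.re) :
    Tendsto (fun t => dilate G p ν t ω) (𝓝[>] 0) (𝓝 (-(2 * Real.pi * d) * G p * ω)) := by
  obtain ⟨K, hK, hdil⟩ := h.eventually_dilate hq1 hC hr hp hν hflat
  obtain ⟨m, A, ρ, hm, hA, hρ, hρ1, hle⟩ := hU.exists_le h.isOpen h.isBounded h.mem hq1 hq2 hC hr
  have hpΩ : p ∉ Ω := by
    have := hp; rw [h.isOpen.frontier_eq] at this; exact this.2
  have hGp := h.norm_eq_one p hp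
  have hGp2 := conj_mul_self_of_norm_eq_one hGp
  -- It suffices that every ultrafilter limit `g` is the same linear function.
  rw [tendsto_iff_ultrafilter]
  intro u hu
  obtain ⟨g, hg⟩ := u.exists_pointwise_limit (F := dilate G p ν) (V := {ω | 0 < ω.re})
    (fun x hx => by
      obtain ⟨N, hN, hev⟩ := hdil x hx
      exact ⟨K * ‖x‖, (hev.filter_mono hu).mono fun t ht => ht.2.2 x (mem_of_mem_nhds hN)⟩)
  have hlu : TendstoLocallyUniformlyOn (dilate G p ν) g u {ω | 0 < ω.re} := by
    refine tendstoLocallyUniformlyOn_of_lipschitz (fun x hx => ?_) hg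
    obtain ⟨N, hN, hev⟩ := hdil x hx
    exact ⟨N, hN, K, (hev.filter_mono hu).mono fun t ht => ht.2.1⟩
  have hopen : IsOpen {ω : ℂ | 0 < ω.re} := isOpen_lt continuous_const continuous_re
  have hgd : DifferentiableOn ℂ g {ω | 0 < ω.re} := by
    refine differentiableOn_of_tendstoLocallyUniformlyOn hopen hlu fun x hx => ?_
    obtain ⟨N, hN, hev⟩ := hdil x hx
    exact ⟨N, hN, (hev.filter_mono hu).mono fun t ht => ht.1⟩
  have hgK : ∀ x : ℂ, 0 < x.re → ‖g x‖ ≤ K * ‖x‖ := by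
    intro x hx
    obtain ⟨N, hN, hev⟩ := hdil x hx
    exact le_of_tendsto (hg x hx).norm
      ((hev.filter_mono hu).mono fun t ht => ht.2.2 x (mem_of_mem_nhds hN))
  have htid : Tendsto (fun t : ℝ => t) (𝓝[>] (0 : ℝ)) (𝓝 0) := nhdsWithin_le_nhds
  -- the modulus of `G` along the dilations
  have hmod : ∀ x : ℂ, 0 < x.re → Tendsto (fun t : ℝ => (‖G (p + ν * (t * x))‖ ^ 2 - 1) / t) u
      (𝓝 (2 * (starRingEnd ℂ (G p) * g x).re)) := by
    intro x hx
    have h1 : Tendsto (fun t : ℝ => 2 * (starRingEnd ℂ (G p) * dilate G p ν t x).re +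
        t * ‖dilate G p ν t x‖ ^ 2) u (𝓝 (2 * (starRingEnd ℂ (G p) * g x).re + 0 * ‖g x‖ ^ 2)) := by
      refine Tendsto.add ?_ ((htid.mono_left hu).mul ((hg x hx).norm.pow 2))
      exact ((Complex.continuous_re.tendsto _).comp ((hg x hx).const_mul _)).const_mul 2
    rw [zero_mul, add_zero] at h1
    refine h1.congr' ?_
    filter_upwards [hu self_mem_nhdsWithin] with t ht
    have ht0 : (0 : ℝ) < t := ht
    have hG : G (p + ν * (t * x)) = G p + t * dilate G p ν t x := by
      rw [dilate]
      have : (t : ℂ) ≠ 0 := by exact_mod_cast ht0.ne'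
      field_simp; ring
    have h2 : ‖G p‖ ^ 2 = 1 := by rw [hGp]; norm_num
    rw [hG, eq_div_iff ht0.ne']
    simp only [Complex.sq_norm, Complex.normSq_apply] at h2 ⊢
    simp
    linear_combination (-1 : ℝ) * h2
  set k : ℂ → ℂ := fun x => -(starRingEnd ℂ (G p) * g x) with hk
  have hkre : ∀ x, (k x).re = -(starRingEnd ℂ (G p) * g x).re := fun x => neg_re _
  -- `Re k ≥ 0` since `|G| < 1`; `Re k ≤ 2π m Re` by the linear growth of `U`; and on the positive
  -- axis `Re k = 2π d x`, because `exp (-4π U) = |G|²` along the normal.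
  obtain ⟨b, hb⟩ := eq_mul_add_of_re_le (k := k) (C := 2 * Real.pi * m) (c := 2 * Real.pi * d)
    ((hgd.const_mul _).neg) (fun x hx => by
      have h1 : 2 * (starRingEnd ℂ (G p) * g x).re ≤ 0 := by
        refine le_of_tendsto (hmod x hx) ?_
        obtain ⟨N, hN, hev⟩ := hflat.eventually_mem hq1 hC hr hν hx one_pos
        filter_upwards [hu hev, hu self_mem_nhdsWithin] with t ht ht0
        have ht0' : (0 : ℝ) < t := ht0
        have h2 := h.norm_lt_one (ht x (mem_of_mem_nhds hN)).1
        refine div_nonpos_of_nonpos_of_nonneg ?_ ht0'.le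
        nlinarith [norm_nonneg (G (p + ν * (t * x)))]
      rw [hkre]; linarith)
    (fun x hx => by
      have hlim : Tendsto (fun t : ℝ => -(4 * Real.pi * (m * (x.re + A * (t ^ (q - 1) * ‖x‖ ^ q)))))
          u (𝓝 (-(4 * Real.pi * (m * (x.re + A * (0 * ‖x‖ ^ q)))))) := by
        have h3 : Tendsto (fun t : ℝ => t ^ (q - 1)) (𝓝[>] 0) (𝓝 0) := by
          have h1 : ContinuousAt (fun t : ℝ => t ^ (q - 1)) 0 :=
            Real.continuousAt_rpow_const _ _ (Or.inr (by linarith))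
          have h2 := h1.tendsto
          simp only [Real.zero_rpow (by linarith : q - 1 ≠ 0)] at h2
          exact h2.mono_left nhdsWithin_le_nhds
        exact (((((h3.mono_left hu).mul_const _).const_mul A).const_add x.re).const_mul m
          |>.const_mul (4 * Real.pi)).neg
      have h1 : -(4 * Real.pi * (m * (x.re + A * (0 * ‖x‖ ^ q)))) ≤
          2 * (starRingEnd ℂ (G p) * g x).re := by
        refine le_of_tendsto_of_tendsto hlim (hmod x hx) ?_
        obtain ⟨N, hN, hev⟩ := hflat.eventually_mem hq1 hC hr hν hx hρ
        filter_upwards [hu hev, hu self_mem_nhdsWithin] with t ht ht0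
        have ht0' : (0 : ℝ) < t := ht0
        obtain ⟨hmem, hball⟩ := ht x (mem_of_mem_nhds hN)
        have hn : ‖(t : ℂ) * x‖ = t * ‖x‖ := by rw [norm_mul, Complex.norm_of_nonneg ht0'.le]
        rw [mem_ball, dist_eq_norm, add_sub_cancel_left, norm_mul, hν, one_mul] at hball
        obtain ⟨hne, hUle⟩ := hle p hp ν hν hflat _ hball hmem
        have h2 := h.one_sub_norm_le hU hmem hne
        have h3 := h.norm_lt_one hmem
        rw [hn, Complex.re_ofReal_mul, Real.mul_rpow ht0'.le (norm_nonneg _)] at hUle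
        have htq : t ^ q = t ^ (q - 1) * t := by
          rw [← Real.rpow_add_one ht0'.ne']; ring_nf
        rw [htq] at hUle
        rw [le_div_iff₀ ht0']
        have h4 : 2 * Real.pi * U (p + ν * (t * x)) ≤
            2 * Real.pi * (m * (t * x.re + A * (t ^ (q - 1) * t * ‖x‖ ^ q))) := by
          have := Real.pi_pos
          gcongr
        nlinarith [norm_nonneg (G (p + ν * (t * x)))]
      rw [hkre]
      rw [zero_mul, mul_zero, add_zero] at h1
      linarith)
    (fun x hx => by
      have hf : HasDerivWithinAt (fun t : ℝ => Real.exp (-(4 * Real.pi * U (p + t * ν))))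
          (-(4 * Real.pi * d)) (Ici 0) 0 := by
        have h1 := ((HasDerivWithinAt.const_mul (4 * Real.pi) hd).neg).exp
        refine h1.congr_deriv ?_
        simp [hU.eq_zero p hp]
      have hf2 : HasDerivWithinAt (fun t : ℝ => Real.exp (-(4 * Real.pi * U (p + (t * x : ℝ) * ν))))
          (-(4 * Real.pi * d) * x) (Ici 0) 0 := by
        have h2 : HasDerivWithinAt (fun t : ℝ => t * x) x (Ici 0) 0 := by
          simpa using ((hasDerivAt_id (0 : ℝ)).mul_const x).hasDerivWithinAt
        have hf' : HasDerivWithinAt (fun t : ℝ => Real.exp (-(4 * Real.pi * U (p + t * ν))))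
          (-(4 * Real.pi * d)) (Ici 0) (0 * x) := by rw [zero_mul]; exact hf
        exact hf'.comp 0 h2 fun t ht => mul_nonneg ht hx.le
      replace hf2 := (hasDerivWithinAt_iff_tendsto_slope' (by simp)).1
        (hf2.mono Ioi_subset_Ici_self)
      have h3 : Tendsto (fun t : ℝ => (‖G (p + ν * (t * x))‖ ^ 2 - 1) / t) u
          (𝓝 (-(4 * Real.pi * d) * x)) := by
        refine (hf2.mono_left hu).congr' ?_
        have hx' : 0 < (x : ℂ).re := hx
        obtain ⟨N, hN, hev⟩ := hflat.eventually_mem hq1 hC hr hν hx' hρ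
        filter_upwards [hu hev, hu self_mem_nhdsWithin] with t ht ht0
        have ht0' : (0 : ℝ) < t := ht0
        obtain ⟨hmem, hball⟩ := ht x (mem_of_mem_nhds hN)
        rw [mem_ball, dist_eq_norm, add_sub_cancel_left, norm_mul, hν, one_mul] at hball
        obtain ⟨hne, hUle⟩ := hle p hp ν hν hflat _ hball hmem
        have e1 : p + ((t * x : ℝ) : ℂ) * ν = p + ν * (t * x) := by push_cast; ring
        rw [slope_def_field, e1]
        have e2 : Real.exp (-(4 * Real.pi * U (p + ν * (t * x)))) = ‖G (p + ν * (t * x))‖ ^ 2 := by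
          rw [h.norm_eq_exp hU hmem hne, ← Real.exp_nat_mul]; congr 1; push_cast; ring
        rw [e2]
        simp [hU.eq_zero p hp]
      have h4 := tendsto_nhds_unique h3 (hmod x hx)
      rw [hkre]; linarith)
  have hgb : ∀ x : ℂ, 0 < x.re → g x = -(2 * Real.pi * d) * G p * x - G p * b := by
    intro x hx
    have h1 := hb x hx
    rw [hk] at h1
    push_cast at h1
    linear_combination (-G p) * h1 - g x * hGp2
  have hb0 : b = 0 := by
    have h1 : Tendsto (fun t : ℝ => ‖-(2 * Real.pi * d) * G p * (t : ℂ) - G p * b‖) (𝓝[>] 0)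
        (𝓝 ‖b‖) := by
      have : Continuous fun t : ℝ => ‖-(2 * Real.pi * d) * G p * (t : ℂ) - G p * b‖ := by fun_prop
      have h2 := this.tendsto 0
      simp only [ofReal_zero, mul_zero, zero_sub, norm_neg, norm_mul, hGp, one_mul] at h2
      simpa [hGp] using h2.mono_left nhdsWithin_le_nhds
    have h3 : Tendsto (fun t : ℝ => K * t) (𝓝[>] 0) (𝓝 0) := by
      simpa using htid.const_mul K
    have h4 : ‖b‖ ≤ 0 := by
      refine le_of_tendsto_of_tendsto h1 h3 ?_
      filter_upwards [self_mem_nhdsWithin] with t ht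
      have ht0 : (0 : ℝ) < t := ht
      rw [← hgb t ht0]
      refine (hgK t ht0).trans_eq ?_
      rw [Complex.norm_of_nonneg ht0.le]
    exact norm_le_zero_iff.1 h4
  have := hg ω hω
  rw [hgb ω hω, hb0, mul_zero, sub_zero] at this
  exact this

end IsRegularRiemannMap

/-! ### Tangential derivative and injectivity of the Riemann map on the boundary. -/

namespace IsRegularRiemannMap

variable {Ω : Set ℂ} {c : ℂ} {G : ℂ → ℂ} {U : ℂ → ℝ} {q C r : ℝ} {p ν : ℂ} {d : ℝ}

/-- The one-sided derivative of `G` along a curve tangent to the boundary. -/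
theorem hasDerivWithinAt_comp (h : IsRegularRiemannMap Ω c G) (hU : IsGreenFunction Ω c U)
    (hq1 : 1 < q) (hq2 : q < 2) (hC : 0 ≤ C) (hr : 0 < r)
    (hp : p ∈ frontier Ω) (hν : ‖ν‖ = 1) (hflat : IsFlatAt Ω q C r p ν)
    (hd : HasInteriorNormalDeriv U p ν d) {δ : ℝ → ℂ} {ω₀ : ℂ} (hω₀ : ω₀.re = 0)
    (hδ : ∀ t, δ t ∈ closure Ω) (hδ0 : δ 0 = p)
    (hδd : HasDerivWithinAt δ (ν * ω₀) (Ici 0) 0) :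
    HasDerivWithinAt (fun t => G (δ t)) (-(2 * Real.pi * d) * G p * ω₀) (Ici 0) 0 := by
  obtain ⟨ρ, hρ, K, hK, hL⟩ := h.exists_lipschitz p hp
  have hGp := h.norm_eq_one p hp
  have hslope := (hasDerivWithinAt_iff_tendsto_slope' (by simp)).1 (hδd.mono Ioi_subset_Ici_self)
  refine HasDerivWithinAt.Ici_of_Ioi ?_
  rw [hasDerivWithinAt_iff_tendsto_slope' (by simp), Metric.tendsto_nhds]
  intro ε hε
  set η := ε / (2 * (2 * K + 2 + 2 * Real.pi * |d|)) with hη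
  have hπ := Real.pi_pos
  have hη0 : 0 < η := by positivity
  have hηε : (2 * K + 1 + 2 * Real.pi * |d|) * η < ε := by
    have : η * (2 * (2 * K + 2 + 2 * Real.pi * |d|)) = ε := by rw [hη]; field_simp
    have h2 : 0 ≤ K * η := by positivity
    have h3 : 0 ≤ Real.pi * |d| * η := by positivity
    nlinarith
  -- The tangent direction `ω₀` is on the edge of the half-plane, where the blow-up limit is not
  -- available. It is moved inside by `η`, and the Lipschitz bound pays for this with a multiple of
  -- `η`.
  have hω1 : 0 < (ω₀ + η).re := by rw [add_re, hω₀, Complex.ofReal_re]; linarith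
  obtain ⟨N, hN, hev⟩ := hflat.eventually_mem hq1 hC hr hν hω1 hρ
  have hdil := h.tendsto_dilate hU hq1 hq2 hC hr hp hν hflat hd hω1
  have hδc : ContinuousWithinAt δ (Ioi 0) 0 := (hδd.mono Ioi_subset_Ici_self).continuousWithinAt
  have hδb : ∀ᶠ t in 𝓝[>] (0 : ℝ), δ t ∈ ball p ρ :=
    hδc (by rw [hδ0]; exact ball_mem_nhds p hρ)
  filter_upwards [hev, (Metric.tendsto_nhds.1 hdil) η hη0, (Metric.tendsto_nhds.1 hslope) η hη0,
    hδb, self_mem_nhdsWithin] with t ht htd hts htb ht0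
  have ht0' : (0 : ℝ) < t := ht0
  have htC : (t : ℂ) ≠ 0 := by exact_mod_cast ht0'.ne'
  have hmem := ht _ (mem_of_mem_nhds hN)
  have e0 : slope (fun t => G (δ t)) 0 t = (G (δ t) - G p) / t := by
    rw [slope_def_module, hδ0, sub_zero, Complex.real_smul]
    push_cast; field_simp
  have e1 : slope δ 0 t = (δ t - p) / t := by
    rw [slope_def_module, hδ0, sub_zero, Complex.real_smul]
    push_cast; field_simp
  rw [e1, dist_eq_norm] at hts
  rw [e0, dist_eq_norm]
  rw [dist_eq_norm] at htd
  have a1 : ‖(G (δ t) - G (p + ν * (t * (ω₀ + η)))) / t‖ ≤ K * (2 * η) := by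
    rw [norm_div, Complex.norm_of_nonneg ht0'.le, div_le_iff₀ ht0']
    refine (hL _ ⟨hδ t, htb⟩ _ ⟨subset_closure hmem.1, hmem.2⟩).trans ?_
    rw [mul_assoc]
    refine mul_le_mul_of_nonneg_left ?_ hK
    have e2 : δ t - (p + ν * (t * (ω₀ + η))) = t * ((δ t - p) / t - ν * ω₀) - t * (ν * η) := by
      field_simp; ring
    rw [e2]
    refine (norm_sub_le _ _).trans ?_
    rw [norm_mul, norm_mul, norm_mul, hν, Complex.norm_of_nonneg ht0'.le,
      Complex.norm_of_nonneg hη0.le]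
    nlinarith
  have e3 : (G (δ t) - G p) / t - -(2 * Real.pi * d) * G p * ω₀ =
      (G (δ t) - G (p + ν * (t * (ω₀ + η)))) / t +
      (dilate G p ν t (ω₀ + η) - -(2 * Real.pi * d) * G p * (ω₀ + η)) +
      -(2 * Real.pi * d) * G p * η := by
    rw [dilate]; field_simp; ring
  have a2 : ‖(-(2 * Real.pi * d) * G p * η : ℂ)‖ = 2 * Real.pi * |d| * η := by
    rw [norm_mul, norm_mul, hGp, norm_neg, norm_mul, norm_mul, Complex.norm_of_nonneg hη0.le,
      Complex.norm_real, Complex.norm_real, Real.norm_of_nonneg hπ.le, Real.norm_eq_abs]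
    simp
  rw [e3]
  calc _ ≤ ‖(G (δ t) - G (p + ν * (t * (ω₀ + η)))) / t‖ +
      ‖dilate G p ν t (ω₀ + η) - -(2 * Real.pi * d) * G p * (ω₀ + η)‖ +
      ‖(-(2 * Real.pi * d) * G p * η : ℂ)‖ :=
        (norm_add_le _ _).trans (add_le_add (norm_add_le _ _) le_rfl)
    _ < ε := by rw [a2]; nlinarith

/-- Near a boundary point with positive normal derivative, `G` attains the values on the radius. -/
theorem eventually_exists_eq (h : IsRegularRiemannMap Ω c G) (hU : IsGreenFunction Ω c U)
    (hq1 : 1 < q) (hq2 : q < 2) (hC : 0 ≤ C) (hr : 0 < r)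
    (hp : p ∈ frontier Ω) (hν : ‖ν‖ = 1) (hflat : IsFlatAt Ω q C r p ν)
    (hd : HasInteriorNormalDeriv U p ν d) (hd0 : 0 < d) {ρ : ℝ} (hρ : 0 < ρ) :
    ∀ᶠ τ : ℝ in 𝓝[>] 0, ∃ z ∈ Ω ∩ ball p ρ, G z = G p * (1 - τ) := by
  have hπ := Real.pi_pos
  have hGp := h.norm_eq_one p hp
  have hGp0 : G p ≠ 0 := norm_ne_zero_iff.1 (by rw [hGp]; exact one_ne_zero)
  obtain ⟨K, hK, hdil⟩ := h.eventually_dilate hq1 hC hr hp hν hflat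
  set k : ℂ := 2 * Real.pi * d * G p with hk
  have hk0 : k ≠ 0 := by
    refine mul_ne_zero ?_ hGp0
    have : (2 * Real.pi * d : ℝ) ≠ 0 := by positivity
    exact_mod_cast this
  have hopen : IsOpen {ω : ℂ | 0 < ω.re} := isOpen_lt continuous_const continuous_re
  have h1 : (1 : ℂ) ∈ {ω : ℂ | 0 < ω.re} := by simp
  -- The limit `-k ω + k` has an isolated zero at `ω = 1`. Hurwitz' theorem gives nearby points
  -- where `dilate G p ν t ω = -k`, that is, where `G = G p * (1 - 2π d t)`.
  have hlu : TendstoLocallyUniformlyOn (fun t ω => dilate G p ν t ω + k) (fun ω => -k * ω + k)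
      (𝓝[>] 0) {ω | 0 < ω.re} := by
    refine tendstoLocallyUniformlyOn_of_lipschitz (fun x hx => ?_) (fun x hx => ?_)
    · obtain ⟨N, hN, hev⟩ := hdil x hx
      refine ⟨N, hN, K, hev.mono fun t ht y hy y' hy' => ?_⟩
      rw [add_sub_add_right_eq_sub]
      exact ht.2.1 y hy y' hy'
    · have := (h.tendsto_dilate hU hq1 hq2 hC hr hp hν hflat hd hx).add_const k
      convert this using 2
      rw [hk]; ring
  obtain ⟨N, hN, hev⟩ := hflat.eventually_mem hq1 hC hr hν (ω₀ := 1) (by simp) hρ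
  obtain ⟨r', hr', hr'N⟩ := Metric.nhds_basis_closedBall.mem_iff.1 hN
  have hzero := eventually_exists_zero_of_tendstoLocallyUniformlyOn hopen hlu h1
    (by
      obtain ⟨N, hN, hev⟩ := hdil 1 h1
      exact ⟨N, hN, hev.mono fun t ht => ht.1.add_const _⟩)
    (by fun_prop) (by ring) (by
      intro hcon
      have h2 : Tendsto (fun t : ℝ => (1 : ℂ) + t) (𝓝[>] 0) (𝓝 1) := by
        have : Continuous (fun t : ℝ => (1 : ℂ) + t) := by fun_prop
        have h4 := this.tendsto 0
        simp only [ofReal_zero, add_zero] at h4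
        exact h4.mono_left nhdsWithin_le_nhds
      obtain ⟨t, ht, ht0⟩ := ((h2.eventually hcon).and self_mem_nhdsWithin).exists
      have ht0' : (0 : ℝ) < t := ht0
      have h5 : k * t = 0 := by linear_combination -ht
      rcases mul_eq_zero.1 h5 with h6 | h6
      · exact hk0 h6
      · exact ht0'.ne' (by exact_mod_cast h6)) hr'
  have hev2 : ∀ᶠ t : ℝ in 𝓝[>] 0, ∃ z ∈ Ω ∩ ball p ρ, G z = G p * (1 - 2 * Real.pi * d * t) := by
    filter_upwards [hzero, hev, self_mem_nhdsWithin] with t ht hmem ht0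
    have ht0' : (0 : ℝ) < t := ht0
    have htC : (t : ℂ) ≠ 0 := by exact_mod_cast ht0'.ne'
    obtain ⟨ω, hω, -, hωz⟩ := ht
    refine ⟨_, hmem ω (hr'N hω), ?_⟩
    rw [dilate] at hωz
    have h6 : (G (p + ν * (t * ω)) - G p) / t * t = -k * t := by linear_combination t * hωz
    rw [div_mul_cancel₀ _ htC] at h6
    linear_combination h6 - t * hk
  have hτ : Tendsto (fun τ : ℝ => τ / (2 * Real.pi * d)) (𝓝[>] 0) (𝓝[>] 0) := by
    refine tendsto_nhdsWithin_iff.2 ⟨?_, ?_⟩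
    · have : Continuous fun τ : ℝ => τ / (2 * Real.pi * d) := by fun_prop
      have h4 := this.tendsto 0
      simp only [zero_div] at h4
      exact h4.mono_left nhdsWithin_le_nhds
    · filter_upwards [self_mem_nhdsWithin] with τ hτ
      have : (0 : ℝ) < τ := hτ
      exact div_pos this (by positivity)
  filter_upwards [hτ.eventually hev2] with τ hτ2
  obtain ⟨z, hz, hzG⟩ := hτ2
  refine ⟨z, hz, ?_⟩
  rw [hzG]
  push_cast
  have hdC : (d : ℂ) ≠ 0 := by exact_mod_cast hd0.ne'
  have hπC : (Real.pi : ℂ) ≠ 0 := by exact_mod_cast hπ.ne'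
  field_simp

/-- If all normal derivatives exist and are positive, the Riemann map is injective on the
boundary. -/
theorem injOn_frontier (h : IsRegularRiemannMap Ω c G) (hU : IsGreenFunction Ω c U)
    (hq1 : 1 < q) (hq2 : q < 2) (hC : 0 ≤ C) (hr : 0 < r)
    (hn : ∀ p ∈ frontier Ω, ∃ ν d, ‖ν‖ = 1 ∧ IsFlatAt Ω q C r p ν ∧
      HasInteriorNormalDeriv U p ν d ∧ 0 < d) : InjOn G (frontier Ω) := by
  intro p hp p' hp' heq
  by_contra hne
  have hdist : 0 < dist p p' := dist_pos.2 hne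
  obtain ⟨ν, d, hν, hf, hd, hd0⟩ := hn p hp
  obtain ⟨ν', d', hν', hf', hd', hd0'⟩ := hn p' hp'
  -- If `G p = G p'`, one value `G p * (1 - τ)` is attained in both of two disjoint discs, against
  -- injectivity inside.
  obtain ⟨τ, ⟨z, hz, hzG⟩, z', hz', hzG'⟩ :=
    ((h.eventually_exists_eq hU hq1 hq2 hC hr hp hν hf hd hd0 (half_pos hdist)).and
      (h.eventually_exists_eq hU hq1 hq2 hC hr hp' hν' hf' hd' hd0' (half_pos hdist))).exists
  have h1 : z = z' := h.bijOn.injOn hz.1 hz'.1 (by rw [hzG, hzG', heq])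
  have h2 := hz.2
  have h3 := hz'.2
  rw [← h1] at h3
  rw [mem_ball] at h2 h3
  have := dist_triangle_left p p' z
  linarith

/-- The inverse of a Riemann map, as a homeomorphism of the closures. -/
theorem exists_inverse_closedBall (h : IsRegularRiemannMap Ω c G)
    (hinj : InjOn G (frontier Ω)) :
    ∃ f : ℂ → ℂ, (∀ z ∈ closure Ω, f (G z) = z) ∧ MapsTo f (closedBall 0 1) (closure Ω) ∧
      MapsTo f (ball 0 1) Ω ∧ (∀ w ∈ closedBall (0 : ℂ) 1, G (f w) = w) ∧
      ContinuousOn f (closedBall 0 1) ∧ DifferentiableOn ℂ f (ball 0 1) := by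
  have hcl : ∀ z ∈ closure Ω, z ∉ Ω → z ∈ frontier Ω := fun z hz hzΩ => by
    rw [h.isOpen.frontier_eq]; exact ⟨hz, hzΩ⟩
  have hcomp : IsCompact (closure Ω) := h.isBounded.isCompact_closure
  have hbij : BijOn G (closure Ω) (closedBall 0 1) := by
    refine ⟨fun z hz => ?_, fun z hz z' hz' heq => ?_, ?_⟩
    · rw [mem_closedBall_zero_iff]
      by_cases hzΩ : z ∈ Ω
      · exact (h.norm_lt_one hzΩ).le
      · exact (h.norm_eq_one z (hcl z hz hzΩ)).le
    · by_cases hzΩ : z ∈ Ω <;> by_cases hzΩ' : z' ∈ Ω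
      · exact h.bijOn.injOn hzΩ hzΩ' heq
      · exfalso
        have h1 := h.norm_lt_one hzΩ
        rw [heq, h.norm_eq_one z' (hcl z' hz' hzΩ')] at h1
        exact lt_irrefl _ h1
      · exfalso
        have h1 := h.norm_lt_one hzΩ'
        rw [← heq, h.norm_eq_one z (hcl z hz hzΩ)] at h1
        exact lt_irrefl _ h1
      · exact hinj (hcl z hz hzΩ) (hcl z' hz' hzΩ') heq
    · have h1 : closure (ball (0 : ℂ) 1) ⊆ G '' closure Ω :=
        closure_minimal (h.bijOn.surjOn.trans (image_mono subset_closure))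
          (hcomp.image_of_continuousOn h.continuousOn).isClosed
      rwa [closure_ball _ one_ne_zero] at h1
  have hi := hbij.invOn_invFunOn
  have hm := hbij.surjOn.mapsTo_invFunOn
  set f := Function.invFunOn G (closure Ω) with hf
  have hmb : MapsTo f (ball 0 1) Ω := by
    intro w hw
    obtain ⟨z, hz, rfl⟩ := h.bijOn.surjOn hw
    rw [hi.1 (subset_closure hz)]; exact hz
  refine ⟨f, hi.1, hm, hmb, hi.2, ?_, ?_⟩
  · rw [continuousOn_iff_isClosed]
    intro t ht
    refine ⟨G '' (closure Ω ∩ t), ((hcomp.inter_right ht).image_of_continuousOn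
      (h.continuousOn.mono inter_subset_left)).isClosed, ?_⟩
    ext w
    constructor
    · rintro ⟨hwt, hw⟩
      exact ⟨⟨f w, ⟨hm hw, hwt⟩, hi.2 hw⟩, hw⟩
    · rintro ⟨⟨z, ⟨hz, hzt⟩, rfl⟩, hw⟩
      refine ⟨?_, hw⟩
      rw [mem_preimage, hi.1 hz]; exact hzt
  · exact differentiableOn_of_leftInverse h.isOpen h.differentiableOn h.bijOn isOpen_ball
      fun z hz => hi.1 (subset_closure hz)

end IsRegularRiemannMap

theorem IsCounterclockwiseArclengthParam.mem_frontier {Ω : Set ℂ} {b : ℂ} {L : ℝ} {γ : ℝ → ℂ}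
    (hγ : IsCounterclockwiseArclengthParam Ω b L γ) (t : ℝ) : γ t ∈ frontier Ω := by
  rw [← hγ.image_eq]
  obtain ⟨t', ht', h⟩ := hγ.periodic.exists_mem_Ico₀ hγ.length_pos t
  exact ⟨t', ht', h.symm⟩

theorem IsCounterclockwiseArclengthParam.hasDerivAt {Ω : Set ℂ} {b : ℂ} {L : ℝ} {γ : ℝ → ℂ}
    (hγ : IsCounterclockwiseArclengthParam Ω b L γ) (s : ℝ) : HasDerivAt γ (deriv γ s) s :=
  (hγ.contDiff.differentiable one_ne_zero s).hasDerivAt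

/-- The derivative of the boundary values of the Riemann map with respect to arclength. -/
theorem IsRegularRiemannMap.hasDerivAt_boundary {α : ℝ≥0} (hα₀ : 0 < α) (hα₁ : α < 1) {Ω : Set ℂ}
    (hΩ : IsC1HolderDomain α Ω) {c b : ℂ} {G : ℂ → ℂ} (h : IsRegularRiemannMap Ω c G) {U : ℂ → ℝ}
    (hU : IsGreenFunction Ω c U) {L : ℝ} {γ : ℝ → ℂ}
    (hγ : IsCounterclockwiseArclengthParam Ω b L γ) {s d : ℝ}
    (hd : HasInteriorNormalDeriv U (γ s) (I * deriv γ s) d) :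
    HasDerivAt (fun t => G (γ t)) (2 * Real.pi * d * I * G (γ s)) s := by
  obtain ⟨C, r, hC, hr, hflat⟩ := hΩ.exists_isFlatAt
  have hα₀' : (0 : ℝ) < α := by exact_mod_cast hα₀
  have hα₁' : (α : ℝ) < 1 := by exact_mod_cast hα₁
  have hp := hγ.mem_frontier s
  obtain ⟨ν, hν, hfl⟩ := hflat _ hp
  have hνeq := hγ.normal_eq hΩ.isOpen (by linarith) hC hr hν hfl
  rw [hνeq] at hd
  have hdγ : deriv γ s = ν * (-I) := by
    rw [← hνeq]; linear_combination (deriv γ s) * I_mul_I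
  have h1 : HasDerivAt (fun t => γ (s + t)) (ν * (-I)) 0 := by
    rw [← hdγ]
    have := hγ.hasDerivAt s
    exact HasDerivAt.comp_const_add s 0 (by rwa [add_zero])
  have h2 : HasDerivAt (fun t => γ (s - t)) (ν * I) 0 := by
    have h3 : HasDerivAt γ (ν * (-I)) (s - 0) := by
      rw [← hdγ, sub_zero]; exact hγ.hasDerivAt s
    have := HasDerivAt.comp_const_sub s 0 h3
    exact this.congr_deriv (by ring)
  -- The forward tangent is `-iν` and the backward one `iν`; the two one-sided derivatives fit
  -- together.
  have r1 := h.hasDerivWithinAt_comp hU (by linarith) (by linarith) hC hr hp hν hfl hd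
    (ω₀ := -I) (by simp) (fun t => frontier_subset_closure (hγ.mem_frontier (s + t)))
    (by simp) h1.hasDerivWithinAt
  have r2 := h.hasDerivWithinAt_comp hU (by linarith) (by linarith) hC hr hp hν hfl hd
    (ω₀ := I) (by simp) (fun t => frontier_subset_closure (hγ.mem_frontier (s - t)))
    (by simp) h2.hasDerivWithinAt
  have r3 : HasDerivWithinAt (fun t => G (γ (s + t))) (2 * Real.pi * d * I * G (γ s)) (Iic 0) 0 := by
    have hneg : HasDerivWithinAt (fun t : ℝ => -t) (-1) (Iic 0) 0 :=
      (hasDerivAt_neg 0).hasDerivWithinAt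
    have r2' : HasDerivWithinAt (fun t => G (γ (s - t))) (-(2 * Real.pi * d) * G (γ s) * I)
        (Ici 0) (-(0 : ℝ)) := by rw [neg_zero]; exact r2
    have := HasDerivWithinAt.scomp (0 : ℝ) r2' hneg (fun t ht => by
      have : t ≤ 0 := ht
      simpa using this)
    refine (this.congr_deriv ?_).congr (fun t _ => ?_) ?_
    · rw [neg_one_smul]; ring
    · simp [Function.comp]
    · simp [Function.comp]
  have r4 : HasDerivAt (fun t => G (γ (s + t))) (2 * Real.pi * d * I * G (γ s)) 0 := by
    have := (r1.congr_deriv (by ring : _ = 2 * Real.pi * d * I * G (γ s))).union r3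
    rw [Ici_union_Iic, hasDerivWithinAt_univ] at this
    exact this
  have r5 := HasDerivAt.comp_sub_const (f := fun t => G (γ (s + t))) s s (by rwa [sub_self])
  simpa using r5

/-- Hopf's lemma along the boundary curve, and injectivity of the Riemann map on the boundary. -/
theorem IsRegularRiemannMap.injOn_frontier_of_normalDeriv {α : ℝ≥0} (hα₀ : 0 < α) (hα₁ : α < 1)
    {Ω : Set ℂ} (hΩ : IsC1HolderDomain α Ω) {c b : ℂ} {G : ℂ → ℂ}
    (h : IsRegularRiemannMap Ω c G) {U : ℂ → ℝ} (hU : IsGreenFunction Ω c U) {L : ℝ} {γ : ℝ → ℂ}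
    (hγ : IsCounterclockwiseArclengthParam Ω b L γ) {φ : ℝ → ℝ}
    (hφ : IsNormalDerivAlong U γ L φ) : InjOn G (frontier Ω) := by
  obtain ⟨C, r, hC, hr, hflat⟩ := hΩ.exists_isFlatAt
  have hα₀' : (0 : ℝ) < α := by exact_mod_cast hα₀
  have hα₁' : (α : ℝ) < 1 := by exact_mod_cast hα₁
  refine h.injOn_frontier hU (q := 1 + α) (by linarith) (by linarith) hC hr fun p hp => ?_
  obtain ⟨s, hs, rfl⟩ : p ∈ γ '' Ico 0 L := by rw [hγ.image_eq]; exact hp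
  obtain ⟨ν, hν, hfl⟩ := hflat _ hp
  have hνeq := hγ.normal_eq hΩ.isOpen (by linarith) hC hr hν hfl
  have hd := hφ s (Ico_subset_Icc_self hs)
  rw [hνeq] at hd
  refine ⟨ν, φ s, hν, hfl, hd, ?_⟩
  obtain ⟨m, hm, hev⟩ := hU.exists_mul_le hΩ.isOpen h.mem
    (fun z hz hzc => h.greenFunction_pos hU hz hzc) (by linarith) (by linarith) hC hr hp hν hfl
  -- Hopf's lemma bounds the difference quotients along the normal below by `m`, hence `φ s ≥ m >
  -- 0`.
  refine hm.trans_le ?_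
  have hsl := (hasDerivWithinAt_iff_tendsto_slope' (by simp)).1 (hd.mono Ioi_subset_Ici_self)
  refine ge_of_tendsto hsl ?_
  filter_upwards [hev, self_mem_nhdsWithin] with t ht ht0
  have ht0' : (0 : ℝ) < t := ht0
  rw [slope_def_field, le_div_iff₀ (by linarith)]
  have e1 : (γ s + ((0 : ℝ) : ℂ) * ν) = γ s := by simp
  rw [e1, hU.eq_zero _ hp, mul_comm (t : ℂ) ν]
  linarith

/-! ### The reflection in complex notation, and chords of the arclength curve. -/

/-- The reflection in a line through `c`, in complex notation. -/
theorem exists_reflection_eq (ℓ : AffineSubspace ℝ ℂ) [Nonempty ℓ]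
    (hℓ : Module.finrank ℝ ℓ.direction = 1) {c : ℂ} (hc : c ∈ ℓ) :
    ∃ m : ℂ, ‖m‖ = 1 ∧
      ∀ z, EuclideanGeometry.reflection ℓ z = c + m * starRingEnd ℂ (z - c) := by
  obtain ⟨⟨u, hu⟩, hu0, hspan⟩ := finrank_eq_one_iff'.1 hℓ
  have hu0' : u ≠ 0 := fun h => hu0 (Subtype.ext h)
  have hcu : starRingEnd ℂ u ≠ 0 := (map_ne_zero _).2 hu0'
  have hdir : ℓ.direction = Submodule.span ℝ {u} := by
    refine le_antisymm (fun w hw => ?_) ((Submodule.span_singleton_le_iff_mem _ _).2 hu)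
    obtain ⟨a, ha⟩ := hspan ⟨w, hw⟩
    exact Submodule.mem_span_singleton.2 ⟨a, congrArg Subtype.val ha⟩
  have key : ∀ (K : Submodule ℝ ℂ) [K.HasOrthogonalProjection], K = Submodule.span ℝ {u} →
      ∀ v, K.reflection v = u / starRingEnd ℂ u * starRingEnd ℂ v := by
    intro K _ hK v
    subst hK
    rw [Submodule.reflection_singleton_apply, Complex.inner]
    have hn : ((‖u‖ : ℝ) : ℂ) ^ 2 = u * starRingEnd ℂ u := (Complex.mul_conj' u).symm
    have h2 : (2 * ((v * starRingEnd ℂ u).re : ℝ) : ℂ) =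
        v * starRingEnd ℂ u + starRingEnd ℂ v * u := by
      have := Complex.add_conj (v * starRingEnd ℂ u)
      rw [map_mul, Complex.conj_conj] at this
      rw [this]
      push_cast; ring
    simp only [nsmul_eq_mul, Complex.real_smul, Complex.ofReal_div, Complex.ofReal_pow,
      RCLike.ofReal_real_eq_id, id]
    rw [hn]
    push_cast
    field_simp
    linear_combination h2
  refine ⟨u / starRingEnd ℂ u, ?_, fun z => ?_⟩
  · rw [norm_div, Complex.norm_conj, div_self (norm_ne_zero_iff.2 hu0')]
  · rw [EuclideanGeometry.reflection_apply_of_mem ℓ z hc, key _ hdir, vsub_eq_sub, vadd_eq_add,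
      add_comm]

namespace IsCounterclockwiseArclengthParam

variable {Ω : Set ℂ} {b : ℂ} {L : ℝ} {γ : ℝ → ℂ}

theorem norm_sub_le (hγ : IsCounterclockwiseArclengthParam Ω b L γ) (s t : ℝ) :
    ‖γ s - γ t‖ ≤ |s - t| := by
  have := convex_univ.norm_image_sub_le_of_norm_deriv_le (f := γ) (C := 1)
    (fun x _ => (hγ.hasDerivAt x).differentiableAt) (fun x _ => (hγ.norm_deriv x).le)
    (mem_univ t) (mem_univ s)
  simpa using this

theorem exists_norm_deriv_sub_lt (hγ : IsCounterclockwiseArclengthParam Ω b L γ) {ε : ℝ}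
    (hε : 0 < ε) : ∃ δ > 0, ∀ s t, |s - t| < δ → ‖deriv γ s - deriv γ t‖ < ε := by
  have hL := hγ.length_pos
  have hcont : Continuous (deriv γ) := hγ.contDiff.continuous_deriv le_rfl
  have hper : Function.Periodic (deriv γ) L := fun x => by
    have : (fun y => γ (y + L)) = γ := funext hγ.periodic
    conv_rhs => rw [← this]
    rw [deriv_comp_add_const]
  -- Once `s` is shifted into `[0, L)` by a period, every `t` with `|s - t| < L` lies in `[-L, 2L]`.
  have huc := (isCompact_Icc (a := -L) (b := 2 * L)).uniformContinuousOn_of_continuous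
    hcont.continuousOn
  obtain ⟨δ, hδ, h⟩ := Metric.uniformContinuousOn_iff.1 huc ε hε
  refine ⟨min δ L, lt_min hδ hL, fun s t hst => ?_⟩
  have h1 : |s - t| < δ := hst.trans_le (min_le_left _ _)
  have h2 := abs_lt.1 (hst.trans_le (min_le_right _ _))
  set k := toIcoDiv hL 0 s
  have hk := sub_toIcoDiv_zsmul_mem_Ico hL 0 s
  have hs : deriv γ s = deriv γ (s - k • L) := (hper.sub_zsmul_eq k).symm
  have ht : deriv γ t = deriv γ (t - k • L) := (hper.sub_zsmul_eq k).symm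
  rw [hs, ht, ← dist_eq_norm]
  rw [zero_add] at hk
  refine h _ ⟨by linarith [hk.1], by linarith [hk.2]⟩ _
    ⟨by linarith [hk.1, h2.2], by linarith [hk.2, h2.1]⟩ ?_
  rw [Real.dist_eq]
  convert h1 using 2
  ring

/-- Arc and chord agree to first order, uniformly along the curve: mean value inequality for `γ x -
x γ'(t)`. -/
theorem exists_mul_abs_sub_le (hγ : IsCounterclockwiseArclengthParam Ω b L γ) {ε : ℝ}
    (hε : 0 < ε) : ∃ δ > 0, ∀ s t, |s - t| < δ → (1 - ε) * |s - t| ≤ ‖γ s - γ t‖ := by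
  obtain ⟨δ, hδ, h⟩ := hγ.exists_norm_deriv_sub_lt hε
  refine ⟨δ, hδ, fun s t hst => ?_⟩
  have h1 := (convex_uIcc t s).norm_image_sub_le_of_norm_hasDerivWithin_le
    (f := fun x => γ x - x * deriv γ t) (f' := fun x => deriv γ x - 1 * deriv γ t) (C := ε)
    (fun x _ => ((hγ.hasDerivAt x).sub
      ((Complex.ofRealCLM.hasDerivAt (x := x)).mul_const _)).hasDerivWithinAt)
    (fun x hx => by
      rw [one_mul]
      refine (h x t (lt_of_le_of_lt ?_ hst)).le
      exact abs_sub_left_of_mem_uIcc hx) left_mem_uIcc right_mem_uIcc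
  have h2 : γ s - γ t = (γ s - s * deriv γ t - (γ t - t * deriv γ t)) +
      ((s - t : ℝ) : ℂ) * deriv γ t := by push_cast; ring
  have h3 : ‖((s - t : ℝ) : ℂ) * deriv γ t‖ = |s - t| := by
    rw [norm_mul, hγ.norm_deriv, mul_one, Complex.norm_real, Real.norm_eq_abs]
  rw [Real.norm_eq_abs] at h1
  have h4 := norm_sub_le_norm_add (((s - t : ℝ) : ℂ) * deriv γ t)
    (γ s - s * deriv γ t - (γ t - t * deriv γ t))
  rw [add_comm, ← h2, h3] at h4
  linarith

/-- A short chord cannot join points far apart along the curve: on the compact set of pairs at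
distance `≥ δ` modulo `L` the chord is positive by injectivity, so it has a positive minimum. -/
theorem exists_abs_sub_add_lt (hγ : IsCounterclockwiseArclengthParam Ω b L γ) {δ : ℝ}
    (hδ : 0 < δ) : ∃ η > 0, ∀ s t, ‖γ s - γ t‖ < η → ∃ k : ℤ, |s - (t + k * L)| < δ := by
  have hL := hγ.length_pos
  have hcont : Continuous γ := hγ.contDiff.continuous
  set K : Set (ℝ × ℝ) := (Icc 0 L ×ˢ Icc 0 L) ∩ {x | ∀ k : ℤ, δ ≤ |x.1 - (x.2 + k * L)|} with hK
  have hKc : IsCompact K := by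
    refine (isCompact_Icc.prod isCompact_Icc).inter_right ?_
    have : {x : ℝ × ℝ | ∀ k : ℤ, δ ≤ |x.1 - (x.2 + k * L)|} =
      ⋂ k : ℤ, {x : ℝ × ℝ | δ ≤ |x.1 - (x.2 + k * L)|} := by ext; simp
    rw [this]
    exact isClosed_iInter fun k => isClosed_le continuous_const (by fun_prop)
  have hpos : ∀ x ∈ K, 0 < ‖γ x.1 - γ x.2‖ := by
    rintro ⟨s, t⟩ hx
    have hs : s ∈ Icc 0 L := hx.1.1
    have ht : t ∈ Icc 0 L := hx.1.2
    have hst : ∀ k : ℤ, δ ≤ |s - (t + k * L)| := hx.2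
    rw [norm_pos_iff, sub_ne_zero]
    intro heq
    have hγL : γ L = γ 0 := by simpa using hγ.periodic 0
    have hzero : ∀ k : ℤ, s ≠ t + k * L := fun k hk => by
      have := hst k
      rw [hk, sub_self, abs_zero] at this
      linarith
    rcases hs.2.lt_or_eq with h1 | h1 <;> rcases ht.2.lt_or_eq with h2 | h2
    · exact hzero 0 (by simpa using hγ.injOn ⟨hs.1, h1⟩ ⟨ht.1, h2⟩ heq)
    · have h3 := hγ.injOn ⟨hs.1, h1⟩ ⟨le_rfl, hL⟩ (by rw [← hγL, ← h2]; exact heq)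
      exact hzero (-1) (by rw [h3, h2]; push_cast; ring)
    · have h3 := hγ.injOn ⟨ht.1, h2⟩ ⟨le_rfl, hL⟩ (by rw [← hγL, ← h1]; exact heq.symm)
      exact hzero 1 (by rw [h3, h1]; push_cast; ring)
    · exact hzero 0 (by rw [h1, h2]; simp)
  obtain ⟨η, hη, hηK⟩ : ∃ η > 0, ∀ x ∈ K, η ≤ ‖γ x.1 - γ x.2‖ := by
    rcases K.eq_empty_or_nonempty with h0 | hne
    · exact ⟨1, one_pos, by simp [h0]⟩
    · obtain ⟨x, hx, hmin⟩ := hKc.exists_isMinOn hne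
        (f := fun x : ℝ × ℝ => ‖γ x.1 - γ x.2‖) (by fun_prop)
      exact ⟨_, hpos x hx, fun y hy => hmin hy⟩
  refine ⟨η, hη, fun s t hst => ?_⟩
  by_contra! hcon
  have hs := sub_toIcoDiv_zsmul_mem_Ico hL 0 s
  have ht := sub_toIcoDiv_zsmul_mem_Ico hL 0 t
  set k := toIcoDiv hL 0 s
  set j := toIcoDiv hL 0 t
  rw [zero_add] at hs ht
  have hmem : (s - k • L, t - j • L) ∈ K := by
    refine ⟨⟨Ico_subset_Icc_self hs, Ico_subset_Icc_self ht⟩, fun n => ?_⟩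
    have e : (s - k • L) - ((t - j • L) + n * L) = s - (t + ((k - j + n : ℤ) : ℝ) * L) := by
      rw [zsmul_eq_mul, zsmul_eq_mul]
      push_cast; ring
    change δ ≤ |(s - k • L) - ((t - j • L) + n * L)|
    rw [e]
    exact hcon _
  have : η ≤ ‖γ (s - k • L) - γ (t - j • L)‖ := hηK _ hmem
  rw [hγ.periodic.sub_zsmul_eq k, hγ.periodic.sub_zsmul_eq j] at this
  linarith

/-- Traversing the curve backwards does not distort small distances. -/
theorem exists_mul_norm_sub_le (hγ : IsCounterclockwiseArclengthParam Ω b L γ) {ε : ℝ}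
    (hε : 0 < ε) (hε1 : ε < 1) : ∃ η > 0, ∀ s t, ‖γ s - γ t‖ < η →
      (1 - ε) * ‖γ (-s) - γ (-t)‖ ≤ ‖γ s - γ t‖ := by
  obtain ⟨δ, hδ, h⟩ := hγ.exists_mul_abs_sub_le hε
  obtain ⟨η, hη, h'⟩ := hγ.exists_abs_sub_add_lt hδ
  refine ⟨η, hη, fun s t hst => ?_⟩
  obtain ⟨k, hk⟩ := h' s t hst
  have e1 : γ (t + k * L) = γ t := hγ.periodic.int_mul k t
  have e2 : γ (-(t + k * L)) = γ (-t) := by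
    rw [neg_add', hγ.periodic.sub_int_mul_eq k]
  rw [← e1, ← e2]
  refine le_trans (mul_le_mul_of_nonneg_left (hγ.norm_sub_le _ _) (by linarith)) ?_
  rw [neg_sub_neg, abs_sub_comm]
  exact h _ _ hk

end IsCounterclockwiseArclengthParam

/-! ### Rigidity in the disc: comparing derivatives through boundary values. -/

theorem DiffContOnCl.dslope_of_mem_nhds {f : ℂ → ℂ} {s : Set ℂ} {c : ℂ}
    (h : DiffContOnCl ℂ f s) (hs : s ∈ 𝓝 c) : DiffContOnCl ℂ (dslope f c) s :=
  ⟨(Complex.differentiableOn_dslope hs).2 h.differentiableOn,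
    (continuousOn_dslope (mem_of_superset hs subset_closure)).2
      ⟨h.continuousOn, h.differentiableOn.differentiableAt hs⟩⟩

/-- Two-point comparison of boundary values under a small rotation. -/
theorem norm_sub_rotation_le {f F : ℂ → ℂ} (hf : DiffContOnCl ℂ f (ball 0 1))
    (hF : DiffContOnCl ℂ F (ball 0 1)) (hinj : InjOn f (closedBall 0 1)) (hd : deriv f 0 ≠ 0)
    {M : ℝ} {l : ℂ} (hl : ‖l‖ = 1) (hl1 : l ≠ 1)
    (H : ∀ w ∈ sphere (0 : ℂ) 1, ‖F (l * w) - F w‖ ≤ M * ‖f (l * w) - f w‖) :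
    ∀ w ∈ ball (0 : ℂ) 1, ‖F (l * w) - F w‖ ≤ M * ‖f (l * w) - f w‖ := by
  have hl0 : l ≠ 0 := norm_ne_zero_iff.1 (by rw [hl]; exact one_ne_zero)
  have hcl : closure (ball (0 : ℂ) 1) = closedBall 0 1 := closure_ball _ one_ne_zero
  have hb0 : ball (0 : ℂ) 1 ∈ 𝓝 0 := ball_mem_nhds 0 one_pos
  have hrot : DiffContOnCl ℂ (fun w : ℂ => l * w) (ball 0 1) :=
    (by fun_prop : Differentiable ℂ fun w : ℂ => l * w).diffContOnCl
  have hmaps : MapsTo (fun w : ℂ => l * w) (ball 0 1) (ball 0 1) := fun w hw => by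
    rw [mem_ball_zero_iff] at hw ⊢; rw [norm_mul, hl, one_mul]; exact hw
  have hmapsc : ∀ w ∈ closedBall (0 : ℂ) 1, l * w ∈ closedBall (0 : ℂ) 1 := fun w hw => by
    rw [mem_closedBall_zero_iff] at hw ⊢; rw [norm_mul, hl, one_mul]; exact hw
  have hcomp : ∀ {g : ℂ → ℂ}, DiffContOnCl ℂ g (ball 0 1) →
      DiffContOnCl ℂ (fun w => g (l * w) - g w) (ball 0 1) := fun hg =>
    (hg.comp hrot hmaps).sub hg
  -- Both differences vanish at `0`, so `w` is divided out. Then `B` has no zeros on the closed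
  -- disc: off `0` because `f` is injective, at `0` because `B 0 = f'(0) (l - 1)`. So `A / B` obeys
  -- the maximum principle.
  set A := dslope (fun w => F (l * w) - F w) 0 with hA
  set B := dslope (fun w => f (l * w) - f w) 0 with hB
  have hAd : DiffContOnCl ℂ A (ball 0 1) := (hcomp hF).dslope_of_mem_nhds hb0
  have hBd : DiffContOnCl ℂ B (ball 0 1) := (hcomp hf).dslope_of_mem_nhds hb0
  have hval : ∀ (g : ℂ → ℂ) w, w ≠ 0 →
      dslope (fun w => g (l * w) - g w) 0 w = (g (l * w) - g w) / w := by
    intro g w hw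
    rw [dslope_of_ne _ hw, slope_def_field]
    simp
  have hB0 : ∀ w ∈ closedBall (0 : ℂ) 1, B w ≠ 0 := by
    intro w hw
    by_cases hw0 : w = 0
    · rw [hw0, hB, dslope_same]
      have hfd := (hf.differentiableAt isOpen_ball (mem_ball_self one_pos)).hasDerivAt
      have h1 : HasDerivAt (fun w => f (l * w)) (deriv f 0 * (l * 1)) 0 := by
        have := HasDerivAt.comp (h₂ := f) (h := fun w => l * w) 0
          (by rw [mul_zero]; exact hfd) ((hasDerivAt_id (0 : ℂ)).const_mul l)
        exact this
      rw [(h1.fun_sub hfd).deriv]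
      have : deriv f 0 * (l * 1) - deriv f 0 = deriv f 0 * (l - 1) := by ring
      rw [this]
      exact mul_ne_zero hd (sub_ne_zero.2 hl1)
    · rw [hB, hval f w hw0]
      refine div_ne_zero (sub_ne_zero.2 fun h => hl1 ?_) hw0
      have := hinj (hmapsc w hw) hw h
      exact mul_right_cancel₀ hw0 (by rw [this, one_mul])
  have hQ : DiffContOnCl ℂ (fun w => (B w)⁻¹ • A w) (ball 0 1) :=
    (hBd.inv (by rw [hcl]; exact hB0)).smul hAd
  have hratio : ∀ w ∈ closedBall (0 : ℂ) 1, w ≠ 0 →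
      (‖(B w)⁻¹ • A w‖ ≤ M ↔ ‖F (l * w) - F w‖ ≤ M * ‖f (l * w) - f w‖) := by
    intro w hw hw0
    have hpos : 0 < ‖f (l * w) - f w‖ := by
      rw [norm_pos_iff]
      have := hB0 w hw
      rw [hB, hval f w hw0] at this
      exact fun h => this (by rw [h, zero_div])
    rw [hA, hB, hval f w hw0, hval F w hw0, smul_eq_mul, norm_mul, norm_inv, norm_div, norm_div]
    have hw' : 0 < ‖w‖ := norm_pos_iff.2 hw0
    rw [show (‖f (l * w) - f w‖ / ‖w‖)⁻¹ * (‖F (l * w) - F w‖ / ‖w‖) =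
      ‖F (l * w) - F w‖ / ‖f (l * w) - f w‖ by field_simp, div_le_iff₀ hpos]
  intro w hw
  by_cases hw0 : w = 0
  · simp [hw0]
  refine (hratio w (ball_subset_closedBall hw) hw0).1 ?_
  refine Complex.norm_le_of_forall_mem_frontier_norm_le isBounded_ball hQ (fun z hz => ?_)
    (subset_closure hw)
  rw [frontier_ball _ one_ne_zero] at hz
  exact (hratio z (sphere_subset_closedBall hz) (ne_of_mem_sphere hz one_ne_zero)).2 (H z hz)

theorem hasDerivAt_comp_exp_mul_I {f : ℂ → ℂ} {w : ℂ} (hf : DifferentiableAt ℂ f w) :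
    HasDerivAt (fun x : ℝ => f (exp (x * I) * w)) (deriv f w * (I * w)) 0 := by
  have h1 : HasDerivAt (fun x : ℝ => exp (x * I) * w) (I * w) 0 := by
    have := (((Complex.ofRealCLM.hasDerivAt (x := (0 : ℝ))).mul_const I).cexp).mul_const w
    simpa using this
  have h2 : HasDerivAt f (deriv f w) (exp (((0 : ℝ) : ℂ) * I) * w) := by
    simpa using hf.hasDerivAt
  exact h2.comp (0 : ℝ) h1

/-- If the boundary values of `F` locally do not expand distances compared to those of the
injective map `f`, then `|F'| ≤ |f'|` in the disc. -/
theorem norm_deriv_le_of_boundary {f F : ℂ → ℂ} (hf : DiffContOnCl ℂ f (ball 0 1))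
    (hF : DiffContOnCl ℂ F (ball 0 1)) (hinj : InjOn f (closedBall 0 1)) (hd : deriv f 0 ≠ 0)
    (H : ∀ ε, 0 < ε → ε < 1 → ∃ η > 0, ∀ w ∈ sphere (0 : ℂ) 1, ∀ w' ∈ sphere (0 : ℂ) 1,
      ‖f w - f w'‖ < η → (1 - ε) * ‖F w - F w'‖ ≤ ‖f w - f w'‖) :
    ∀ w ∈ ball (0 : ℂ) 1, ‖deriv F w‖ ≤ ‖deriv f w‖ := by
  have hcl : closure (ball (0 : ℂ) 1) = closedBall 0 1 := closure_ball _ one_ne_zero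
  have key : ∀ w ∈ ball (0 : ℂ) 1, w ≠ 0 → ‖deriv F w‖ ≤ ‖deriv f w‖ := by
    intro w hw hw0
    have main : ∀ ε, 0 < ε → ε < 1 → (1 - ε) * ‖deriv F w‖ ≤ ‖deriv f w‖ := by
      intro ε hε hε1
      obtain ⟨η, hη, hH⟩ := H ε hε hε1
      have huc := (isCompact_closedBall (0 : ℂ) 1).uniformContinuousOn_of_continuous
        (hcl ▸ hf.continuousOn)
      obtain ⟨δ, hδ, hfδ⟩ := Metric.uniformContinuousOn_iff.1 huc η hη
      have hexp : Tendsto (fun x : ℝ => exp (x * I)) (𝓝[>] 0) (𝓝 1) := by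
        have : Continuous fun x : ℝ => exp (x * I) := by fun_prop
        have h0 := this.tendsto 0
        simp only [ofReal_zero, zero_mul, Complex.exp_zero] at h0
        exact h0.mono_left nhdsWithin_le_nhds
      -- Small rotations by `x` keep the chords of `f` on the circle below `η`, and `0 < x < 2π`
      -- ensures that the rotation is not the identity.
      have hev : ∀ᶠ x : ℝ in 𝓝[>] 0,
          ‖F (exp (x * I) * w) - F w‖ ≤ (1 - ε)⁻¹ * ‖f (exp (x * I) * w) - f w‖ := by
        filter_upwards [hexp (ball_mem_nhds 1 hδ),
          Ioo_mem_nhdsGT (Real.two_pi_pos)] with x hx hx2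
        have hl : ‖exp (x * I)‖ = 1 := norm_exp_ofReal_mul_I x
        refine norm_sub_rotation_le hf hF hinj hd hl ?_ (fun z hz => ?_) w hw
        · intro h1
          obtain ⟨n, hn⟩ := Complex.exp_eq_one_iff.1 h1
          have h2 : x = n * (2 * Real.pi) := by
            have : (x : ℂ) = n * (2 * Real.pi) := by
              have h3 : (x : ℂ) * I = n * (2 * Real.pi) * I := by rw [hn]; ring
              exact mul_right_cancel₀ I_ne_zero h3
            exact_mod_cast this
          have h4 : (0 : ℝ) < n := by
            by_contra! hneg
            nlinarith [hx2.1, Real.two_pi_pos]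
          have h5 : (n : ℝ) < 1 := by
            by_contra! hge
            nlinarith [hx2.2, Real.two_pi_pos]
          have h6 : 0 < n := by exact_mod_cast h4
          have h7 : n < 1 := by exact_mod_cast h5
          omega
        · have hz1 : ‖z‖ = 1 := mem_sphere_zero_iff_norm.1 hz
          have hlz : exp (x * I) * z ∈ sphere (0 : ℂ) 1 := by
            rw [mem_sphere_zero_iff_norm, norm_mul, hl, hz1, one_mul]
          rw [inv_mul_eq_div, le_div_iff₀' (by linarith)]
          refine hH _ hlz _ hz ?_
          rw [← dist_eq_norm]
          refine hfδ _ (sphere_subset_closedBall hlz) _ (sphere_subset_closedBall hz) ?_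
          rw [dist_eq_norm, show exp (x * I) * z - z = (exp (x * I) - 1) * z by ring, norm_mul,
            hz1, mul_one, ← dist_eq_norm]
          exact hx
      have hslope : ∀ {g : ℂ → ℂ}, DiffContOnCl ℂ g (ball 0 1) →
          Tendsto (fun x : ℝ => x⁻¹ * ‖g (exp (x * I) * w) - g w‖) (𝓝[>] 0)
            (𝓝 (‖deriv g w‖ * ‖w‖)) := by
        intro g hg
        have h1 := (hasDerivAt_comp_exp_mul_I
          (hg.differentiableAt isOpen_ball hw)).hasDerivWithinAt (s := Ioi 0)
        have h2 := ((hasDerivWithinAt_iff_tendsto_slope' (by simp)).1 h1).norm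
        rw [norm_mul, norm_mul, norm_I, one_mul] at h2
        refine h2.congr' ?_
        filter_upwards [self_mem_nhdsWithin] with x hx
        have hx' : (0 : ℝ) < x := hx
        rw [slope_def_module, norm_smul, sub_zero, norm_inv, Real.norm_of_nonneg hx'.le]
        simp
      have hlim := le_of_tendsto_of_tendsto (hslope hF) ((hslope hf).const_mul (1 - ε)⁻¹) (by
        filter_upwards [hev, self_mem_nhdsWithin] with x hx hx0
        have hx' : (0 : ℝ) < x := hx0
        rw [mul_left_comm]
        exact mul_le_mul_of_nonneg_left hx (by positivity))
      have hw' : 0 < ‖w‖ := norm_pos_iff.2 hw0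
      rw [← mul_assoc] at hlim
      have := le_of_mul_le_mul_right hlim hw'
      rwa [inv_mul_eq_div, le_div_iff₀' (by linarith)] at this
    by_contra! hcon
    have ha : 0 < ‖deriv F w‖ := (norm_nonneg _).trans_lt hcon
    have := main ((‖deriv F w‖ - ‖deriv f w‖) / (2 * ‖deriv F w‖)) (by
      apply div_pos <;> linarith) (by
      rw [div_lt_one (by positivity)]; linarith [norm_nonneg (deriv f w)])
    have e : (1 - (‖deriv F w‖ - ‖deriv f w‖) / (2 * ‖deriv F w‖)) * ‖deriv F w‖ =
      (‖deriv F w‖ + ‖deriv f w‖) / 2 := by field_simp; ring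
    rw [e] at this
    linarith
  intro w hw
  -- Rotations fix the centre and give no information there; continuity of the derivatives does.
  by_cases hw0 : w = 0
  · subst hw0
    have hc : ∀ {g : ℂ → ℂ}, DiffContOnCl ℂ g (ball 0 1) →
        Tendsto (fun z => ‖deriv g z‖) (𝓝[≠] 0) (𝓝 ‖deriv g 0‖) := fun hg =>
      (((hg.differentiableOn.deriv isOpen_ball).continuousOn.continuousAt
        (isOpen_ball.mem_nhds hw)).norm.tendsto).mono_left nhdsWithin_le_nhds
    refine le_of_tendsto_of_tendsto (hc hF) (hc hf) ?_
    filter_upwards [self_mem_nhdsWithin, nhdsWithin_le_nhds (isOpen_ball.mem_nhds hw)] with z hz hzb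
    exact key z hzb hz
  · exact key w hw hw0

/-- A function holomorphic on the disc, the modulus of whose derivative is that of `f'`, is affine
in `f`. -/
theorem exists_eq_mul_add_of_norm_deriv_eq {f F : ℂ → ℂ} (hf : DiffContOnCl ℂ f (ball 0 1))
    (hF : DiffContOnCl ℂ F (ball 0 1)) (hd : ∀ w ∈ ball (0 : ℂ) 1, deriv f w ≠ 0)
    (h : ∀ w ∈ ball (0 : ℂ) 1, ‖deriv F w‖ = ‖deriv f w‖) :
    ∃ k a : ℂ, ∀ w ∈ closedBall (0 : ℂ) 1, F w = k * f w + a := by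
  have h0 : (0 : ℂ) ∈ ball (0 : ℂ) 1 := mem_ball_self one_pos
  have hpc : IsPreconnected (ball (0 : ℂ) 1) := (convex_ball 0 1).isPreconnected
  have hn : ∀ w ∈ ball (0 : ℂ) 1, ‖deriv F w / deriv f w‖ = 1 := fun w hw => by
    rw [norm_div, h w hw, div_self (norm_ne_zero_iff.2 (hd w hw))]
  -- A holomorphic quotient of constant modulus is constant.
  have hk := Complex.eqOn_of_isPreconnected_of_isMaxOn_norm hpc isOpen_ball
    ((hF.differentiableOn.deriv isOpen_ball).div (hf.differentiableOn.deriv isOpen_ball) hd) h0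
    (fun w hw => by
      change ‖deriv F w / deriv f w‖ ≤ ‖deriv F 0 / deriv f 0‖
      rw [hn w hw, hn 0 h0])
  set k := deriv F 0 / deriv f 0 with hkdef
  have hkw : ∀ w ∈ ball (0 : ℂ) 1, deriv F w = k * deriv f w := fun w hw => by
    have : deriv F w / deriv f w = k := hk hw
    rw [← this, div_mul_cancel₀ _ (hd w hw)]
  obtain ⟨a, ha⟩ := isOpen_ball.exists_is_const_of_deriv_eq_zero hpc
    (f := fun w => F w - k * f w)
    (hF.differentiableOn.sub (hf.differentiableOn.const_mul k)) (fun w hw => by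
      have e := (hF.differentiableAt isOpen_ball hw).hasDerivAt.fun_sub
        ((hf.differentiableAt isOpen_ball hw).hasDerivAt.const_mul k)
      rw [e.deriv, hkw w hw, sub_self, Pi.zero_apply])
  refine ⟨k, a, ?_⟩
  have hcl : closure (ball (0 : ℂ) 1) = closedBall 0 1 := closure_ball _ one_ne_zero
  have heq : EqOn F (fun w => k * f w + a) (ball 0 1) := fun w hw => by
    change F w = k * f w + a
    rw [← ha w hw]; ring
  have := heq.of_subset_closure hF.continuousOn
    ((continuousOn_const.mul hf.continuousOn).add continuousOn_const) subset_closure le_rfl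
  intro w hw
  exact this (hcl ▸ hw)

/-! ### From a symmetric normal derivative to a symmetric domain. -/

/-- A symmetric normal derivative makes the boundary correspondence symmetric. -/
theorem IsRegularRiemannMap.mul_eq_one_of_symm {α : ℝ≥0} (hα₀ : 0 < α) (hα₁ : α < 1)
    {Ω : Set ℂ} (hΩ : IsC1HolderDomain α Ω) {c b : ℂ} {G : ℂ → ℂ}
    (h : IsRegularRiemannMap Ω c G) (hb : G b = 1) {U : ℂ → ℝ} (hU : IsGreenFunction Ω c U)
    {L : ℝ} {γ : ℝ → ℂ} (hγ : IsCounterclockwiseArclengthParam Ω b L γ) {φ : ℝ → ℝ}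
    (hφ : IsNormalDerivAlong U γ L φ) (hsymm : ∀ s ∈ Icc 0 L, φ s = φ (L - s)) :
    ∀ s ∈ Icc 0 L, G (γ (L - s)) * G (γ s) = 1 := by
  have hL := hγ.length_pos
  have hderiv : ∀ s ∈ Icc 0 L, HasDerivAt (fun s => G (γ (L - s)) * G (γ s)) 0 s := by
    intro s hs
    have hs' : L - s ∈ Icc 0 L := ⟨by linarith [hs.2], by linarith [hs.1]⟩
    have h1 := h.hasDerivAt_boundary hα₀ hα₁ hΩ hU hγ (hφ s hs)
    have h2 := h.hasDerivAt_boundary hα₀ hα₁ hΩ hU hγ (hφ _ hs')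
    have h3 := HasDerivAt.comp_const_sub (f := fun t => G (γ t)) L s h2
    -- The logarithmic derivatives of the two factors are `-2π i φ(L - s)` and `2π i φ(s)`, which
    -- cancel.
    have e : -(2 * Real.pi * φ (L - s) * I * G (γ (L - s))) * G (γ s) +
        G (γ (L - s)) * (2 * Real.pi * φ s * I * G (γ s)) = 0 := by
      rw [hsymm s hs]; ring
    rw [← e]
    exact h3.fun_mul h1
  intro s hs
  have := constant_of_has_deriv_right_zero (f := fun s => G (γ (L - s)) * G (γ s))
    (fun s hs => (hderiv s hs).continuousAt.continuousWithinAt)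
    (fun s hs => (hderiv s (Ico_subset_Icc_self hs)).hasDerivWithinAt) s hs
  have hγL : γ L = γ 0 := by simpa using hγ.periodic 0
  rw [this, sub_zero, hγL, hγ.start, hb, one_mul]

/-- If the normal derivative of the Green function is symmetric, then so is the domain. -/
theorem IsGreenFunction.mapsTo_reflection_of_symm {α : ℝ≥0} (hα₀ : 0 < α) (hα₁ : α < 1)
    {Ω : Set ℂ} (hΩ : IsC1HolderDomain α Ω) {c b m : ℂ} (hc : c ∈ Ω) (hb : b ∈ frontier Ω)
    (hm : ‖m‖ = 1) (hbm : c + m * starRingEnd ℂ (b - c) = b) {U : ℂ → ℝ}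
    (hU : IsGreenFunction Ω c U) {L : ℝ} {γ : ℝ → ℂ}
    (hγ : IsCounterclockwiseArclengthParam Ω b L γ) {φ : ℝ → ℝ}
    (hφ : IsNormalDerivAlong U γ L φ) (hsymm : ∀ s ∈ Icc 0 L, φ s = φ (L - s)) :
    MapsTo (fun z => c + m * starRingEnd ℂ (z - c)) Ω Ω := by
  obtain ⟨G, hG, hGb⟩ := exists_isRegularRiemannMap hα₀ hα₁ hΩ hc hb hU
  have hinj := hG.injOn_frontier_of_normalDeriv hα₀ hα₁ hΩ hU hγ hφ
  obtain ⟨f, hfG, hfcl, hfb, hGf, hfcont, hfd⟩ := hG.exists_inverse_closedBall hinj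
  have hprod := hG.mul_eq_one_of_symm hα₀ hα₁ hΩ hGb hU hγ hφ hsymm
  have hcl : closure (ball (0 : ℂ) 1) = closedBall 0 1 := closure_ball _ one_ne_zero
  have hf : DiffContOnCl ℂ f (ball 0 1) := ⟨hfd, hcl ▸ hfcont⟩
  have hconjb : ∀ w ∈ ball (0 : ℂ) 1, starRingEnd ℂ w ∈ ball (0 : ℂ) 1 := fun w hw => by
    rw [mem_ball_zero_iff] at hw ⊢; rwa [Complex.norm_conj]
  have hconjc : ∀ w ∈ closedBall (0 : ℂ) 1, starRingEnd ℂ w ∈ closedBall (0 : ℂ) 1 :=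
    fun w hw => by
      rw [mem_closedBall_zero_iff] at hw ⊢; rwa [Complex.norm_conj]
  -- Conjugation occurs twice, so `F` is holomorphic; the aim is `F = f`.
  set F : ℂ → ℂ := fun w => c + m * starRingEnd ℂ (f (starRingEnd ℂ w) - c) with hFdef
  have hFderiv : ∀ w ∈ ball (0 : ℂ) 1,
      HasDerivAt F (m * starRingEnd ℂ (deriv f (starRingEnd ℂ w))) w := by
    intro w hw
    have h1 := ((hfd.differentiableAt (isOpen_ball.mem_nhds
      (hconjb w hw))).hasDerivAt.sub_const c).conj_conj
    rw [Complex.conj_conj] at h1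
    exact (h1.const_mul m).const_add c
  have hF : DiffContOnCl ℂ F (ball 0 1) := by
    refine ⟨fun w hw => (hFderiv w hw).differentiableAt.differentiableWithinAt, ?_⟩
    rw [hcl]
    have h1 : ContinuousOn (fun w => f (starRingEnd ℂ w)) (closedBall 0 1) :=
      hfcont.comp Complex.continuous_conj.continuousOn hconjc
    exact continuousOn_const.add (continuousOn_const.mul
      (Complex.continuous_conj.comp_continuousOn (h1.sub continuousOn_const)))
  have hfinj : InjOn f (closedBall 0 1) := fun w hw w' hw' heq => by
    rw [← hGf w hw, heq, hGf w' hw']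
  have hd : ∀ w ∈ ball (0 : ℂ) 1, deriv f w ≠ 0 := by
    intro w hw h0
    have h1 := (hfd.differentiableAt (isOpen_ball.mem_nhds hw)).hasDerivAt
    have h2 := (hG.differentiableOn.differentiableAt (hG.isOpen.mem_nhds (hfb hw))).hasDerivAt
    have h3 := h2.comp w h1
    rw [h0, mul_zero] at h3
    have h4 : G ∘ f =ᶠ[𝓝 w] id := by
      filter_upwards [isOpen_ball.mem_nhds hw] with z hz
      exact hGf z (ball_subset_closedBall hz)
    exact one_ne_zero ((hasDerivAt_id w).unique (h3.congr_of_eventuallyEq h4.symm))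
  -- On the circle the inverse of `w` is its conjugate, so `G(γ(L - s)) G(γ s) = 1` says that
  -- conjugation reverses the arclength parameter.
  have hsphere : ∀ w ∈ sphere (0 : ℂ) 1, ∃ s, f w = γ s ∧ f (starRingEnd ℂ w) = γ (-s) := by
    intro w hw
    have hwc := sphere_subset_closedBall hw
    have hw1 : ‖w‖ = 1 := mem_sphere_zero_iff_norm.1 hw
    have hfr : f w ∈ frontier Ω := by
      rw [hG.isOpen.frontier_eq]
      refine ⟨hfcl hwc, fun hΩ' => ?_⟩
      have := hG.norm_lt_one hΩ'
      rw [hGf w hwc, hw1] at this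
      exact lt_irrefl _ this
    rw [← hγ.image_eq] at hfr
    obtain ⟨s, hs, hsw⟩ := hfr
    refine ⟨s, hsw.symm, ?_⟩
    have h1 := hprod s (Ico_subset_Icc_self hs)
    rw [hsw, hGf w hwc] at h1
    have h2 : starRingEnd ℂ w = G (γ (L - s)) := by
      have h3 := conj_mul_self_of_norm_eq_one hw1
      have hw0 : w ≠ 0 := ne_of_mem_sphere hw one_ne_zero
      exact mul_right_cancel₀ hw0 (h3.trans h1.symm)
    rw [h2, hfG _ (frontier_subset_closure (hγ.mem_frontier _))]
    rw [sub_eq_neg_add]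
    exact hγ.periodic _
  have hle : ∀ w ∈ ball (0 : ℂ) 1, ‖deriv F w‖ ≤ ‖deriv f w‖ := by
    refine norm_deriv_le_of_boundary hf hF hfinj (hd 0 (mem_ball_self one_pos)) ?_
    intro ε hε hε1
    obtain ⟨η, hη, hH⟩ := hγ.exists_mul_norm_sub_le hε hε1
    refine ⟨η, hη, fun w hw w' hw' hww => ?_⟩
    obtain ⟨s, hs1, hs2⟩ := hsphere w hw
    obtain ⟨t, ht1, ht2⟩ := hsphere w' hw'
    have e : ‖F w - F w'‖ = ‖γ (-s) - γ (-t)‖ := by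
      rw [hFdef]
      simp only [hs2, ht2]
      rw [show c + m * starRingEnd ℂ (γ (-s) - c) - (c + m * starRingEnd ℂ (γ (-t) - c)) =
        m * starRingEnd ℂ (γ (-s) - γ (-t)) by simp only [map_sub]; ring, norm_mul, hm, one_mul,
        Complex.norm_conj]
    rw [e, hs1, ht1]
    exact hH s t (by rwa [hs1, ht1] at hww)
  have hnF : ∀ w ∈ ball (0 : ℂ) 1, ‖deriv F w‖ = ‖deriv f (starRingEnd ℂ w)‖ := fun w hw => by
    rw [(hFderiv w hw).deriv, norm_mul, hm, one_mul, Complex.norm_conj]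
  -- Since `|F' w| = |f' (conj w)|`, the inequality `hle` at `conj w` is the reverse of the one at
  -- `w`.
  have heq : ∀ w ∈ ball (0 : ℂ) 1, ‖deriv F w‖ = ‖deriv f w‖ := by
    intro w hw
    refine le_antisymm (hle w hw) ?_
    have := hle _ (hconjb w hw)
    rwa [hnF _ (hconjb w hw), Complex.conj_conj, ← hnF w hw] at this
  obtain ⟨k, a, hka⟩ := exists_eq_mul_add_of_norm_deriv_eq hf hF hd heq
  have hf0 : f 0 = c := by rw [← hG.eq_zero]; exact hfG c (subset_closure hc)
  have hf1 : f 1 = b := by rw [← hGb]; exact hfG b (frontier_subset_closure hb)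
  have hF0 : c = k * c + a := by
    have := hka 0 (by simp)
    simp only [hFdef, map_zero, hf0, sub_self, mul_zero, add_zero] at this
    exact this
  have hF1 : b = k * b + a := by
    have := hka 1 (by simp)
    simp only [hFdef, map_one, hf1, hbm] at this
    exact this
  have hbc : b - c ≠ 0 := by
    rw [sub_ne_zero]
    rintro rfl
    rw [hG.isOpen.frontier_eq] at hb
    exact hb.2 hc
  -- `F` and `f` agree at `0` and at `1`, with the distinct values `c` and `b`.
  have hk : k = 1 := by
    have : (k - 1) * (b - c) = 0 := by linear_combination hF0 - hF1
    rcases mul_eq_zero.1 this with h1 | h1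
    · exact sub_eq_zero.1 h1
    · exact absurd h1 hbc
  have ha : a = 0 := by rw [hk] at hF0; linear_combination -hF0
  intro z hz
  have hzb := hG.bijOn.mapsTo hz
  have h1 := hka _ (ball_subset_closedBall (hconjb _ hzb))
  rw [hk, ha, one_mul, add_zero] at h1
  simp only [hFdef, Complex.conj_conj, hfG z (subset_closure hz)] at h1
  change c + m * starRingEnd ℂ (z - c) ∈ Ω
  rw [h1]
  exact hfb (hconjb _ hzb)

/-! ### From a symmetric domain to a symmetric normal derivative. -/

namespace IsCounterclockwiseArclengthParam

variable {Ω : Set ℂ} {b c m : ℂ} {L : ℝ} {γ σ : ℝ → ℂ}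

/-- In a boundary chart, the arclength of the graph grows with unit speed along the curve. -/
theorem hasDerivAt_chart_length (hγ : IsCounterclockwiseArclengthParam Ω b L γ) (hΩ : IsOpen Ω)
    {α C : ℝ≥0} (hα₀ : 0 < α) {p e : ℂ} {h : ℝ → ℝ} {r : ℝ} (hch : IsC1HolderChart α Ω p e h C r)
    {s : ℝ} (hs : γ s ∈ ball p r) :
    HasDerivAt (fun t => ∫ x in (0 : ℝ)..(starRingEnd ℂ e * (γ t - p)).re,
      Real.sqrt (1 + deriv h x ^ 2)) 1 s := by
  have hρ : 0 < r - dist (γ s) p := by rw [mem_ball] at hs; linarith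
  have hα₀' : (0 : ℝ) < α := by exact_mod_cast hα₀
  have hflat := hch.isFlatAt hΩ (hγ.mem_frontier s) (ρ := r - dist (γ s) p) (by linarith) hρ
  have hν := hγ.normal_eq hΩ (by linarith) C.2 hρ
    (IsC1HolderChart.norm_normal hch.norm_eq_one _) hflat
  set x := (starRingEnd ℂ e * (γ s - p)).re with hx
  have hS : 0 < Real.sqrt (1 + deriv h x ^ 2) := Real.sqrt_pos.2 (by positivity)
  have hcont : Continuous fun x => Real.sqrt (1 + deriv h x ^ 2) := by
    have := hch.contDiff.continuous_deriv le_rfl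
    fun_prop
  have h1 : HasDerivAt (fun y => ∫ x in (0 : ℝ)..y, Real.sqrt (1 + deriv h x ^ 2))
      (Real.sqrt (1 + deriv h x ^ 2)) x := (hcont.integral_hasStrictDerivAt 0 x).hasDerivAt
  have h2 : HasDerivAt (fun t => (starRingEnd ℂ e * (γ t - p)).re)
      (starRingEnd ℂ e * deriv γ s).re s :=
    Complex.reCLM.hasFDerivAt.comp_hasDerivAt s
      (((hγ.hasDerivAt s).sub_const p).const_mul (starRingEnd ℂ e))
  have h3 : starRingEnd ℂ e * deriv γ s =
      (1 + deriv h x * I) / (Real.sqrt (1 + deriv h x ^ 2) : ℝ) := by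
    have e1 : deriv γ s = -I * IsC1HolderChart.normal e h x := by
      rw [← hν]; linear_combination deriv γ s * I_mul_I
    have e2 := conj_mul_self_of_norm_eq_one hch.norm_eq_one
    rw [e1, IsC1HolderChart.normal]
    have hS' : ((Real.sqrt (1 + deriv h x ^ 2) : ℝ) : ℂ) ≠ 0 := by exact_mod_cast hS.ne'
    field_simp
    linear_combination (((deriv h x : ℝ) : ℂ) * I + 1) * e2 - starRingEnd ℂ e * e * I_mul_I
  have h4 : (starRingEnd ℂ e * deriv γ s).re = (Real.sqrt (1 + deriv h x ^ 2))⁻¹ := by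
    rw [h3, Complex.div_ofReal_re]
    simp
  have h5 := h1.comp s h2
  rwa [h4, mul_inv_cancel₀ hS.ne'] at h5

/-- The arclength parametrization is determined by its starting point. -/
theorem unique {α : ℝ≥0} (hα₀ : 0 < α) (hΩ : IsC1HolderDomain α Ω)
    (hγ : IsCounterclockwiseArclengthParam Ω b L γ)
    (hσ : IsCounterclockwiseArclengthParam Ω b L σ) : γ = σ := by
  have hγc : Continuous γ := hγ.contDiff.continuous
  have hσc : Continuous σ := hσ.contDiff.continuous
  -- Where the curves meet, both have the same graph arclength in a chart as long as they stay in
  -- it; as that arclength is strictly increasing in the abscissa, they agree nearby. So the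
  -- coincidence set is open as well as closed.
  have hclopen : IsClopen {s | γ s = σ s} := by
    refine ⟨isClosed_eq hγc hσc, isOpen_iff_mem_nhds.2 fun s hs => ?_⟩
    have hs' : γ s = σ s := hs
    obtain ⟨e, h, C, r, hch⟩ := hΩ.boundary.exists_chart (hγ.mem_frontier s)
    have hev : ∀ᶠ t in 𝓝 s, γ t ∈ ball (γ s) r ∧ σ t ∈ ball (γ s) r :=
      (hγc.continuousAt.eventually (ball_mem_nhds _ hch.pos)).and
        (hσc.continuousAt.eventually (by rw [← hs']; exact ball_mem_nhds _ hch.pos))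
    obtain ⟨δ, hδ, hball⟩ := Metric.eventually_nhds_iff_ball.1 hev
    set A : ℝ → ℝ := fun y => ∫ x in (0 : ℝ)..y, Real.sqrt (1 + deriv h x ^ 2) with hA
    have hcont : Continuous fun x => Real.sqrt (1 + deriv h x ^ 2) := by
      have := hch.contDiff.continuous_deriv le_rfl
      fun_prop
    have hmono : StrictMono A := strictMono_of_deriv_pos fun y => by
      rw [(hcont.integral_hasStrictDerivAt 0 y).hasDerivAt.deriv]
      exact Real.sqrt_pos.2 (by positivity)
    have hd : ∀ t ∈ ball s δ, HasDerivAt (fun t => A (starRingEnd ℂ e * (γ t - γ s)).re -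
        A (starRingEnd ℂ e * (σ t - γ s)).re) 0 t := by
      intro t ht
      have := (hγ.hasDerivAt_chart_length hΩ.isOpen hα₀ hch (hball t ht).1).fun_sub
        (hσ.hasDerivAt_chart_length hΩ.isOpen hα₀ hch (hball t ht).2)
      rwa [sub_self] at this
    refine mem_of_superset (ball_mem_nhds s hδ) fun t ht => ?_
    have hconst := isOpen_ball.is_const_of_deriv_eq_zero (convex_ball s δ).isPreconnected
      (fun t ht => (hd t ht).differentiableAt.differentiableWithinAt)
      (fun t ht => (hd t ht).deriv) ht (mem_ball_self hδ)
    simp only [← hs', sub_self] at hconst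
    have hre := hmono.injective (sub_eq_zero.1 hconst)
    have him : (starRingEnd ℂ e * (γ t - γ s)).im = (starRingEnd ℂ e * (σ t - γ s)).im := by
      rw [hch.im_eq hΩ.isOpen (hball t ht).1 (hγ.mem_frontier t),
        hch.im_eq hΩ.isOpen (hball t ht).2 (hσ.mem_frontier t), hre]
    have heq := Complex.ext hre him
    have he0 : starRingEnd ℂ e ≠ 0 :=
      (map_ne_zero _).2 (norm_ne_zero_iff.1 (by rw [hch.norm_eq_one]; exact one_ne_zero))
    exact sub_left_injective (mul_left_cancel₀ he0 heq)
  have huniv := hclopen.eq_univ ⟨0, hγ.start.trans hσ.start.symm⟩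
  funext s
  have : s ∈ {s | γ s = σ s} := by rw [huniv]; trivial
  exact this

theorem hasDerivAt_reflection (hγ : IsCounterclockwiseArclengthParam Ω b L γ) (c m : ℂ) (s : ℝ) :
    HasDerivAt (fun s => c + m * starRingEnd ℂ (γ (-s) - c))
      (-(m * starRingEnd ℂ (deriv γ (-s)))) s := by
  have h1 : HasDerivAt (fun s => γ (-s) - c) (-deriv γ (-s)) s := by
    have := (hγ.hasDerivAt (-s)).scomp s (hasDerivAt_neg s)
    simpa [Function.comp_def] using this.sub_const c
  have h2 : HasDerivAt (fun s => starRingEnd ℂ (γ (-s) - c)) (starRingEnd ℂ (-deriv γ (-s))) s :=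
    (Complex.conjCLE : ℂ →L[ℝ] ℂ).hasFDerivAt.comp_hasDerivAt s h1
  have h3 := (h2.const_mul m).const_add c
  rwa [map_neg, mul_neg] at h3

/-- The reflected curve, traversed backwards, is a parametrization of the boundary of a symmetric
domain. -/
theorem reflection (hγ : IsCounterclockwiseArclengthParam Ω b L γ) (hm : ‖m‖ = 1)
    (hbm : c + m * starRingEnd ℂ (b - c) = b)
    (hΩ : MapsTo (fun z => c + m * starRingEnd ℂ (z - c)) Ω Ω)
    (hfr : MapsTo (fun z => c + m * starRingEnd ℂ (z - c)) (frontier Ω) (frontier Ω)) :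
    IsCounterclockwiseArclengthParam Ω b L
      (fun s => c + m * starRingEnd ℂ (γ (-s) - c)) := by
  have hL := hγ.length_pos
  have hm0 : m ≠ 0 := norm_ne_zero_iff.1 (by rw [hm]; exact one_ne_zero)
  have hder : ∀ s, deriv (fun s => c + m * starRingEnd ℂ (γ (-s) - c)) s =
      -(m * starRingEnd ℂ (deriv γ (-s))) := fun s => (hγ.hasDerivAt_reflection c m s).deriv
  have hper : Function.Periodic (fun s => c + m * starRingEnd ℂ (γ (-s) - c)) L := fun s => by
    have : γ (-(s + L)) = γ (-s) := by rw [neg_add']; exact hγ.periodic.sub_eq (-s)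
    simp only [this]
  refine ⟨hL, ?_, fun s => ?_, hper, ?_, ?_, ?_, fun s => ?_⟩
  · have h1 : ContDiff ℝ 1 fun s => γ (-s) - c := (hγ.contDiff.comp contDiff_neg).sub contDiff_const
    exact contDiff_const.add (contDiff_const.mul
      ((Complex.conjCLE : ℂ →L[ℝ] ℂ).contDiff.comp h1))
  · rw [hder, norm_neg, norm_mul, hm, one_mul, Complex.norm_conj, hγ.norm_deriv]
  · have hinj : ∀ s ∈ Ico 0 L, ∀ t ∈ Ico 0 L, γ (-s) = γ (-t) → s ≤ t := by
      intro s hs t ht heq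
      by_contra! hlt
      have e1 : γ (-s) = γ (L - s) := by rw [sub_eq_neg_add]; exact (hγ.periodic _).symm
      -- For `s` in `(0, L)`, `γ (-s)` is `γ (L - s)` with parameter again in `[0, L)`; at `0` this
      -- would be the excluded endpoint `L`, hence the separate case.
      rcases ht.1.eq_or_lt with h0 | h0
      · have := hγ.injOn (⟨by linarith [hs.2], by linarith⟩ : L - s ∈ Ico 0 L) ⟨le_rfl, hL⟩
          (by rw [← e1, heq, ← h0, neg_zero])
        linarith [hs.2]
      · have e2 : γ (-t) = γ (L - t) := by rw [sub_eq_neg_add]; exact (hγ.periodic _).symm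
        have := hγ.injOn (⟨by linarith [hs.2], by linarith⟩ : L - s ∈ Ico 0 L)
          (⟨by linarith [ht.2], by linarith⟩ : L - t ∈ Ico 0 L) (by rw [← e1, heq, e2])
        linarith
    intro s hs t ht heq
    have heq' : γ (-s) = γ (-t) :=
      sub_left_injective ((starRingEnd ℂ).injective (mul_left_cancel₀ hm0 (add_left_cancel heq)))
    exact le_antisymm (hinj s hs t ht heq') (hinj t ht s hs heq'.symm)
  · refine Subset.antisymm ?_ fun p hp => ?_
    · rintro _ ⟨s, -, rfl⟩
      exact hfr (hγ.mem_frontier _)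
    · have h1 : c + m * starRingEnd ℂ (p - c) ∈ frontier Ω := hfr hp
      rw [← hγ.image_eq] at h1
      obtain ⟨u, -, hu⟩ := h1
      obtain ⟨s, hs, hsu⟩ := hper.exists_mem_Ico₀ hL (-u)
      refine ⟨s, hs, hsu.symm.trans ?_⟩
      have e2 := conj_mul_self_of_norm_eq_one hm
      simp only [neg_neg, hu, add_sub_cancel_left, map_mul, Complex.conj_conj]
      linear_combination (p - c) * e2
  · simp only [neg_zero, hγ.start, hbm]
  -- The reflection reverses orientation and so does running backwards, so the domain remains on the
  -- left.
  · obtain ⟨ε, hε, h⟩ := hγ.interior_left (-s)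
    refine ⟨ε, hε, fun t ht => ?_⟩
    have h1 := hΩ (h t ht)
    rw [hder]
    convert h1 using 1
    simp only [map_sub, map_add, map_mul, Complex.conj_ofReal, conj_I]
    ring

end IsCounterclockwiseArclengthParam

/-- The Riemann map of a symmetric domain, reflected on both sides. -/
theorem IsRiemannMap.reflection {Ω : Set ℂ} {c m : ℂ} {G : ℂ → ℂ} (h : IsRiemannMap Ω c G)
    (hm : ‖m‖ = 1) (hΩ : MapsTo (fun z => c + m * starRingEnd ℂ (z - c)) Ω Ω) :
    IsRiemannMap Ω c (fun z => starRingEnd ℂ (G (c + m * starRingEnd ℂ (z - c)))) := by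
  have e2 := conj_mul_self_of_norm_eq_one hm
  have hinv : ∀ z, c + m * starRingEnd ℂ (c + m * starRingEnd ℂ (z - c) - c) = z := fun z => by
    simp only [add_sub_cancel_left, map_mul, Complex.conj_conj]
    linear_combination (z - c) * e2
  refine ⟨h.isOpen, h.isBounded, h.mem, fun z hz => ?_, ⟨fun z hz => ?_, fun z hz z' hz' heq => ?_,
    fun w hw => ?_⟩, ?_⟩
  · have h1 : DifferentiableAt ℂ G (c + m * (starRingEnd ℂ z - starRingEnd ℂ c)) := by
      rw [← map_sub]
      exact h.differentiableOn.differentiableAt (h.isOpen.mem_nhds (hΩ hz))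
    have h2 : DifferentiableAt ℂ (fun y => G (c + m * (y - starRingEnd ℂ c)))
        (starRingEnd ℂ z) := DifferentiableAt.comp (g := G) _ h1 (by fun_prop)
    have h3 := h2.conj_conj
    rw [Complex.conj_conj] at h3
    simpa only [Function.comp_def, ← map_sub] using h3.differentiableWithinAt
  · have := h.bijOn.mapsTo (hΩ hz)
    rw [mem_ball_zero_iff] at this ⊢
    rwa [Complex.norm_conj]
  · have : c + m * starRingEnd ℂ (z - c) = c + m * starRingEnd ℂ (z' - c) :=
      h.bijOn.injOn (hΩ hz) (hΩ hz') ((starRingEnd ℂ).injective heq)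
    rw [← hinv z, ← hinv z', this]
  · have hw' : starRingEnd ℂ w ∈ ball (0 : ℂ) 1 := by
      rw [mem_ball_zero_iff] at hw ⊢; rwa [Complex.norm_conj]
    obtain ⟨z, hz, hzw⟩ := h.bijOn.surjOn hw'
    refine ⟨_, hΩ hz, ?_⟩
    change starRingEnd ℂ (G (c + m * starRingEnd ℂ (c + m * starRingEnd ℂ (z - c) - c))) = w
    rw [hinv, hzw, Complex.conj_conj]
  · rw [sub_self, map_zero, mul_zero, add_zero, h.eq_zero, map_zero]

/-- The Green function of a symmetric domain is symmetric. -/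
theorem IsRiemannMap.greenFunction_reflection {Ω : Set ℂ} {c m : ℂ} {G : ℂ → ℂ}
    (h : IsRiemannMap Ω c G) (hm : ‖m‖ = 1)
    (hΩ : MapsTo (fun z => c + m * starRingEnd ℂ (z - c)) Ω Ω)
    (hfr : MapsTo (fun z => c + m * starRingEnd ℂ (z - c)) (frontier Ω) (frontier Ω))
    {U : ℂ → ℝ} (hU : IsGreenFunction Ω c U) {z : ℂ} (hz : z ∈ closure Ω) :
    U (c + m * starRingEnd ℂ (z - c)) = U z := by
  by_cases hzΩ : z ∈ Ω
  · rcases eq_or_ne z c with rfl | hzc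
    · simp
    · have hne : c + m * starRingEnd ℂ (z - c) ≠ c := by
        rw [Ne, add_eq_left]
        refine mul_ne_zero (norm_ne_zero_iff.1 (by rw [hm]; exact one_ne_zero)) ?_
        exact (map_ne_zero _).2 (sub_ne_zero.2 hzc)
      rw [(h.reflection hm hΩ).greenFunction_eq hU hzΩ hzc, h.greenFunction_eq hU (hΩ hzΩ) hne,
        Complex.norm_conj]
  · have hzf : z ∈ frontier Ω := by rw [h.isOpen.frontier_eq]; exact ⟨hz, hzΩ⟩
    rw [hU.eq_zero z hzf, hU.eq_zero _ (hfr hzf)]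

/-- The normal derivative of the Green function of a symmetric domain is symmetric. -/
theorem IsGreenFunction.normalDeriv_symm {α : ℝ≥0} (hα₀ : 0 < α) (hα₁ : α < 1)
    {Ω : Set ℂ} (hΩ : IsC1HolderDomain α Ω) {c b m : ℂ} (hc : c ∈ Ω) (hb : b ∈ frontier Ω)
    (hm : ‖m‖ = 1) (hbm : c + m * starRingEnd ℂ (b - c) = b) {U : ℂ → ℝ}
    (hU : IsGreenFunction Ω c U) {L : ℝ} {γ : ℝ → ℂ}
    (hγ : IsCounterclockwiseArclengthParam Ω b L γ) {φ : ℝ → ℝ}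
    (hφ : IsNormalDerivAlong U γ L φ)
    (hR : MapsTo (fun z => c + m * starRingEnd ℂ (z - c)) Ω Ω)
    (hfr : MapsTo (fun z => c + m * starRingEnd ℂ (z - c)) (frontier Ω) (frontier Ω))
    {s : ℝ} (hs : s ∈ Icc 0 L) : φ s = φ (L - s) := by
  obtain ⟨G, hG, -⟩ := exists_isRegularRiemannMap hα₀ hα₁ hΩ hc hb hU
  -- The reflected curve run backwards also starts at `b`, so it is `γ` itself.
  have huniq := hγ.unique hα₀ hΩ (hγ.reflection hm hbm hR hfr)
  have hval : ∀ t, γ t = c + m * starRingEnd ℂ (γ (-t) - c) := fun t => congrFun huniq t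
  have hder : ∀ t, deriv γ t = -(m * starRingEnd ℂ (deriv γ (-t))) := fun t => by
    have := (hγ.hasDerivAt_reflection c m t).deriv
    rwa [← huniq] at this
  have h1 : HasDerivWithinAt (fun t : ℝ => U (γ s + t * (I * deriv γ s))) (φ s) (Ici 0) 0 :=
    hφ s hs
  have h2 : HasDerivWithinAt (fun t : ℝ => U (γ (L - s) + t * (I * deriv γ (L - s))))
    (φ (L - s)) (Ici 0) 0 := hφ _ ⟨by linarith [hs.2], by linarith [hs.1]⟩
  have hγs : γ (L - s) = γ (-s) := by rw [sub_eq_neg_add]; exact hγ.periodic _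
  have hdγ : deriv γ (L - s) = deriv γ (-s) := by
    have : (fun y => γ (y + L)) = γ := funext hγ.periodic
    conv_rhs => rw [← this]
    rw [deriv_comp_add_const, sub_eq_neg_add]
  have hrefl : ∀ t : ℝ, c + m * starRingEnd ℂ (γ s + t * (I * deriv γ s) - c) =
      γ (L - s) + t * (I * deriv γ (L - s)) := by
    intro t
    rw [hγs, hdγ, hval (-s), hder (-s), neg_neg]
    simp only [map_sub, map_add, map_mul, Complex.conj_ofReal, conj_I]
    ring
  obtain ⟨ε, hε, hint⟩ := hγ.interior_left s
  -- The reflection exchanges the inward normal segments at `γ s` and `γ (L - s)`, on which `U`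
  -- therefore takes equal values near the boundary.
  have hev : (fun t : ℝ => U (γ (L - s) + t * (I * deriv γ (L - s)))) =ᶠ[𝓝[≥] 0]
      fun t : ℝ => U (γ s + t * (I * deriv γ s)) := by
    filter_upwards [Ico_mem_nhdsGE hε] with t ht
    rw [← hrefl]
    refine hG.greenFunction_reflection hm hR hfr hU ?_
    rcases ht.1.eq_or_lt with h0 | h0
    · rw [← h0, ofReal_zero, zero_mul, add_zero]
      exact frontier_subset_closure (hγ.mem_frontier s)
    · exact subset_closure (hint t ⟨h0, ht.2⟩)
  have h3 := h1.congr_of_eventuallyEq hev (hev.self_of_nhdsWithin self_mem_Ici)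
  exact (uniqueDiffOn_Ici (0 : ℝ) 0 self_mem_Ici).eq_deriv _ h3 h2

/-! ### The equivalence. -/

theorem theorem3p2 (α : ℝ≥0) (hα₀ : 0 < α) (hα₁ : α < 1)
    (Ω : Set ℂ) (hΩ : IsC1HolderDomain α Ω)
    (ℓ : AffineSubspace ℝ ℂ) [Nonempty ℓ] (hℓ : Module.finrank ℝ ℓ.direction = 1)
    (ζc : ℂ) (hζc : ζc ∈ Ω) (hζcℓ : ζc ∈ ℓ)
    (ζb : ℂ) (hζb : ζb ∈ frontier Ω) (hζbℓ : ζb ∈ ℓ)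
    (U : ℂ → ℝ) (hU : IsGreenFunction Ω ζc U)
    (L : ℝ) (γ : ℝ → ℂ) (hγ : IsCounterclockwiseArclengthParam Ω ζb L γ)
    (φ : ℝ → ℝ) (hφ : IsNormalDerivAlong U γ L φ) :
    EuclideanGeometry.reflection ℓ '' Ω = Ω ↔ ∀ s ∈ Icc 0 L, φ s = φ (L - s) := by
  obtain ⟨m, hm, hR⟩ := exists_reflection_eq ℓ hℓ hζcℓ
  have hbm : ζc + m * starRingEnd ℂ (ζb - ζc) = ζb := by
    rw [← hR]; exact (EuclideanGeometry.reflection_eq_self_iff _).2 hζbℓ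
  have hfun : (fun z => ζc + m * starRingEnd ℂ (z - ζc)) = EuclideanGeometry.reflection ℓ :=
    funext fun z => (hR z).symm
  constructor
  · intro hsym s hs
    refine hU.normalDeriv_symm hα₀ hα₁ hΩ hζc hζb hm hbm hγ hφ ?_ ?_ hs
    · rw [hfun, mapsTo_iff_image_subset, hsym]
    · rw [hfun, mapsTo_iff_image_subset]
      have := (EuclideanGeometry.reflection ℓ).toHomeomorph.image_frontier Ω
      have e : ⇑(EuclideanGeometry.reflection ℓ).toHomeomorph = EuclideanGeometry.reflection ℓ :=
        rfl
      rw [e, hsym] at this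
      exact this.le
  · intro hsymm
    have hmaps := hU.mapsTo_reflection_of_symm hα₀ hα₁ hΩ hζc hζb hm hbm hγ hφ hsymm
    rw [hfun] at hmaps
    -- The reflection is an involution, so mapping the domain into itself already means mapping it
    -- onto itself.
    refine Subset.antisymm hmaps.image_subset fun z hz => ⟨_, hmaps hz, ?_⟩
    exact EuclideanGeometry.reflection_reflection ℓ z
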